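/- **Conventions.** Sorts are built from $o$ by $\to$, with $\mathrm{ord}(o)=0$, $\mathrm{ord}(\alpha\to\beta)=\max(1+\mathrm{ord}(\alpha),\mathrm{ord}(\beta))$. Terms are built by application from sorted variables $x^\alpha$, sorted nonterminals $A^\alpha$ and symbols $a^r$ of sort $o^r\to o$ ($a$ a letter, $r\ge 0$ its rank). A HORS $\mathcal S$ consists of an initial nonterminal $A_{init}$ of sort $o$ and a finite set of rules $A\,x_1\cdots x_m\to K$, with $K$ of sort $o$ using only the distinct variables $x_1,\dots,x_m$ (several rules per nonterminal are allowed); its order is the highest order of a nonterminal that has a rule. One step rewrites one outermost nonterminal: $A\,M_1\cdots M_m\to K[M_1/x_1,\dots,M_m/x_m]$, also below symbols. $\mathcal S$ generates a tree (closed term of sort $o$ without nonterminals) if it is reachable from $A_{init}$. For a finite set $\Delta=\{e_1,\dots,e_n\}$ of nullary symbols, $\mathcal S$ is $\Delta$-narrow if every generated tree has exactly $|\Delta|$ leaves, labeled by pairwise different symbols of $\Delta$. $\mathrm{Diag}_\Sigma(\mathcal S)$ means: for every $N\in\mathbb N$ some tree generated by $\mathcal S$ has at least $N$ occurrences of every letter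 of $\Sigma$. **Construction.** Let $\bullet$ be a letter not used in $\mathcal S$. *Normalization.* Replace every rule $B\,x_1\cdots x_m\to K$ by $B\,y_1\cdots y_n\,x_1\cdots x_m\to K'$, with fresh $y_i$ of sort $o$, where $K'$ is $K$ with $e_i$ replaced by $y_i$, every nullary symbol outside $\Delta$ by $y_1$ (unchanged if $\Delta=\emptyset$), and every nonterminal $C$ by $C\,y_1\cdots y_n$; add a fresh initial nonterminal with the only rule $A_{init}\to A\,e_1\cdots e_n$, where $A$ was initial before. *Types.* The only type of sort $o$ is $r$. A type of sort $\alpha_1\to\dots\to\alpha_m\to o$ is $\Lambda_1\to\dots\to\Lambda_m\to r$, with $\Lambda_i$ a set of labeled types of sort $\alpha_i$, such that $S\cap S'=\emptyset$ whenever $(S,\sigma)\in\Lambda_i$, $(S',\sigma')\in\Lambda_j$ and either $i\ne j$, or $i=j$ and $(S,\sigma)\neq(S',\sigma')$. Labeled types of sort $\alpha$ are pairs $(S,\tau)$, $S\subseteq\Delta$, $\tau$ a type of sort $\alpha$, with $S\neq\emptyset$ if $\alpha=o$; fix a linear order on them. Derivations of $\Gamma\vdash M:(S,\tau)$ ($\Gamma$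 a set of bindings $x:\lambda$; only labeled types may occur) use the rules: $\Gamma\vdash x:\lambda$ if $(x:\lambda)\in\Gamma$; $\Gamma\vdash A:(\emptyset,\tau)$; $\Gamma\vdash a^0:(\{a^0\},r)$ for $a^0\in\Delta$; $\Gamma\vdash a^m:(\emptyset,\{(S_1,r)\}\to\dots\to\{(S_m,r)\}\to r)$ for $m\ge1$; and from $\Gamma\vdash L:(S_0,\Lambda\to\tau)$ and $\Gamma\vdash M:\lambda$ for each $\lambda\in\Lambda$ infer $\Gamma\vdash L\,M:(S_0\cup S_\Lambda,\tau)$, where $S_\Lambda$ is the union of the first coordinates of $\Lambda$, provided $S_0\cap S_\Lambda=\emptyset$. *Translation.* Put $tr(r)=o$ and, for $\Lambda=\{(S_1,\tau_1)<\dots<(S_l,\tau_l)\}$ a set of labeled types of sort $\alpha$, $tr(\Lambda\to\tau)=tr(\tau_1)\to\dots\to tr(\tau_l)\to tr(\tau)$ if $\alpha\ne o$ and $tr(\Lambda\to\tau)=tr(\tau)$ if $\alpha=o$. For a derivation $D$ of $\Gamma\vdash K:\lambda$, $\lambda=(S,\tau)$: $tr(D)=a^0$ if $K=a^m$; $tr(D)=\bullet^0$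 if $K$ is a variable of sort $o$; $tr(D)=x{\restriction}_\lambda$ (of sort $tr(\tau)$) if $K=x$ is another variable; $tr(D)=A{\restriction}_\tau$ (of sort $tr(\tau)$) if $K=A$; and if $K=L\,M$ with immediate subderivations $D_0$ for $L$ and $D_1,\dots,D_l$ (in order) for $M$, then $tr(D)=tr(D_0)$ if $M$ has sort $o$, and $tr(D)=tr(D_0)\,tr(D_1)\cdots tr(D_l)$ otherwise. $tr_{cum}(D)$ is the concatenation of the lists $tr_{cum}(\cdot)$ of the immediate subderivations of $D$ in order, preceded by $tr(D)$ if $K$ has sort $o$. Let $merge(R_1;\dots;R_l)=\bullet^l R_1\cdots R_l$. *The scheme $\mathcal S'$.* Its rules are $A_{init}\to merge(A{\restriction}_{\tau_0};e_1;\dots;e_n)$ with $\tau_0=\{(\{e_1\},r)\}\to\dots\to\{(\{e_n\},r)\}\to r$, and, for every non-initial rule $B\,x_1\cdots x_m\to K$ of the normalized scheme, every type $\tau=\Lambda_1\to\dots\to\Lambda_m\to r$ of the sort of $B$, and every derivation $D$ of $x_1:\Lambda_1,\dots,x_m:\Lambda_m\vdash K:(\bigcup_i S_{\Lambda_i},r)$,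 the rule $B{\restriction}_\tau\,\vec x_1\cdots\vec x_m\to merge(tr_{cum}(D))$, where $\vec x_i$ lists $x_i{\restriction}_\lambda$ for $\lambda\in\Lambda_i$ in order if $x_i$ is not of sort $o$, and is empty otherwise. **Theorem.** Let $k\ge1$, let $\mathcal S$ be a $\Delta$-narrow HORS of order $k$, let $\bullet$ be a letter not used in $\mathcal S$, and let $\mathcal S'$ be constructed as above. Then: 1. $\mathcal S'$ is a HORS, of order at most $k-1$. 2. (Soundness) For every tree $T'$ generated by $\mathcal S'$ there is a tree $T$ generated by $\mathcal S$ such that every letter $a\neq\bullet$ occurs equally often in $T$ and in $T'$. 3. (Completeness) For every tree $T$ generated by $\mathcal S$ there is a tree $T'$ generated by $\mathcal S'$ such that every letter $a\neq\bullet$ occurs equally often in $T$ and in $T'$. 4. For every set of letters $\Sigma$ with $\bullet\notin\Sigma$, $\mathrm{Diag}_\Sigma(\mathcal S)$ holds if and only if $\mathrm{Diag}_\Sigma(\mathcal S')$ holds. -/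

import Mathlib

namespace Hors

universe u v w

/-! ### Sorts and terms -/

/-- Sorts: a single basic sort `o`, closed under the binary operation `arr`. -/
inductive Srt where
  | o : Srt
  | arr : Srt → Srt → Srt
  deriving DecidableEq

/-- The order of a sort. -/
def Srt.ord : Srt → ℕ
  | .o => 0
  | .arr α β => max (1 + α.ord) β.ord

/-- `arrs [α₁, …, αₖ] γ` is the sort `α₁ → … → αₖ → γ`. -/
def Srt.arrs (l : List Srt) (γ : Srt) : Srt := l.foldr Srt.arr γ

/-- `pow r γ` is the sort `o → … → o → γ` with `r` occurrences of `o` before `γ`. -/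
def Srt.pow : ℕ → Srt → Srt
  | 0, γ => γ
  | r + 1, γ => .arr .o (Srt.pow r γ)

/-- Raw applicative terms over letters `L`, names `N` of nonterminals and names `V` of variables.
Variables `x^α` and nonterminals `A^α` carry their sort. A letter `a` can be used with any
rank `r`, giving the symbol `a^r` of sort `o → … → o → o`. -/
inductive Tm (L : Type u) (N : Type v) (V : Type w) where
  | var (x : V) (α : Srt) : Tm L N V
  | nt (A : N) (α : Srt) : Tm L N V
  | sym (a : L) (r : ℕ) : Tm L N V
  | app (K M : Tm L N V) : Tm L N V

/-- `HasSort K α`: `K` is a (well-formed) term of sort `α`. -/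
inductive Tm.HasSort {L : Type u} {N : Type v} {V : Type w} : Tm L N V → Srt → Prop
  | var (x : V) (α : Srt) : HasSort (.var x α) α
  | nt (A : N) (α : Srt) : HasSort (.nt A α) α
  | sym (a : L) (r : ℕ) : HasSort (.sym a r) (Srt.pow r .o)
  | app {K M : Tm L N V} {α β : Srt} :
      HasSort K (.arr α β) → HasSort M α → HasSort (.app K M) β

namespace Tm

variable {L : Type u} {N : Type v} {V : Type w}

/-- The variables occurring in a term. -/
def vars : Tm L N V → Set (V × Srt)
  | .var x α => {(x, α)}
  | .nt _ _ => ∅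
  | .sym _ _ => ∅
  | .app K M => K.vars ∪ M.vars

/-- The nonterminals occurring in a term. -/
def nts : Tm L N V → Set (N × Srt)
  | .var _ _ => ∅
  | .nt A α => {(A, α)}
  | .sym _ _ => ∅
  | .app K M => K.nts ∪ M.nts

/-- The number of occurrences of the letter `a` (used with any rank). -/
def count [DecidableEq L] (a : L) : Tm L N V → ℕ
  | .var _ _ => 0
  | .nt _ _ => 0
  | .sym b _ => if b = a then 1 else 0
  | .app K M => K.count a + M.count a

/-- The labels of the leaves of a tree (its occurrences of nullary symbols), left to right. -/
def leaves : Tm L N V → List L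
  | .var _ _ => []
  | .nt _ _ => []
  | .sym a 0 => [a]
  | .sym _ (_ + 1) => []
  | .app K M => K.leaves ++ M.leaves

/-- `apps K [M₁, …, Mₖ]` is the term `K M₁ … Mₖ`. -/
def apps (K : Tm L N V) (Ms : List (Tm L N V)) : Tm L N V := Ms.foldl Tm.app K

/-- Simultaneous substitution for variables. -/
def subst (σ : V × Srt → Tm L N V) : Tm L N V → Tm L N V
  | .var x α => σ (x, α)
  | .nt A α => .nt A α
  | .sym a r => .sym a r
  | .app K M => .app (K.subst σ) (M.subst σ)

open Classical in
/-- `bind [x₁, …, xₖ] [M₁, …, Mₖ]` is the substitution `[M₁/x₁, …, Mₖ/xₖ]`;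
other variables are left unchanged. -/
noncomputable def bind : List (V × Srt) → List (Tm L N V) → V × Srt → Tm L N V
  | x :: xs, M :: Ms => fun y => if y = x then M else bind xs Ms y
  | _, _ => fun y => .var y.1 y.2

/-- A tree: a closed term of sort `o` without nonterminals. -/
def IsTree (K : Tm L N V) : Prop :=
  K.HasSort .o ∧ K.vars = ∅ ∧ K.nts = ∅

/-- A tree is `Δ`-narrow if it has exactly `|Δ|` leaves, labeled by pairwise different
symbols from `Δ`. -/
def IsNarrow (Δ : Finset L) (K : Tm L N V) : Prop :=
  K.leaves.length = Δ.card ∧ K.leaves.Nodup ∧ ∀ a ∈ K.leaves, a ∈ Δ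

end Tm

/-- Two trees are equivalent if every letter other than the auxiliary letter `bullet` occurs
the same number of times in both. -/
def Equivalent {L : Type u} {N N' : Type*} {V V' : Type*} [DecidableEq L] (bullet : L)
    (K : Tm L N V) (K' : Tm L N' V') : Prop :=
  ∀ a : L, a ≠ bullet → K.count a = K'.count a

/-! ### Recursion schemes -/

/-- A rule `A^α x₁ … xₖ → K`, where `α` is determined by the sorts of the `xᵢ`. -/
structure Rule (L : Type u) (N : Type v) (V : Type w) where
  nt : N
  vars : List (V × Srt)
  body : Tm L N V

/-- The sort of the nonterminal on the left-hand side. -/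
def Rule.sort {L : Type u} {N : Type v} {V : Type w} (R : Rule L N V) : Srt :=
  Srt.arrs (R.vars.map Prod.snd) .o

/-- The data of a recursion scheme: the name of the initial nonterminal (of sort `o`), and a
set of rules. -/
structure Scheme (L : Type u) (N : Type v) (V : Type w) where
  init : N
  rules : Set (Rule L N V)

namespace Scheme

variable {L : Type u} {N : Type v} {V : Type w}

/-- A higher-order recursion scheme: there are finitely many rules, and in each of them the
variables on the left are distinct, and the right side is a term of sort `o` that uses only these
variables. -/
def IsHORS (S : Scheme L N V) : Prop :=
  S.rules.Finite ∧ ∀ R ∈ S.rules,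
    R.vars.Nodup ∧ R.body.HasSort .o ∧ ∀ x ∈ R.body.vars, x ∈ R.vars

/-- The order of a scheme: the highest order of a nonterminal that has a rule. -/
noncomputable def order (S : Scheme L N V) : ℕ :=
  sSup ((fun R : Rule L N V => R.sort.ord) '' S.rules)

/-- One reduction step: a rule is applied to one of the outermost nonterminals. -/
inductive Step (S : Scheme L N V) : Tm L N V → Tm L N V → Prop
  | rule (R : Rule L N V) (hR : R ∈ S.rules) (Ms : List (Tm L N V))
      (hlen : Ms.length = R.vars.length) :
      Step S ((Tm.nt R.nt R.sort).apps Ms) (R.body.subst (Tm.bind R.vars Ms))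
  | sym (a : L) (r : ℕ) (Ks₁ Ks₂ : List (Tm L N V)) (K K' : Tm L N V)
      (hr : Ks₁.length + 1 + Ks₂.length = r) (h : Step S K K') :
      Step S ((Tm.sym a r).apps (Ks₁ ++ K :: Ks₂)) ((Tm.sym a r).apps (Ks₁ ++ K' :: Ks₂))

/-- `S` generates the tree `T` (from its initial nonterminal). -/
def Generates (S : Scheme L N V) (T : Tm L N V) : Prop :=
  T.IsTree ∧ Relation.ReflTransGen S.Step (.nt S.init .o) T

/-- `S` is `Δ`-narrow if it generates only `Δ`-narrow trees. -/
def IsNarrow (Δ : Finset L) (S : Scheme L N V) : Prop :=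
  ∀ T, S.Generates T → T.IsNarrow Δ

/-- The predicate `Diag`: for every `n`, some generated tree has at least `n` occurrences of every
letter from the set `Sig`. -/
def Diag [DecidableEq L] (Sig : Set L) (S : Scheme L N V) : Prop :=
  ∀ n : ℕ, ∃ T, S.Generates T ∧ ∀ a ∈ Sig, n ≤ T.count a

/-- The letter `a` is not used in `S`. -/
def NotUsed [DecidableEq L] (a : L) (S : Scheme L N V) : Prop :=
  ∀ R ∈ S.rules, R.body.count a = 0

end Scheme

/-! ### Normalization: nullary symbols appear only in the initial rule -/

section Normalize

variable {L : Type u} {N : Type v} {V : Type w} [DecidableEq L]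

/-- A fixed enumeration `e₁, …, eₙ` of `Δ`. -/
noncomputable def enum (Δ : Finset L) : List Δ := Δ.attach.toList

/-- The fresh variables `y₁, …, yₙ` of sort `o`, one for each element of `Δ`. -/
noncomputable def freshVars (V : Type w) (Δ : Finset L) : List ((V ⊕ Δ) × Srt) :=
  (enum Δ).map fun e => (Sum.inr e, Srt.o)

/-- The transformation of right-hand sides: `eᵢ ∈ Δ` becomes `yᵢ`, any other nullary symbol
becomes `y₁` (it stays unchanged if `Δ` is empty), and each nonterminal `C` becomes
`C y₁ … yₙ`. -/
noncomputable def normTm (Δ : Finset L) : Tm L N V → Tm L (Option N) (V ⊕ Δ)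
  | .var x α => .var (.inl x) α
  | .nt C γ =>
      (Tm.nt (some C) (Srt.pow (enum Δ).length γ)).apps
        ((freshVars V Δ).map fun y => .var y.1 y.2)
  | .sym a 0 =>
      if h : a ∈ Δ then .var (.inr ⟨a, h⟩) .o
      else match enum Δ with
        | [] => .sym a 0
        | e :: _ => .var (.inr e) .o
  | .sym a (r + 1) => .sym a (r + 1)
  | .app K M => .app (normTm Δ K) (normTm Δ M)

/-- The rule `B x₁ … xₖ → K` becomes `B y₁ … yₙ x₁ … xₖ → K'`. -/
noncomputable def normRule (Δ : Finset L) (R : Rule L N V) : Rule L (Option N) (V ⊕ Δ) where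
  nt := some R.nt
  vars := freshVars V Δ ++ R.vars.map fun x => (Sum.inl x.1, x.2)
  body := normTm Δ R.body

/-- The normalized scheme: the fresh initial nonterminal `none` has the only rule
`none → A e₁ … eₙ`, where `A` was initial before, and the other rules are transformed. -/
noncomputable def normalize (Δ : Finset L) (S : Scheme L N V) :
    Scheme L (Option N) (V ⊕ Δ) where
  init := none
  rules :=
    {⟨none, [], (Tm.nt (some S.init) (Srt.pow (enum Δ).length .o)).apps
        ((enum Δ).map fun e => .sym e.1 0)⟩} ∪ normRule Δ '' S.rules

end Normalize

/-! ### Types -/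

section Types

variable {L : Type u} [DecidableEq L]

/-- Types of sort `α` before imposing the validity conditions. The only type of sort `o` is
`⋆` (the distinguished type `r`); a type of sort `α → β` is a pair `(Λ, τ)`, read `Λ → τ`, of a set
`Λ` of labeled types of sort `α` and a type `τ` of sort `β`. -/
def Ty (Δ : Finset L) : Srt → Type u
  | .o => PUnit
  | .arr α β => Finset (Finset Δ × Ty Δ α) × Ty Δ β

/-- Labeled types `(S, τ)` of sort `α`, before imposing the validity conditions. -/
abbrev LTy (Δ : Finset L) (α : Srt) : Type u := Finset Δ × Ty Δ α

/-- The distinguished type `r` of sort `o`. -/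
def Ty.r {Δ : Finset L} : Ty Δ .o := PUnit.unit

/-- The type `Λ → τ`. -/
def Ty.fn {Δ : Finset L} {α β : Srt} (Λ : Finset (LTy Δ α)) (τ : Ty Δ β) :
    Ty Δ (.arr α β) := (Λ, τ)

/-- The union of the sets on the first coordinates of a set of labeled types. -/
def labelUnion {Δ : Finset L} {α : Srt} (Λ : Finset (LTy Δ α)) : Finset Δ :=
  Λ.biUnion Prod.fst

/-- For `τ = Λ₁ → … → Λₖ → r`, the union of the sets `S` over all `(S, σ)` in the `Λᵢ`. -/
def Ty.labels {Δ : Finset L} : {α : Srt} → Ty Δ α → Finset Δ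
  | .o, _ => ∅
  | .arr _ _, (Λ, τ) => labelUnion Λ ∪ Ty.labels τ

/-- A set of labeled types is separated if the sets on the first coordinates of its distinct
elements are disjoint. -/
def Separated {Δ : Finset L} {α : Srt} (Λ : Finset (LTy Δ α)) : Prop :=
  ∀ l ∈ Λ, ∀ l' ∈ Λ, l ≠ l' → Disjoint l.1 l'.1

/-- `τ = Λ₁ → … → Λₖ → r` is a type in `𝒯^α`: all elements of the `Λᵢ` are labeled types
(with nonempty first coordinate where the sort is `o`), every `Λᵢ` is separated, and for `i ≠ j`
the sets occurring in `Λᵢ` are disjoint from those occurring in `Λⱼ`. The last two conditions say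
together that the supports of the `Λᵢ` are pairwise disjoint and the union of the `Λᵢ` is
separated. -/
def Ty.Valid {Δ : Finset L} : {α : Srt} → Ty Δ α → Prop
  | .o, _ => True
  | .arr α _, (Λ, τ) =>
      (∀ l ∈ Λ, Ty.Valid l.2 ∧ (α = .o → l.1.Nonempty)) ∧
      Separated Λ ∧ Disjoint (labelUnion Λ) (Ty.labels τ) ∧ Ty.Valid τ

/-- `(S, τ)` is a labeled type of sort `α`: `τ` is a type, and `S` is nonempty if `α = o`. -/
def LTy.Valid {Δ : Finset L} {α : Srt} (l : LTy Δ α) : Prop :=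
  Ty.Valid l.2 ∧ (α = .o → l.1.Nonempty)

/-- The type `{(S₁, r)} → … → {(Sₙ, r)} → r`. -/
def leafTy {Δ : Finset L} : (Ss : List (Finset Δ)) → Ty Δ (Srt.pow Ss.length .o)
  | [] => Ty.r
  | S :: Ss => Ty.fn (α := .o) {(S, Ty.r)} (leafTy Ss)

/-- A fixed (arbitrary) linear order on the labeled types of every sort. -/
@[reducible] noncomputable def ltyOrder (Δ : Finset L) (α : Srt) : LinearOrder (LTy Δ α) :=
  letI := Classical.decRel (WellOrderingRel (α := LTy Δ α))
  linearOrderOfSTO WellOrderingRel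

/-- The elements `λ₁ < … < λₖ` of a set of labeled types, listed in the fixed order. -/
noncomputable def sorted {Δ : Finset L} {α : Srt} (Λ : Finset (LTy Δ α)) : List (LTy Δ α) :=
  @Finset.sort _ Λ (ltyOrder Δ α).le (ltyOrder Δ α).toDecidableLE
    ⟨(ltyOrder Δ α).le_trans⟩ ⟨(ltyOrder Δ α).le_antisymm⟩ ⟨(ltyOrder Δ α).le_total⟩

theorem mem_sorted {Δ : Finset L} {α : Srt} {Λ : Finset (LTy Δ α)} {l : LTy Δ α} :
    l ∈ sorted Λ ↔ l ∈ Λ := by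
  simp [sorted]

/-- The sort `tr(τ)`. -/
noncomputable def Ty.tr {Δ : Finset L} : {α : Srt} → Ty Δ α → Srt
  | .o, _ => .o
  | .arr α _, (Λ, τ) =>
      if α = .o then Ty.tr τ
      else Srt.arrs ((sorted Λ).map fun l => Ty.tr l.2) (Ty.tr τ)

/-- Type environments: `Γ x α` is the set of those `λ` for which `Γ` has the binding `x^α : λ`. -/
abbrev Env (V : Type w) (Δ : Finset L) := V → (α : Srt) → Finset (LTy Δ α)

/-- `Deriv N Γ M α S τ` is the type of derivations for `Γ ⊢ M^α : (S, τ)`. In every node the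
labeled type is required to be valid. -/
inductive Deriv (N : Type v) {V : Type w} {Δ : Finset L} (Γ : Env V Δ) :
    Tm L N V → (α : Srt) → Finset Δ → Ty Δ α → Type (max u v w)
  | var (x : V) (α : Srt) (S : Finset Δ) (τ : Ty Δ α) (hx : (S, τ) ∈ Γ x α)
      (hv : LTy.Valid (S, τ)) :
      Deriv N Γ (.var x α) α S τ
  | nt (A : N) (α : Srt) (τ : Ty Δ α) (hv : LTy.Valid (∅, τ)) :
      Deriv N Γ (.nt A α) α ∅ τ
  | leaf (a : L) (ha : a ∈ Δ) :
      Deriv N Γ (.sym a 0) .o {⟨a, ha⟩} Ty.r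
  | sym (a : L) (r : ℕ) (hr : 1 ≤ r) (Ss : List (Finset Δ)) (hlen : Ss.length = r)
      (hv : LTy.Valid (∅, leafTy Ss)) :
      Deriv N Γ (.sym a r) (Srt.pow Ss.length .o) ∅ (leafTy Ss)
  | app (K M : Tm L N V) (α β : Srt) (S S₀ : Finset Δ) (Λ : Finset (LTy Δ α)) (τ : Ty Δ β)
      (D₀ : Deriv N Γ K (.arr α β) S₀ (Ty.fn Λ τ))
      (D : ∀ l ∈ Λ, Deriv N Γ M α l.1 l.2)
      (hdisj : Disjoint S₀ (labelUnion Λ)) (hS : S = S₀ ∪ labelUnion Λ)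
      (hv : LTy.Valid (S, τ)) :
      Deriv N Γ (.app K M) β S τ

end Types

/-! ### The transformation -/

section Transformation

variable {L : Type u} {N : Type v} {V : Type w} [DecidableEq L]

/-- Nonterminals of the new scheme: `none` is the initial nonterminal, and `some (A, ⟨α, τ⟩)` is
the nonterminal `A^α` labeled by the type `τ` of sort `α`. -/
abbrev NT (N : Type v) (Δ : Finset L) := Option (N × (Σ α : Srt, Ty Δ α))

/-- Variables of the new scheme: `(x, ⟨α, l⟩)` is the variable `x^α` labeled by the labeled type
`l` of sort `α`. -/
abbrev VT (V : Type w) (Δ : Finset L) := V × (Σ α : Srt, LTy Δ α)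

/-- The term `tr(D)`; it has sort `tr(τ)`. -/
noncomputable def Deriv.tr (bullet : L) {Δ : Finset L} {Γ : Env V Δ} :
    {M : Tm L N V} → {α : Srt} → {S : Finset Δ} → {τ : Ty Δ α} →
    Deriv N Γ M α S τ → Tm L (NT N Δ) (VT V Δ)
  | _, _, _, _, .var x α S τ _ _ =>
      if α = .o then .sym bullet 0 else .var (x, ⟨α, (S, τ)⟩) τ.tr
  | _, _, _, _, .nt A α τ _ => .nt (some (A, ⟨α, τ⟩)) τ.tr
  | _, _, _, _, .leaf a _ => .sym a 0
  | _, _, _, _, .sym a _ _ _ _ _ => .sym a 0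
  | _, _, _, _, .app _ _ α _ _ _ Λ _ D₀ D _ _ _ =>
      if α = .o then D₀.tr bullet
      else (D₀.tr bullet).apps
        ((sorted Λ).attach.map fun l => (D l.1 (mem_sorted.1 l.2)).tr bullet)

/-- The list `tr_cum(D)` of terms of sort `o`. -/
noncomputable def Deriv.trCum (bullet : L) {Δ : Finset L} {Γ : Env V Δ} :
    {M : Tm L N V} → {α : Srt} → {S : Finset Δ} → {τ : Ty Δ α} →
    Deriv N Γ M α S τ → List (Tm L (NT N Δ) (VT V Δ))
  | _, _, _, _, .var x α S τ hx hv =>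
      if α = .o then [(Deriv.var (N := N) x α S τ hx hv).tr bullet] else []
  | _, _, _, _, .nt A α τ hv =>
      if α = .o then [(Deriv.nt (Γ := Γ) A α τ hv).tr bullet] else []
  | _, _, _, _, .leaf a ha => [(Deriv.leaf (N := N) (Γ := Γ) a ha).tr bullet]
  | _, _, _, _, .sym a r hr Ss hlen hv =>
      if Srt.pow Ss.length .o = .o then
        [(Deriv.sym (N := N) (Γ := Γ) a r hr Ss hlen hv).tr bullet] else []
  | _, _, _, _, .app K M α β S S₀ Λ τ D₀ D hdisj hS hv =>
      (if β = .o then [(Deriv.app K M α β S S₀ Λ τ D₀ D hdisj hS hv).tr bullet] else []) ++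
      (D₀.trCum bullet ++
        ((sorted Λ).attach.map fun l => (D l.1 (mem_sorted.1 l.2)).trCum bullet).flatten)

/-- `merge(R₁; …; Rₖ)` is the term `bullet^k R₁ … Rₖ`. -/
def merge {N' : Type*} {V' : Type*} (bullet : L) (Rs : List (Tm L N' V')) : Tm L N' V' :=
  (Tm.sym bullet Rs.length).apps Rs

/-- For `Γ = x₁ : Λ₁, …, xₖ : Λₖ`, the type `Λ₁ → … → Λₖ → r`. -/
def envTy {Δ : Finset L} (Γ : Env V Δ) :
    (xs : List (V × Srt)) → Ty Δ (Srt.arrs (xs.map Prod.snd) .o)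
  | [] => Ty.r
  | x :: xs => Ty.fn (Γ x.1 x.2) (envTy Γ xs)

/-- The variables of the new scheme that replace the variable `x`: none if `x` has sort `o`, and
otherwise one for every labeled type bound to `x` in `Γ`. -/
noncomputable def splitVar {Δ : Finset L} (Γ : Env V Δ) (x : V × Srt) : List (VT V Δ × Srt) :=
  if x.2 = .o then []
  else (sorted (Γ x.1 x.2)).map fun l => ((x.1, ⟨x.2, l⟩), Ty.tr l.2)

/-- The rule created out of the rule `R`, the environment `Γ = x₁ : Λ₁, …, xₖ : Λₖ`, and a
derivation `D` for the body of `R`. -/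
noncomputable def trRule (bullet : L) {Δ : Finset L} (R : Rule L N V) (Γ : Env V Δ)
    (D : Deriv N Γ R.body .o (envTy Γ R.vars).labels Ty.r) :
    Rule L (NT N Δ) (VT V Δ) where
  nt := some (R.nt, ⟨_, envTy Γ R.vars⟩)
  vars := R.vars.flatMap (splitVar Γ)
  body := merge bullet (D.trCum bullet)

/-- The transformation of a scheme `S` whose only initial rule is `A_init → A e₁ … eₙ`. That rule
is replaced by `A_init → merge(A_τ₀; e₁; …; eₙ)` with `τ₀ = {({e₁}, r)} → … → {({eₙ}, r)} → r`, and
every other rule by the rules for all derivations of its body in all environments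
`x₁ : Λ₁, …, xₖ : Λₖ` for which `Λ₁ → … → Λₖ → r` is a type. -/
noncomputable def lower (bullet : L) (Δ : Finset L) (A : N) (S : Scheme L N V) :
    Scheme L (NT N Δ) (VT V Δ) where
  init := none
  rules :=
    {⟨none, [],
      merge bullet
        (Tm.nt (some (A, ⟨_, leafTy ((enum Δ).map fun e => {e})⟩))
            (leafTy ((enum Δ).map fun e => {e})).tr ::
          (enum Δ).map fun e => Tm.sym e.1 0)⟩} ∪
    {R' | ∃ R ∈ S.rules, R.nt ≠ S.init ∧ ∃ Γ : Env V Δ,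
      (∀ x α, (x, α) ∉ R.vars → Γ x α = ∅) ∧ (envTy Γ R.vars).Valid ∧
      ∃ D : Deriv N Γ R.body .o (envTy Γ R.vars).labels Ty.r, R' = trRule bullet R Γ D}

/-- The order-lowering construction for an arbitrary scheme: normalize it, then transform it. -/
noncomputable def lowering (bullet : L) (Δ : Finset L) (S : Scheme L N V) :
    Scheme L (NT (Option N) Δ) (VT (V ⊕ Δ) Δ) :=
  lower bullet Δ (some S.init) (normalize Δ S)

end Transformation

end Hors

/-!
The transformation rests on a linear type system. A derivation of `Γ ⊢ M : (S, τ)` predicts which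
leaves from `Δ` the tree generated by `M` will contain: they are the elements of `S`, each of them
once. Since the labels of the premises of an application are disjoint and their union is the label
of the conclusion, a derivation uses each of its variables bound to a type with nonempty label
exactly once, whereas variables whose label is empty may be used any number of times, but contribute
nothing to `tr_cum`. Consequently an argument of sort `o`, whose label is nonempty, is used exactly
once, and for counting letters it need not be substituted: its translation can just as well be
produced beside the translation of the head. This is what `tr_cum` and `merge` do. Arguments of sort
`o` disappear, which lowers the order (`Ty.ord_tr_le`).

Only the multisets of letters matter, so reduction is described by a big-step relation `Run` on
multisets of terms, in which independent parts can be separated and joined freely. It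
characterizes the generated trees (`Scheme.IsHORS.exists_generates_iff`). The normalized rules
simulate the original ones and conversely (`Run.normalize`, `Run.of_normalize`); on narrow trees
normalization does not change the symbols. Derivations are replaced by the relation `Translates`,
which keeps of a derivation only its translation and the multiset `tr_cum`.

Soundness (`Run.of_translates`) is subject reduction. Substituting derivations of the arguments into
a derivation of a rule body gives a derivation of the reduct (`Translates.subst`), and its `tr_cum`
is, up to nullary symbols `bullet`, the translation of the body under the corresponding substitution
together with the `tr_cum` of the arguments: the labels of the bindings partition the label of the
body, so each argument derivation with nonempty label is used once, and the others contribute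
nothing.

Completeness (`Run.exists_translates`) is subject expansion. A derivation of a reduct is cut at the
occurrences of the substituted arguments (`Translates.cut`), and the labeled types found there form
the environment for the rule body. The difficulty is that an argument with empty label may be typed
at several places by different derivations of the same type, with different translations, whereas
the transformed rule has just one variable for this type. Therefore only canonical derivations are
used, where the argument set of each application contains all the types with empty label that
the argument has. Their translations are determined by the type (`Translates.unique`), and every
closed term that has a type with empty label has a canonical derivation of it
(`Translates.exists_canonical`).

Finally, the initial rule is handled by showing that `{({e₁}, r)} → … → {({eₙ}, r)} → r` is the only
type with which the old initial nonterminal, applied to `e₁, …, eₙ`, uses all of them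
(`Spine.eq_leafTy_singletons`).
-/


namespace Hors

universe u v w

/-! ### Terms as a head applied to arguments -/

namespace Tm

variable {L : Type u} {N : Type v} {V : Type w}

/-- The number of nodes of a term. -/
def size : Tm L N V → ℕ
  | .var _ _ => 1
  | .nt _ _ => 1
  | .sym _ _ => 1
  | .app K M => K.size + M.size + 1

/-- The head of a term: `head (H M₁ … Mₖ) = H` if `H` is not an application. -/
def head : Tm L N V → Tm L N V
  | .var x α => .var x α
  | .nt A α => .nt A α
  | .sym a r => .sym a r
  | .app K _ => K.head

/-- The arguments of the head of a term. -/
def args : Tm L N V → List (Tm L N V)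
  | .var _ _ => []
  | .nt _ _ => []
  | .sym _ _ => []
  | .app K M => K.args ++ [M]

/-- The symbols of a term, with their ranks. -/
def syms : Tm L N V → Multiset (L × ℕ)
  | .var _ _ => 0
  | .nt _ _ => 0
  | .sym a r => {(a, r)}
  | .app K M => K.syms + M.syms

@[simp] theorem apps_nil (K : Tm L N V) : K.apps [] = K := rfl

@[simp] theorem apps_cons (K M : Tm L N V) (Ms : List (Tm L N V)) :
    K.apps (M :: Ms) = (K.app M).apps Ms := rfl

theorem apps_append (K : Tm L N V) (Ms Ms' : List (Tm L N V)) :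
    K.apps (Ms ++ Ms') = (K.apps Ms).apps Ms' := by
  simp [apps, List.foldl_append]

@[simp] theorem head_apps (K : Tm L N V) (Ms : List (Tm L N V)) : (K.apps Ms).head = K.head := by
  induction Ms generalizing K with
  | nil => rfl
  | cons M Ms ih => simp [ih, head]

@[simp] theorem args_apps (K : Tm L N V) (Ms : List (Tm L N V)) :
    (K.apps Ms).args = K.args ++ Ms := by
  induction Ms generalizing K with
  | nil => simp
  | cons M Ms ih => simp [ih, args]

theorem exists_eq_apps (K : Tm L N V) :
    (∃ x α Ms, K = (Tm.var x α).apps Ms) ∨ (∃ A α Ms, K = (Tm.nt A α).apps Ms) ∨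
      ∃ a r Ms, K = (Tm.sym a r).apps Ms := by
  induction K with
  | var x α => exact .inl ⟨x, α, [], rfl⟩
  | nt A α => exact .inr (.inl ⟨A, α, [], rfl⟩)
  | sym a r => exact .inr (.inr ⟨a, r, [], rfl⟩)
  | app K M ih _ =>
    rcases ih with ⟨x, α, Ms, rfl⟩ | ⟨x, α, Ms, rfl⟩ | ⟨x, α, Ms, rfl⟩
    · exact .inl ⟨x, α, Ms ++ [M], by simp [apps_append]⟩
    · exact .inr (.inl ⟨x, α, Ms ++ [M], by simp [apps_append]⟩)
    · exact .inr (.inr ⟨x, α, Ms ++ [M], by simp [apps_append]⟩)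

theorem sym_apps_inj {a b : L} {r s : ℕ} {Ms Ms' : List (Tm L N V)}
    (h : (Tm.sym a r).apps Ms = (Tm.sym b s).apps Ms') : a = b ∧ r = s ∧ Ms = Ms' := by
  have h1 := congrArg head h
  have h2 := congrArg args h
  simp [head, args] at h1 h2
  exact ⟨h1.1, h1.2, h2⟩

theorem nt_apps_inj {A B : N} {α β : Srt} {Ms Ms' : List (Tm L N V)}
    (h : (Tm.nt A α).apps Ms = (Tm.nt B β).apps Ms') : A = B ∧ α = β ∧ Ms = Ms' := by
  have h1 := congrArg head h
  have h2 := congrArg args h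
  simp [head, args] at h1 h2
  exact ⟨h1.1, h1.2, h2⟩

theorem sym_apps_ne_nt_apps {a : L} {r : ℕ} {A : N} {α : Srt} {Ms Ms' : List (Tm L N V)} :
    (Tm.sym a r).apps Ms ≠ (Tm.nt A α).apps Ms' := by
  intro h
  have h1 := congrArg head h
  simp [head] at h1

theorem size_lt_of_mem_args (H : Tm L N V) {K : Tm L N V} {Ks : List (Tm L N V)} (h : K ∈ Ks) :
    K.size < (H.apps Ks).size := by
  have aux : ∀ (Ks : List (Tm L N V)) (H : Tm L N V),
      H.size ≤ (H.apps Ks).size := by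
    intro Ks
    induction Ks with
    | nil => intro H; rfl
    | cons M Ms ih => intro H; exact le_trans (by simp only [size]; omega) (ih (H.app M))
  induction Ks generalizing H with
  | nil => simp at h
  | cons M Ms ih =>
    rcases List.mem_cons.1 h with rfl | h
    · exact lt_of_lt_of_le (by simp only [size]; omega) (aux Ms (H.app K))
    · exact ih _ h

theorem subst_apps (σ : V × Srt → Tm L N V) (H : Tm L N V) (Ks : List (Tm L N V)) :
    (H.apps Ks).subst σ = (H.subst σ).apps (Ks.map (subst σ)) := by
  induction Ks generalizing H with
  | nil => rfl
  | cons M Ms ih => simp [ih, subst]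

theorem syms_apps (H : Tm L N V) (Ks : List (Tm L N V)) :
    (H.apps Ks).syms = H.syms + (Ks.map syms).sum := by
  induction Ks generalizing H with
  | nil => simp
  | cons M Ms ih => simp [ih, syms, add_assoc]

theorem mem_vars_apps {H : Tm L N V} {Ks : List (Tm L N V)} {x : V × Srt} :
    x ∈ (H.apps Ks).vars ↔ x ∈ H.vars ∨ ∃ K ∈ Ks, x ∈ K.vars := by
  induction Ks generalizing H with
  | nil => simp
  | cons M Ms ih => simp [ih, vars, or_assoc]

theorem mem_nts_apps {H : Tm L N V} {Ks : List (Tm L N V)} {x : N × Srt} :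
    x ∈ (H.apps Ks).nts ↔ x ∈ H.nts ∨ ∃ K ∈ Ks, x ∈ K.nts := by
  induction Ks generalizing H with
  | nil => simp
  | cons M Ms ih => simp [ih, nts, or_assoc]

theorem count_eq_syms [DecidableEq L] (a : L) (K : Tm L N V) :
    K.count a = (K.syms.map Prod.fst).count a := by
  induction K with
  | sym b r =>
    by_cases h : b = a
    · simp [count, syms, h]
    · simp [count, syms, h, Ne.symm h]
  | app K M ih ih' => simp [count, syms, ih, ih']
  | _ => simp [count, syms]

theorem leaves_eq_syms (K : Tm L N V) :
    (K.leaves : Multiset L) = (K.syms.filter (fun p => p.2 = 0)).map Prod.fst := by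
  induction K with
  | sym b r => cases r <;> simp [leaves, syms, Multiset.filter_singleton]
  | app K M ih ih' => simp [leaves, syms, ← ih, ← ih', ← Multiset.coe_add]
  | _ => simp [leaves, syms]

theorem HasSort.unique {K : Tm L N V} {α β : Srt} (h : K.HasSort α) (h' : K.HasSort β) :
    α = β := by
  induction h generalizing β with
  | app _ _ ih _ => cases h' with | app h1 _ => exact (Srt.arr.inj (ih h1)).2
  | _ => cases h'; rfl

theorem hasSort_apps {H : Tm L N V} {Ks : List (Tm L N V)} {β : Srt} :
    (H.apps Ks).HasSort β ↔
      ∃ αs, H.HasSort (Srt.arrs αs β) ∧ List.Forall₂ HasSort Ks αs := by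
  induction Ks generalizing H with
  | nil =>
    constructor
    · intro h; exact ⟨[], h, .nil⟩
    · rintro ⟨_, h, h'⟩
      cases h'
      exact h
  | cons K Ks ih =>
    rw [apps_cons, ih]
    constructor
    · rintro ⟨αs, h, h'⟩
      cases h with
      | @app _ _ α _ h1 h2 => exact ⟨α :: αs, h1, .cons h2 h'⟩
    · rintro ⟨_, h, h'⟩
      cases h' with
      | cons h1 h2 => exact ⟨_, .app h h1, h2⟩

theorem _root_.Hors.Srt.pow_eq_arrs (r : ℕ) (γ : Srt) :
    Srt.pow r γ = Srt.arrs (List.replicate r .o) γ := by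
  induction r with
  | zero => rfl
  | succ r ih => simp [Srt.pow, ih, Srt.arrs, List.replicate_succ]

theorem _root_.Hors.Srt.arrs_o_inj {αs βs : List Srt} (h : Srt.arrs αs .o = Srt.arrs βs .o) :
    αs = βs := by
  induction αs generalizing βs with
  | nil => cases βs with
    | nil => rfl
    | cons => simp [Srt.arrs] at h
  | cons a as ih => cases βs with
    | nil => simp [Srt.arrs] at h
    | cons b bs =>
      have h := Srt.arr.inj h
      rw [h.1, ih h.2]

theorem hasSort_sym_apps {a : L} {r : ℕ} {Ks : List (Tm L N V)}
    (h : ((Tm.sym a r).apps Ks).HasSort .o) : r = Ks.length ∧ ∀ K ∈ Ks, K.HasSort .o := by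
  obtain ⟨αs, h1, h2⟩ := hasSort_apps.1 h
  have h3 := HasSort.unique h1 (.sym a r)
  rw [Srt.pow_eq_arrs] at h3
  have h4 := Srt.arrs_o_inj h3
  subst h4
  have hl := h2.length_eq
  simp at hl
  refine ⟨hl.symm, fun K hK => ?_⟩
  obtain ⟨i, hi, rfl⟩ := List.mem_iff_getElem.1 hK
  have := h2.get hi (by simpa [hl] using hi)
  simpa using this

theorem sym_apps_hasSort {a : L} {Ks : List (Tm L N V)} (h : ∀ K ∈ Ks, K.HasSort .o) :
    ((Tm.sym a Ks.length).apps Ks).HasSort .o := by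
  refine hasSort_apps.2 ⟨List.replicate Ks.length .o, ?_, ?_⟩
  · rw [← Srt.pow_eq_arrs]; exact .sym _ _
  · induction Ks with
    | nil => exact .nil
    | cons K Ks ih =>
      simp only [List.length_cons, List.replicate_succ]
      exact .cons (h _ (by simp)) (ih fun K hK => h _ (by simp [hK]))

theorem nt_apps_hasSort {A : N} {αs : List Srt} {Ks : List (Tm L N V)}
    (h : ((Tm.nt A (Srt.arrs αs .o)).apps Ks).HasSort .o) : List.Forall₂ HasSort Ks αs := by
  obtain ⟨αs', h1, h2⟩ := hasSort_apps.1 h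
  have h3 := HasSort.unique h1 (.nt A _)
  rwa [Srt.arrs_o_inj h3] at h2

/-! ### Substitution -/

theorem bind_map_apply {ι : Type*} (l : List ι) (f : ι → V × Srt) (g : ι → Tm L N V)
    {i : ι} (hi : i ∈ l) (h : ∀ j ∈ l, f j = f i → g j = g i) :
    bind (l.map f) (l.map g) (f i) = g i := by
  induction l with
  | nil => simp at hi
  | cons j l ih =>
    simp only [List.map_cons, bind]
    split_ifs with hj
    · exact h j (by simp) hj.symm
    · refine ih ?_ fun j hj => h j (by simp [hj])
      rcases List.mem_cons.1 hi with rfl | hi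
      · exact absurd rfl hj
      · exact hi

theorem bind_append {xs xs' : List (V × Srt)} {Ms Ms' : List (Tm L N V)}
    (hlen : Ms.length = xs.length) (y : V × Srt) [dec : Decidable (y ∈ xs)] :
    bind (xs ++ xs') (Ms ++ Ms') y = if y ∈ xs then bind xs Ms y else bind xs' Ms' y := by
  have hdec : dec = Classical.propDecidable _ := Subsingleton.elim _ _
  subst hdec
  induction xs generalizing Ms with
  | nil =>
    simp at hlen
    simp [hlen]
  | cons x xs ih =>
    cases Ms with
    | nil => simp at hlen
    | cons M Ms =>
      simp only [List.length_cons, add_left_inj] at hlen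
      by_cases hy : y = x
      · simp [bind, hy]
      · simp only [List.cons_append, bind, hy, if_false]
        rw [ih hlen]
        by_cases h : y ∈ xs <;> simp [h, hy]

theorem bind_map {L' : Type*} {N' : Type*} {V' : Type*} {xs : List (V × Srt)}
    {Ms : List (Tm L N V)} (hlen : Ms.length = xs.length) {f : V × Srt → V' × Srt}
    (hf : Function.Injective f) (φ : Tm L N V → Tm L' N' V') {y : V × Srt} (hy : y ∈ xs) :
    bind (xs.map f) (Ms.map φ) (f y) = φ (bind xs Ms y) := by
  induction xs generalizing Ms with
  | nil => simp at hy
  | cons x xs ih =>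
    cases Ms with
    | nil => simp at hlen
    | cons M Ms =>
      simp only [List.length_cons, add_left_inj] at hlen
      simp only [List.map_cons, bind]
      by_cases h : y = x
      · simp [h]
      · have h' : f y ≠ f x := fun e => h (hf e)
        simp only [h, h', if_false]
        exact ih hlen ((List.mem_cons.1 hy).resolve_left h)

theorem bind_mem {xs : List (V × Srt)} {Ms : List (Tm L N V)} (hlen : Ms.length = xs.length)
    {y : V × Srt} (hy : y ∈ xs) : bind xs Ms y ∈ Ms := by
  induction xs generalizing Ms with
  | nil => simp at hy
  | cons x xs ih =>
    cases Ms with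
    | nil => simp at hlen
    | cons M Ms =>
      simp only [List.length_cons, add_left_inj] at hlen
      by_cases h : y = x
      · simp [bind, h]
      · simp [bind, h, ih hlen ((List.mem_cons.1 hy).resolve_left h)]

theorem hasSort_bind {xs : List (V × Srt)} {Ms : List (Tm L N V)}
    (h : List.Forall₂ HasSort Ms (xs.map Prod.snd)) (y : V × Srt) :
    (bind xs Ms y).HasSort y.2 := by
  induction xs generalizing Ms with
  | nil => cases Ms <;> exact .var _ _
  | cons x xs ih =>
    cases h with
    | cons h1 h2 =>
      simp only [bind]
      split_ifs with hy
      · rwa [hy]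
      · exact ih h2

theorem HasSort.subst {K : Tm L N V} {α : Srt} (h : K.HasSort α) {σ : V × Srt → Tm L N V}
    (hσ : ∀ y, (σ y).HasSort y.2) : (K.subst σ).HasSort α := by
  induction h with
  | var x α => exact hσ (x, α)
  | nt => exact .nt _ _
  | sym => exact .sym _ _
  | app _ _ ih ih' => exact .app ih ih'

theorem vars_subst_eq_empty {K : Tm L N V} {σ : V × Srt → Tm L N V}
    (h : ∀ y ∈ K.vars, (σ y).vars = ∅) : (K.subst σ).vars = ∅ := by
  induction K with
  | var x α => exact h _ rfl
  | nt => rfl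
  | sym => rfl
  | app K M ih ih' =>
    simp only [Tm.subst, vars, Set.union_empty_iff]
    exact ⟨ih fun y hy => h y (.inl hy), ih' fun y hy => h y (.inr hy)⟩

theorem vars_apps_eq_empty {H : Tm L N V} {Ks : List (Tm L N V)} :
    (H.apps Ks).vars = ∅ ↔ H.vars = ∅ ∧ ∀ K ∈ Ks, K.vars = ∅ := by
  simp only [Set.eq_empty_iff_forall_notMem, mem_vars_apps]
  constructor
  · intro h
    exact ⟨fun x hx => h x (.inl hx), fun K hK x hx => h x (.inr ⟨K, hK, hx⟩)⟩
  · rintro ⟨h1, h2⟩ x (hx | ⟨K, hK, hx⟩)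
    exacts [h1 x hx, h2 K hK x hx]

theorem nts_apps_eq_empty {H : Tm L N V} {Ks : List (Tm L N V)} :
    (H.apps Ks).nts = ∅ ↔ H.nts = ∅ ∧ ∀ K ∈ Ks, K.nts = ∅ := by
  simp only [Set.eq_empty_iff_forall_notMem, mem_nts_apps]
  constructor
  · intro h
    exact ⟨fun x hx => h x (.inl hx), fun K hK x hx => h x (.inr ⟨K, hK, hx⟩)⟩
  · rintro ⟨h1, h2⟩ x (hx | ⟨K, hK, hx⟩)
    exacts [h1 x hx, h2 K hK x hx]

end Tm

/-! ### Big-step reduction of multisets of terms -/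

section Run

variable {L : Type u} {N : Type v} {V : Type w}

/-- `Run P m n c`: using the rules from `P` altogether `n` times, the terms of the multiset `m`
can be reduced to trees, and `c` is the multiset of all symbols (with ranks) in these trees. -/
inductive Run (P : Set (Rule L N V)) : Multiset (Tm L N V) → ℕ → Multiset (L × ℕ) → Prop
  | zero : Run P 0 0 0
  | sym (a : L) (Ks : List (Tm L N V)) (m : Multiset (Tm L N V)) (n : ℕ) (c : Multiset (L × ℕ)) :
      Run P (↑Ks + m) n c →
      Run P ((Tm.sym a Ks.length).apps Ks ::ₘ m) n ((a, Ks.length) ::ₘ c)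
  | rule (R : Rule L N V) (hR : R ∈ P) (Ms : List (Tm L N V)) (hlen : Ms.length = R.vars.length)
      (m : Multiset (Tm L N V)) (n : ℕ) (c : Multiset (L × ℕ)) :
      Run P (R.body.subst (Tm.bind R.vars Ms) ::ₘ m) n c →
      Run P ((Tm.nt R.nt R.sort).apps Ms ::ₘ m) (n + 1) c

variable {P : Set (Rule L N V)}

theorem Run.add {m m' : Multiset (Tm L N V)} {n n' : ℕ} {c c' : Multiset (L × ℕ)}
    (h : Run P m n c) (h' : Run P m' n' c') : Run P (m + m') (n + n') (c + c') := by
  induction h with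
  | zero => simpa using h'
  | sym a Ks m n c _ ih =>
    rw [Multiset.cons_add, Multiset.cons_add]
    refine .sym a Ks _ _ _ ?_
    rwa [← add_assoc]
  | rule R hR Ms hlen m n c _ ih =>
    rw [Multiset.cons_add, Nat.add_right_comm]
    refine .rule R hR Ms hlen _ _ _ ?_
    rwa [← Multiset.cons_add]

theorem Run.split {m m' : Multiset (Tm L N V)} {n : ℕ} {c : Multiset (L × ℕ)}
    (h : Run P (m + m') n c) :
    ∃ n₁ n₂ c₁ c₂, Run P m n₁ c₁ ∧ Run P m' n₂ c₂ ∧ n = n₁ + n₂ ∧ c = c₁ + c₂ := by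
  generalize hs : m + m' = s at h
  induction h generalizing m m' with
  | zero =>
    obtain ⟨rfl, rfl⟩ : m = 0 ∧ m' = 0 := by simpa using hs
    exact ⟨0, 0, 0, 0, .zero, .zero, rfl, rfl⟩
  | sym a Ks s n c _ ih =>
    have hmem : (Tm.sym a Ks.length).apps Ks ∈ m + m' := by rw [hs]; simp
    rcases Multiset.mem_add.1 hmem with hm | hm
    · obtain ⟨m, rfl⟩ := Multiset.exists_cons_of_mem hm
      rw [Multiset.cons_add, Multiset.cons_inj_right] at hs
      subst hs
      obtain ⟨n₁, n₂, c₁, c₂, h1, h2, rfl, rfl⟩ := ih (m := ↑Ks + m) (m' := m') (add_assoc _ _ _)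
      exact ⟨n₁, n₂, _, c₂, .sym a Ks m n₁ c₁ h1, h2, rfl, by simp⟩
    · obtain ⟨m', rfl⟩ := Multiset.exists_cons_of_mem hm
      rw [Multiset.add_cons, Multiset.cons_inj_right] at hs
      subst hs
      obtain ⟨n₁, n₂, c₁, c₂, h1, h2, rfl, rfl⟩ :=
        ih (m := m) (m' := ↑Ks + m') (add_left_comm _ _ _)
      exact ⟨n₁, n₂, c₁, _, h1, .sym a Ks m' n₂ c₂ h2, rfl, by simp⟩
  | rule R hR Ms hlen s n c _ ih =>
    have hmem : (Tm.nt R.nt R.sort).apps Ms ∈ m + m' := by rw [hs]; simp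
    rcases Multiset.mem_add.1 hmem with hm | hm
    · obtain ⟨m, rfl⟩ := Multiset.exists_cons_of_mem hm
      rw [Multiset.cons_add, Multiset.cons_inj_right] at hs
      subst hs
      obtain ⟨n₁, n₂, c₁, c₂, h1, h2, rfl, rfl⟩ := ih (Multiset.cons_add _ _ _)
      exact ⟨n₁ + 1, n₂, c₁, c₂, .rule R hR Ms hlen m n₁ c₁ h1, h2, by omega, rfl⟩
    · obtain ⟨m', rfl⟩ := Multiset.exists_cons_of_mem hm
      rw [Multiset.add_cons, Multiset.cons_inj_right] at hs
      subst hs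
      obtain ⟨n₁, n₂, c₁, c₂, h1, h2, rfl, rfl⟩ := ih (Multiset.add_cons _ _ _)
      exact ⟨n₁, n₂ + 1, c₁, c₂, h1, .rule R hR Ms hlen m' n₂ c₂ h2, by omega, rfl⟩

theorem Run.eq_zero {n : ℕ} {c : Multiset (L × ℕ)} (h : Run P 0 n c) : n = 0 ∧ c = 0 := by
  generalize hs : (0 : Multiset (Tm L N V)) = s at h
  cases h with
  | zero => exact ⟨rfl, rfl⟩
  | sym => simp at hs
  | rule => simp at hs

theorem Run.sym_apps {a : L} {r : ℕ} {Ks : List (Tm L N V)} {n : ℕ} {c : Multiset (L × ℕ)}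
    (h : Run P {(Tm.sym a r).apps Ks} n c) :
    r = Ks.length ∧ ∃ c', Run P ↑Ks n c' ∧ c = (a, r) ::ₘ c' := by
  generalize hs : ({(Tm.sym a r).apps Ks} : Multiset (Tm L N V)) = s at h
  cases h with
  | zero => simp at hs
  | sym b Ks' m n c h =>
    rw [Multiset.singleton_eq_cons_iff] at hs
    obtain ⟨hs, rfl⟩ := hs
    obtain ⟨rfl, rfl, rfl⟩ := Tm.sym_apps_inj hs
    exact ⟨rfl, c, by simpa using h, rfl⟩
  | rule R hR Ms hlen m n c h =>
    rw [Multiset.singleton_eq_cons_iff] at hs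
    exact absurd hs.1 Tm.sym_apps_ne_nt_apps

theorem Run.nt_apps {A : N} {α : Srt} {Ms : List (Tm L N V)} {n : ℕ} {c : Multiset (L × ℕ)}
    (h : Run P {(Tm.nt A α).apps Ms} n c) :
    ∃ R ∈ P, R.nt = A ∧ R.sort = α ∧ Ms.length = R.vars.length ∧
      ∃ n', n = n' + 1 ∧ Run P {R.body.subst (Tm.bind R.vars Ms)} n' c := by
  generalize hs : ({(Tm.nt A α).apps Ms} : Multiset (Tm L N V)) = s at h
  cases h with
  | zero => simp at hs
  | sym b Ks' m n c h =>
    rw [Multiset.singleton_eq_cons_iff] at hs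
    exact absurd hs.1.symm Tm.sym_apps_ne_nt_apps
  | rule R hR Ms' hlen m n c h =>
    rw [Multiset.singleton_eq_cons_iff] at hs
    obtain ⟨hs, rfl⟩ := hs
    obtain ⟨h1, h2, rfl⟩ := Tm.nt_apps_inj hs
    exact ⟨R, hR, h1.symm, h2.symm, hlen, n, rfl, h⟩

theorem Run.not_var_apps {x : V} {α : Srt} {Ms : List (Tm L N V)} {n : ℕ}
    {c : Multiset (L × ℕ)} : ¬ Run P {(Tm.var x α).apps Ms} n c := by
  intro h
  generalize hs : ({(Tm.var x α).apps Ms} : Multiset (Tm L N V)) = s at h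
  cases h with
  | zero => simp at hs
  | sym b Ks' m n c h =>
    rw [Multiset.singleton_eq_cons_iff] at hs
    simpa [Tm.head] using congrArg Tm.head hs.1
  | rule R hR Ms' hlen m n c h =>
    rw [Multiset.singleton_eq_cons_iff] at hs
    simpa [Tm.head] using congrArg Tm.head hs.1

theorem Run.forall₂ {Ks : List (Tm L N V)} {n : ℕ} {c : Multiset (L × ℕ)}
    (h : Run P ↑Ks n c) :
    ∃ cs : List (Multiset (L × ℕ)), c = cs.sum ∧
      List.Forall₂ (fun K c => ∃ n' ≤ n, Run P {K} n' c) Ks cs := by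
  induction Ks generalizing n c with
  | nil => exact ⟨[], by simpa using (Run.eq_zero h).2, .nil⟩
  | cons K Ks ih =>
    rw [← Multiset.cons_coe, ← Multiset.singleton_add] at h
    obtain ⟨n₁, n₂, c₁, c₂, h1, h2, rfl, rfl⟩ := h.split
    obtain ⟨cs, rfl, h3⟩ := ih h2
    refine ⟨c₁ :: cs, by simp, .cons ⟨n₁, by omega, h1⟩ (h3.imp ?_)⟩
    rintro K c ⟨n', hn', h⟩
    exact ⟨n', by omega, h⟩

theorem Run.of_forall₂ {Ks : List (Tm L N V)} {cs : List (Multiset (L × ℕ))}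
    (h : List.Forall₂ (fun K c => ∃ n, Run P {K} n c) Ks cs) : ∃ n, Run P ↑Ks n cs.sum := by
  induction h with
  | nil => exact ⟨0, .zero⟩
  | cons h _ ih =>
    obtain ⟨n, h⟩ := h
    obtain ⟨n', h'⟩ := ih
    exact ⟨n + n', by simpa using h.add h'⟩

/-- Induction on the reduction of a single term: a property passes from the arguments to the
application of a symbol, and from the right side of a rule to its left side. -/
theorem Run.single_induction {Q : Tm L N V → Multiset (L × ℕ) → Prop}
    (hsym : ∀ a (Ks : List (Tm L N V)) cs, List.Forall₂ Q Ks cs →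
      Q ((Tm.sym a Ks.length).apps Ks) ((a, Ks.length) ::ₘ cs.sum))
    (hrule : ∀ R ∈ P, ∀ Ms : List (Tm L N V), Ms.length = R.vars.length → ∀ c,
      Q (R.body.subst (Tm.bind R.vars Ms)) c → Q ((Tm.nt R.nt R.sort).apps Ms) c)
    {M : Tm L N V} {n : ℕ} {c : Multiset (L × ℕ)} (h : Run P {M} n c) : Q M c := by
  induction n using Nat.strong_induction_on generalizing M c with
  | _ n ihn =>
    induction hs : M.size using Nat.strong_induction_on generalizing M c with
    | _ s ihs =>
      rcases M.exists_eq_apps with ⟨x, α, Ms, rfl⟩ | ⟨A, α, Ms, rfl⟩ | ⟨a, r, Ms, rfl⟩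
      · exact absurd h Run.not_var_apps
      · obtain ⟨R, hR, rfl, rfl, hlen, n', rfl, h'⟩ := h.nt_apps
        exact hrule R hR Ms hlen c (ihn n' (by omega) h')
      · obtain ⟨rfl, c', h', rfl⟩ := h.sym_apps
        obtain ⟨cs, rfl, h''⟩ := h'.forall₂
        refine hsym a Ms cs ?_
        have hsz : ∀ K ∈ Ms, K.size < s := fun K hK => hs ▸ Tm.size_lt_of_mem_args _ hK
        clear hs h h'
        induction h'' with
        | nil => exact .nil
        | @cons K c Ks cs h1 _ ih =>
          refine .cons ?_ (ih fun K hK => hsz K (by simp [hK]))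
          obtain ⟨n', hn', h1⟩ := h1
          rcases hn'.lt_or_eq with hlt | rfl
          · exact ihn n' hlt h1
          · exact ihs _ (hsz K (by simp)) h1 rfl

/-! ### Generated trees and big-step reduction -/

theorem Tm.IsTree.run {T : Tm L N V} (h : T.IsTree) : Run P {T} 0 T.syms := by
  induction hs : T.size using Nat.strong_induction_on generalizing T with
  | _ s ih =>
    obtain ⟨h1, h2, h3⟩ := h
    rcases T.exists_eq_apps with ⟨x, α, Ms, rfl⟩ | ⟨A, α, Ms, rfl⟩ | ⟨a, r, Ms, rfl⟩
    · simp [Tm.vars_apps_eq_empty, Tm.vars] at h2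
    · simp [Tm.nts_apps_eq_empty, Tm.nts] at h3
    · obtain ⟨rfl, h1'⟩ := Tm.hasSort_sym_apps h1
      have h2' := (Tm.vars_apps_eq_empty.1 h2).2
      have h3' := (Tm.nts_apps_eq_empty.1 h3).2
      have key : Run P (↑Ms) 0 (Ms.map Tm.syms).sum := by
        have hM : ∀ K ∈ Ms, Run P {K} 0 K.syms := fun K hK =>
          ih _ (hs ▸ Tm.size_lt_of_mem_args _ hK) ⟨h1' K hK, h2' K hK, h3' K hK⟩ rfl
        clear hs ih h1 h2 h3 h1' h2' h3'
        induction Ms with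
        | nil => exact .zero
        | cons K Ms ih =>
          have := (hM K (by simp)).add (ih fun K hK => hM K (by simp [hK]))
          simpa using this
      have := Run.sym a Ms 0 0 _ (by simpa using key)
      simpa [Tm.syms_apps, Tm.syms] using this

theorem Run.of_step {S : Scheme L N V} {K K' : Tm L N V} (h : S.Step K K') {n : ℕ}
    {c : Multiset (L × ℕ)} (hr : Run S.rules {K'} n c) : ∃ n', Run S.rules {K} n' c := by
  induction h generalizing n c with
  | rule R hR Ms hlen => exact ⟨n + 1, .rule R hR Ms hlen 0 n c hr⟩
  | sym a r Ks₁ Ks₂ K K' hlen _ ih =>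
    obtain ⟨h1, c', h2, rfl⟩ := hr.sym_apps
    have e : ∀ K : Tm L N V, ((Ks₁ ++ K :: Ks₂ : List _) : Multiset (Tm L N V)) =
        {K} + ((Ks₁ ++ Ks₂ : List _) : Multiset (Tm L N V)) := by
      intro K
      rw [Multiset.singleton_add, Multiset.cons_coe, Multiset.coe_eq_coe]
      exact List.perm_middle
    rw [e] at h2
    obtain ⟨n₁, n₂, c₁, c₂, h3, h4, rfl, rfl⟩ := h2.split
    obtain ⟨n', h5⟩ := ih h3
    have h6 := h5.add h4
    rw [← e] at h6
    have := Run.sym a (Ks₁ ++ K :: Ks₂) 0 _ _ (by simpa using h6)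
    have hr : (Ks₁ ++ K :: Ks₂).length = r := by rw [← hlen]; simp; omega
    rw [hr] at this
    exact ⟨_, this⟩

theorem Run.of_generates {S : Scheme L N V} {T : Tm L N V} (h : S.Generates T) :
    ∃ n, Run S.rules {.nt S.init .o} n T.syms := by
  obtain ⟨hT, h⟩ := h
  generalize Tm.nt S.init Srt.o = K at h
  induction h using Relation.ReflTransGen.head_induction_on with
  | refl => exact ⟨0, hT.run⟩
  | head h1 _ ih =>
    obtain ⟨n, hn⟩ := ih
    exact Run.of_step h1 hn

theorem Scheme.reflTransGen_sym_apps {S : Scheme L N V} (a : L) (r : ℕ)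
    {Ks Ts : List (Tm L N V)} (h : List.Forall₂ (Relation.ReflTransGen S.Step) Ks Ts)
    (Ks₀ : List (Tm L N V)) (hr : Ks₀.length + Ks.length = r) :
    Relation.ReflTransGen S.Step ((Tm.sym a r).apps (Ks₀ ++ Ks))
      ((Tm.sym a r).apps (Ks₀ ++ Ts)) := by
  induction h generalizing Ks₀ with
  | nil => exact .refl
  | @cons K T Ks Ts h1 _ ih =>
    have := ih (Ks₀ ++ [T]) (by simp at hr ⊢; omega)
    simp only [List.append_assoc, List.singleton_append] at this
    refine .trans ?_ this
    clear this
    induction h1 with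
    | refl => exact .refl
    | tail _ h2 ih => exact ih.tail (.sym a r Ks₀ Ks _ _ (by simp at hr; omega) h2)

theorem Run.exists_tree {S : Scheme L N V} (hS : S.IsHORS) {M : Tm L N V} {n : ℕ}
    {c : Multiset (L × ℕ)} (h : Run S.rules {M} n c) (hM : M.HasSort .o) (hv : M.vars = ∅) :
    ∃ T : Tm L N V, T.IsTree ∧ Relation.ReflTransGen S.Step M T ∧ T.syms = c := by
  revert hM hv
  refine Run.single_induction (Q := fun M c => M.HasSort .o → M.vars = ∅ →
    ∃ T : Tm L N V, T.IsTree ∧ Relation.ReflTransGen S.Step M T ∧ T.syms = c) ?_ ?_ h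
  · intro a Ks cs h hM hv
    replace hM := (Tm.hasSort_sym_apps hM).2
    replace hv := (Tm.vars_apps_eq_empty.1 hv).2
    obtain ⟨Ts, h1, h2, h3⟩ : ∃ Ts : List (Tm L N V), (∀ T ∈ Ts, T.IsTree) ∧
        List.Forall₂ (Relation.ReflTransGen S.Step) Ks Ts ∧ (Ts.map Tm.syms) = cs := by
      induction h with
      | nil => exact ⟨[], by simp, .nil, rfl⟩
      | cons h _ ih =>
        obtain ⟨T, hT, h1, h2⟩ := h (hM _ (by simp)) (hv _ (by simp))
        obtain ⟨Ts, hTs, h3, h4⟩ :=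
          ih (fun K hK => hM K (by simp [hK])) (fun K hK => hv K (by simp [hK]))
        refine ⟨T :: Ts, ?_, .cons h1 h3, by simp [h2, h4]⟩
        simpa using ⟨hT, hTs⟩
    refine ⟨(Tm.sym a Ks.length).apps Ts, ⟨?_, ?_, ?_⟩, ?_, ?_⟩
    · rw [h2.length_eq]; exact Tm.sym_apps_hasSort fun T hT => (h1 T hT).1
    · exact Tm.vars_apps_eq_empty.2 ⟨rfl, fun T hT => (h1 T hT).2.1⟩
    · exact Tm.nts_apps_eq_empty.2 ⟨rfl, fun T hT => (h1 T hT).2.2⟩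
    · exact Scheme.reflTransGen_sym_apps a _ h2 [] (by simp)
    · simp [Tm.syms_apps, Tm.syms, h3]
  · intro R hR Ms hlen c h hM hv
    obtain ⟨-, hb, hbv⟩ := hS.2 R hR
    have hMs := Tm.nt_apps_hasSort hM
    have hv := (Tm.vars_apps_eq_empty.1 hv).2
    obtain ⟨T, h1, h2, h3⟩ := h (hb.subst (Tm.hasSort_bind hMs))
      (Tm.vars_subst_eq_empty fun y hy => hv _ (Tm.bind_mem hlen (hbv y hy)))
    exact ⟨T, h1, .head (.rule R hR Ms hlen) h2, h3⟩

/-- A scheme generates a tree with a given multiset of symbols if and only if its initial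
nonterminal reduces to it in the big-step semantics. -/
theorem Scheme.IsHORS.exists_generates_iff {S : Scheme L N V} (hS : S.IsHORS)
    {c : Multiset (L × ℕ)} :
    (∃ T, S.Generates T ∧ T.syms = c) ↔ ∃ n, Run S.rules {.nt S.init .o} n c := by
  constructor
  · rintro ⟨T, hT, rfl⟩
    exact Run.of_generates hT
  · rintro ⟨n, h⟩
    obtain ⟨T, h1, h2, h3⟩ := h.exists_tree hS (.nt _ _) rfl
    exact ⟨T, ⟨h1, h2⟩, h3⟩

end Run

/-! ### Normalization -/

section Norm

variable {L : Type u} {N : Type v} {V : Type w} [DecidableEq L]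

/-- The substitution `[e₁/y₁, …, eₙ/yₙ]` for the fresh variables. -/
def freshSubst (Δ : Finset L) : (V ⊕ Δ) × Srt → Tm L (Option N) (V ⊕ Δ)
  | (.inl x, α) => .var (.inl x) α
  | (.inr e, _) => .sym e.1 0

/-- The normalized term with the symbols from `Δ` put back for the fresh variables. -/
noncomputable def closeTm (Δ : Finset L) (K : Tm L N V) : Tm L (Option N) (V ⊕ Δ) :=
  (normTm Δ K).subst (freshSubst Δ)

/-- The effect of normalization on the symbols of generated trees. -/
noncomputable def normSym (Δ : Finset L) : L × ℕ → L × ℕ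
  | (a, 0) =>
      if a ∈ Δ then (a, 0)
      else match enum Δ with
        | [] => (a, 0)
        | e :: _ => (e.1, 0)
  | (a, r + 1) => (a, r + 1)

/-- The nullary symbols `e₁, …, eₙ` as terms. -/
noncomputable def leafTms (N : Type v) (V : Type w) (Δ : Finset L) : List (Tm L N V) :=
  (enum Δ).map fun e => .sym e.1 0

theorem normSym_snd (Δ : Finset L) (a : L) (r : ℕ) : (normSym Δ (a, r)).2 = r := by
  cases r with
  | zero =>
    simp only [normSym]
    split_ifs
    · rfl
    · split <;> rfl
  | succ r => rfl

theorem closeTm_sym (Δ : Finset L) (a : L) (r : ℕ) :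
    closeTm Δ (.sym a r : Tm L N V) = .sym (normSym Δ (a, r)).1 r := by
  cases r with
  | zero =>
    simp only [closeTm, normTm, normSym]
    split_ifs with h
    · rfl
    · cases enum Δ <;> rfl
  | succ r => rfl

theorem closeTm_nt (Δ : Finset L) (C : N) (γ : Srt) :
    closeTm Δ (.nt C γ : Tm L N V) =
      (Tm.nt (some C) (Srt.pow (enum Δ).length γ)).apps (leafTms _ _ Δ) := by
  simp [closeTm, normTm, Tm.subst_apps, Tm.subst, freshVars, leafTms, Function.comp_def,
    freshSubst]

theorem closeTm_apps (Δ : Finset L) (H : Tm L N V) (Ks : List (Tm L N V)) :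
    closeTm Δ (H.apps Ks) = (closeTm Δ H).apps (Ks.map (closeTm Δ)) := by
  induction Ks generalizing H with
  | nil => rfl
  | cons K Ks ih => rw [Tm.apps_cons, ih]; rfl

theorem normRule_sort (Δ : Finset L) (R : Rule L N V) :
    (normRule Δ R).sort = Srt.pow (enum Δ).length R.sort := by
  have h : (freshVars V Δ).map Prod.snd = List.replicate (enum Δ).length .o := by
    simp [freshVars, Function.comp_def]
  have h2 : (Prod.snd ∘ fun x : V × Srt => ((Sum.inl x.1 : V ⊕ Δ), x.2)) = Prod.snd := rfl
  rw [Srt.pow_eq_arrs]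
  simp only [Rule.sort, normRule, List.map_append, h, Srt.arrs, List.foldr_append, List.map_map, h2]

theorem Srt.pow_injective (n : ℕ) : Function.Injective (Srt.pow n) := by
  induction n with
  | zero => exact fun _ _ h => h
  | succ n ih => exact fun α β h => ih (Srt.arr.inj h).2

theorem mem_enum (Δ : Finset L) (e : Δ) : e ∈ enum Δ := by simp [enum]

theorem inr_mem_freshVars (Δ : Finset L) (e : Δ) : (Sum.inr e, Srt.o) ∈ freshVars V Δ :=
  List.mem_map.2 ⟨e, mem_enum Δ e, rfl⟩

theorem inl_notMem_freshVars (Δ : Finset L) (x : V) (α : Srt) :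
    ((Sum.inl x : V ⊕ Δ), α) ∉ freshVars V Δ := by
  simp [freshVars]

theorem closeTm_subst_bind (Δ : Finset L) {K : Tm L N V} {xs : List (V × Srt)}
    {Ms : List (Tm L N V)} (hlen : Ms.length = xs.length) (hK : ∀ x ∈ K.vars, x ∈ xs) :
    closeTm Δ (K.subst (Tm.bind xs Ms)) =
      (normTm Δ K).subst (Tm.bind (freshVars V Δ ++ xs.map fun x => (Sum.inl x.1, x.2))
        (leafTms _ _ Δ ++ Ms.map (closeTm Δ))) := by
  classical
  have hl : (leafTms (Option N) (V ⊕ Δ) Δ).length = (freshVars V Δ).length := by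
    simp [leafTms, freshVars]
  have hfresh : ∀ e : Δ, Tm.bind (freshVars V Δ ++ xs.map fun x => (Sum.inl x.1, x.2))
      (leafTms (Option N) (V ⊕ Δ) Δ ++ Ms.map (closeTm Δ)) (Sum.inr e, .o) = .sym e.1 0 := by
    intro e
    rw [Tm.bind_append hl, if_pos (inr_mem_freshVars Δ e)]
    exact Tm.bind_map_apply (enum Δ) (fun e => ((Sum.inr e : V ⊕ Δ), Srt.o))
      (fun e => Tm.sym e.1 0) (mem_enum Δ e) (by simp)
  induction K with
  | var x α =>
    simp only [normTm, Tm.subst]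
    rw [Tm.bind_append hl, if_neg (inl_notMem_freshVars Δ x α)]
    have hinj : Function.Injective (fun x : V × Srt => ((Sum.inl x.1 : V ⊕ Δ), x.2)) := by
      rintro ⟨x, α⟩ ⟨y, β⟩ h
      simpa using h
    exact (Tm.bind_map hlen hinj (closeTm Δ) (hK (x, α) rfl)).symm
  | nt C γ =>
    simp only [Tm.subst, closeTm_nt, normTm, Tm.subst_apps]
    congr 1
    generalize Tm.bind _ _ = σ at hfresh ⊢
    simp only [freshVars, leafTms, List.map_map]
    exact List.map_congr_left fun e _ => (hfresh e).symm
  | sym a r =>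
    simp only [Tm.subst, closeTm_sym]
    cases r with
    | zero =>
      simp only [normTm, normSym]
      split_ifs with h
      · exact (hfresh ⟨a, h⟩).symm
      · cases enum Δ with
        | nil => rfl
        | cons e _ => exact (hfresh e).symm
    | succ r => rfl
  | app K M ih ih' =>
    have := ih fun x hx => hK x (.inl hx)
    have h' := ih' fun x hx => hK x (.inr hx)
    simp only [normTm, Tm.subst]
    rw [← this, ← h']
    rfl

/-- The rules of the normalized scheme other than its initial rule simulate the original rules. -/
theorem Run.normalize {P : Set (Rule L N V)} (hP : ∀ R ∈ P, ∀ x ∈ R.body.vars, x ∈ R.vars)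
    (Δ : Finset L) {m : Multiset (Tm L N V)} {n : ℕ} {c : Multiset (L × ℕ)} (h : Run P m n c) :
    Run (normRule Δ '' P) (m.map (closeTm Δ)) n (c.map (normSym Δ)) := by
  induction h with
  | zero => exact .zero
  | sym a Ks m n c _ ih =>
    have := Run.sym (normSym Δ (a, Ks.length)).1 (Ks.map (closeTm Δ)) (m.map (closeTm Δ)) n
      (c.map (normSym Δ)) (by simpa using ih)
    simp only [Multiset.map_cons, closeTm_apps, closeTm_sym]
    convert this using 2
    · simp
    · exact Prod.ext rfl (by simp [normSym_snd])
  | rule R hR Ms hlen m n c _ ih =>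
    simp only [Multiset.map_cons, closeTm_apps, closeTm_nt] at ih ⊢
    rw [closeTm_subst_bind Δ hlen (hP R hR)] at ih
    have := Run.rule (P := normRule Δ '' P) (normRule Δ R) ⟨R, hR, rfl⟩
      (leafTms _ _ Δ ++ Ms.map (closeTm Δ))
      (by simp [leafTms, normRule, freshVars, hlen]) _ _ _ ih
    rwa [normRule_sort, Tm.apps_append] at this

/-- The original rules simulate the rules of the normalized scheme. -/
theorem Run.of_normalize {P : Set (Rule L N V)} (hP : ∀ R ∈ P, ∀ x ∈ R.body.vars, x ∈ R.vars)
    {Δ : Finset L} {M : Tm L N V} (hM : M.vars = ∅) {n : ℕ} {c' : Multiset (L × ℕ)}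
    (h : Run (normRule Δ '' P) {closeTm Δ M} n c') :
    ∃ n c, Run P {M} n c ∧ c.map (normSym Δ) = c' := by
  refine Run.single_induction (Q := fun M' c' => ∀ M : Tm L N V, M.vars = ∅ → closeTm Δ M = M' →
    ∃ n c, Run P {M} n c ∧ c.map (normSym Δ) = c') ?_ ?_ h M hM rfl
  · intro a Ks cs h M hM he
    rcases M.exists_eq_apps with ⟨x, α, Ms, rfl⟩ | ⟨A, α, Ms, rfl⟩ | ⟨b, r, Ms, rfl⟩
    · simp [Tm.vars_apps_eq_empty, Tm.vars] at hM
    · rw [closeTm_apps, closeTm_nt, ← Tm.apps_append] at he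
      exact absurd he.symm Tm.sym_apps_ne_nt_apps
    · rw [closeTm_apps, closeTm_sym] at he
      obtain ⟨h1, h2, rfl⟩ := Tm.sym_apps_inj he
      replace hM := (Tm.vars_apps_eq_empty.1 hM).2
      rw [List.length_map] at h2
      obtain ⟨cs', h3, rfl⟩ : ∃ cs', List.Forall₂ (fun K c => ∃ n, Run P {K} n c) Ms cs' ∧
          cs'.map (Multiset.map (normSym Δ)) = cs := by
        clear h1 h2 he
        induction Ms generalizing cs with
        | nil => cases h; exact ⟨[], .nil, rfl⟩
        | cons K Ks ih =>
          cases h with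
          | cons h1 h2 =>
            obtain ⟨cs', h3, h4⟩ := ih _ h2 fun K hK => hM K (by simp [hK])
            obtain ⟨n, c, h5, h6⟩ := h1 K (hM K (by simp)) rfl
            exact ⟨c :: cs', .cons ⟨n, h5⟩ h3, by simp [h4, h6]⟩
      obtain ⟨n, h4⟩ := Run.of_forall₂ h3
      subst h2
      refine ⟨n, _, .sym b Ms 0 n _ (by simpa using h4), ?_⟩
      have h5 : normSym Δ (b, Ms.length) = (a, Ms.length) :=
        Prod.ext h1 (normSym_snd _ _ _)
      have h6 : (cs'.map (Multiset.map (normSym Δ))).sum = cs'.sum.map (normSym Δ) :=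
        (map_list_sum (Multiset.mapAddMonoidHom (normSym Δ)) cs').symm
      simp [h5, h6]
  · rintro _ ⟨R, hR, rfl⟩ Ms hlen c ih M hM he
    rcases M.exists_eq_apps with ⟨x, α, Ks, rfl⟩ | ⟨A, α, Ks, rfl⟩ | ⟨b, r, Ks, rfl⟩
    · simp [Tm.vars_apps_eq_empty, Tm.vars] at hM
    · rw [closeTm_apps, closeTm_nt, ← Tm.apps_append, normRule_sort] at he
      obtain ⟨h1, h2, rfl⟩ := Tm.nt_apps_inj he
      obtain rfl : A = R.nt := by simpa [normRule] using h1
      obtain rfl := Srt.pow_injective _ h2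
      have hl : Ks.length = R.vars.length := by
        simpa [leafTms, normRule, freshVars] using hlen
      replace hM := (Tm.vars_apps_eq_empty.1 hM).2
      obtain ⟨n, c, h3, h4⟩ := ih (R.body.subst (Tm.bind R.vars Ks))
        (Tm.vars_subst_eq_empty fun y hy => hM _ (Tm.bind_mem hl (hP R hR y hy)))
        (closeTm_subst_bind Δ hl (hP R hR))
      exact ⟨n + 1, c, .rule R hR Ks hl 0 n c h3, h4⟩
    · rw [closeTm_apps, closeTm_sym] at he
      exact absurd he Tm.sym_apps_ne_nt_apps

/-- Right-hand sides of normalized rules contain no nullary symbols from `Δ`. -/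
theorem leaf_notMem_syms_normTm {Δ : Finset L} {a : L} (ha : a ∈ Δ) (K : Tm L N V) :
    (a, 0) ∉ (normTm Δ K).syms := by
  induction K with
  | var x α => simp [normTm, Tm.syms]
  | nt C γ =>
    simp [normTm, Tm.syms_apps, Tm.syms, freshVars, Function.comp_def]
  | sym b r =>
    cases r with
    | zero =>
      simp only [normTm]
      split_ifs with h
      · simp [Tm.syms]
      · split
        · simp only [Tm.syms, Multiset.mem_singleton, Prod.mk.injEq, and_true]
          rintro rfl
          exact h ha
        · simp [Tm.syms]
    | succ r => simp [normTm, Tm.syms]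
  | app K M ih ih' => simp [normTm, Tm.syms, ih, ih']

theorem vars_normTm {Δ : Finset L} {K : Tm L N V} {y : (V ⊕ Δ) × Srt}
    (h : y ∈ (normTm Δ K).vars) :
    y ∈ freshVars V Δ ∨ ∃ x ∈ K.vars, y = (Sum.inl x.1, x.2) := by
  induction K with
  | var x α => exact .inr ⟨(x, α), rfl, h⟩
  | nt C γ =>
    left
    simp only [normTm, Tm.mem_vars_apps, List.mem_map] at h
    rcases h with h | ⟨_, ⟨z, hz, rfl⟩, h⟩
    · exact absurd h (by simp [Tm.vars])
    · rwa [show y = z from h]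
  | sym b r =>
    left
    cases r with
    | zero =>
      simp only [normTm] at h
      split_ifs at h with hb
      · rw [show y = _ from h]; exact inr_mem_freshVars _ _
      · split at h
        · exact absurd h (by simp [Tm.vars])
        · rw [show y = _ from h]; exact inr_mem_freshVars _ _
    | succ r => exact absurd h (by simp [normTm, Tm.vars])
  | app K M ih ih' =>
    rcases h with h | h
    · exact (ih h).imp_right fun ⟨x, hx, e⟩ => ⟨x, .inl hx, e⟩
    · exact (ih' h).imp_right fun ⟨x, hx, e⟩ => ⟨x, .inr hx, e⟩

theorem hasSort_normTm {Δ : Finset L} {K : Tm L N V} {α : Srt} (h : K.HasSort α) :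
    (normTm Δ K).HasSort α := by
  induction h with
  | var x α => exact .var _ _
  | nt C γ =>
    refine Tm.hasSort_apps.2 ⟨List.replicate (enum Δ).length .o, ?_, ?_⟩
    · rw [← Srt.pow_eq_arrs]; exact .nt _ _
    · simp only [freshVars]
      induction enum Δ with
      | nil => exact .nil
      | cons e l ih => exact .cons (.var _ _) ih
  | sym a r =>
    cases r with
    | zero =>
      simp only [normTm]
      split_ifs with hb
      · exact .var _ _
      · split
        · exact .sym _ _
        · exact .var _ _
    | succ r => exact .sym _ _
  | app _ _ ih ih' => exact .app ih ih'

theorem nodup_normRule_vars (Δ : Finset L) {R : Rule L N V} (h : R.vars.Nodup) :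
    (normRule Δ R).vars.Nodup := by
  refine List.Nodup.append ?_ ?_ ?_
  · exact (Finset.nodup_toList _).map fun e e' h => by simpa using h
  · refine h.map ?_
    rintro ⟨x, α⟩ ⟨y, β⟩ h
    simpa using h
  · intro y hy hy'
    obtain ⟨x, -, rfl⟩ := List.mem_map.1 hy'
    exact inl_notMem_freshVars Δ _ _ hy

theorem Scheme.IsHORS.normalize {S : Scheme L N V} (hS : S.IsHORS) (Δ : Finset L) :
    (Hors.normalize Δ S).IsHORS := by
  refine ⟨(Set.finite_singleton _).union (hS.1.image _), ?_⟩
  rintro R (rfl | ⟨R, hR, rfl⟩)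
  · refine ⟨List.nodup_nil, ?_, ?_⟩
    · refine Tm.hasSort_apps.2 ⟨List.replicate (enum Δ).length .o, ?_, ?_⟩
      · rw [← Srt.pow_eq_arrs]; exact .nt _ _
      · induction enum Δ with
        | nil => exact .nil
        | cons e l ih => exact .cons (.sym _ _) ih
    · intro x hx
      simp [Tm.mem_vars_apps, Tm.vars] at hx
  · obtain ⟨h1, h2, h3⟩ := hS.2 R hR
    refine ⟨nodup_normRule_vars Δ h1, hasSort_normTm h2, fun y hy => List.mem_append.2 ?_⟩
    refine (vars_normTm hy).imp_right ?_
    rintro ⟨x, hx, rfl⟩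
    exact List.mem_map.2 ⟨x, h3 x hx, rfl⟩

end Norm

/-! ### Labeled types -/

section TypeLemmas

variable {L : Type u} [DecidableEq L] {Δ : Finset L}

theorem Ty.valid_fn {α β : Srt} {Λ : Finset (LTy Δ α)} {τ : Ty Δ β} :
    Ty.Valid (Ty.fn Λ τ) ↔ (∀ l ∈ Λ, LTy.Valid l) ∧ Separated Λ ∧
      Disjoint (labelUnion Λ) (Ty.labels τ) ∧ Ty.Valid τ := Iff.rfl

@[simp] theorem Ty.labels_fn {α β : Srt} (Λ : Finset (LTy Δ α)) (τ : Ty Δ β) :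
    Ty.labels (Ty.fn Λ τ) = labelUnion Λ ∪ Ty.labels τ := rfl

@[simp] theorem Ty.labels_o (τ : Ty Δ .o) : Ty.labels τ = ∅ := rfl

theorem mem_labelUnion {α : Srt} {Λ : Finset (LTy Δ α)} {e : Δ} :
    e ∈ labelUnion Λ ↔ ∃ l ∈ Λ, e ∈ l.1 := by
  simp only [labelUnion, Finset.mem_biUnion]

theorem subset_labelUnion {α : Srt} {Λ : Finset (LTy Δ α)} {l : LTy Δ α} (hl : l ∈ Λ) :
    l.1 ⊆ labelUnion Λ := fun _ he => mem_labelUnion.2 ⟨l, hl, he⟩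

theorem labelUnion_eq_empty {α : Srt} {Λ : Finset (LTy Δ α)} :
    labelUnion Λ = ∅ ↔ ∀ l ∈ Λ, l.1 = ∅ := by
  constructor
  · intro h l hl
    exact Finset.subset_empty.1 (h ▸ subset_labelUnion hl)
  · intro h
    refine Finset.eq_empty_of_forall_notMem fun e he => ?_
    obtain ⟨l, hl, he⟩ := mem_labelUnion.1 he
    simp [h l hl] at he

theorem LTy.Valid.ne_o {α : Srt} {τ : Ty Δ α} (h : LTy.Valid (∅, τ)) : α ≠ .o := fun e => by
  simpa using h.2 e

theorem coe_sorted {α : Srt} (Λ : Finset (LTy Δ α)) : (sorted Λ : Multiset (LTy Δ α)) = Λ.val := by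
  simp only [sorted, Finset.sort_eq]

theorem nodup_sorted {α : Srt} (Λ : Finset (LTy Δ α)) : (sorted Λ).Nodup := by
  rw [← Multiset.coe_nodup, coe_sorted]
  exact Λ.nodup

theorem attach_sorted_map {α : Srt} {Λ : Finset (LTy Δ α)} {X : Type*}
    (f : {l // l ∈ sorted Λ} → X) (g : LTy Δ α → X) (h : ∀ l, f l = g l.1) :
    (sorted Λ).attach.map f = (sorted Λ).map g := by
  conv_rhs => rw [← List.attach_map_subtype_val (sorted Λ), List.map_map]
  exact List.map_congr_left fun l _ => h l

theorem coe_flatten_map_sorted {α : Srt} {Λ : Finset (LTy Δ α)} {X : Type*}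
    (g : LTy Δ α → List X) :
    (((sorted Λ).map g).flatten : Multiset X) = ∑ l ∈ Λ, (g l : Multiset X) := by
  have h : ∀ ls : List (LTy Δ α), ((ls.map g).flatten : Multiset X) =
      ((ls : Multiset (LTy Δ α)).map fun l => (g l : Multiset X)).sum := by
    intro ls
    induction ls with
    | nil => rfl
    | cons l ls ih =>
      rw [List.map_cons, List.flatten_cons, ← Multiset.coe_add, ih]
      simp
  rw [h, coe_sorted]
  rfl

theorem Ty.finite : ∀ α : Srt, Finite (Ty Δ α)
  | .o => inferInstanceAs (Finite PUnit)
  | .arr α β =>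
    haveI := Ty.finite α
    haveI := Ty.finite β
    inferInstanceAs (Finite (Finset (Finset Δ × Ty Δ α) × Ty Δ β))

theorem leafTy_tr (Ss : List (Finset Δ)) : Ty.tr (leafTy Ss) = .o := by
  induction Ss with
  | nil => rfl
  | cons S Ss ih =>
    exact (if_pos rfl).trans ih

theorem Ty.tr_fn {α β : Srt} (Λ : Finset (LTy Δ α)) (τ : Ty Δ β) :
    Ty.tr (Ty.fn Λ τ) = if α = .o then Ty.tr τ
      else Srt.arrs ((sorted Λ).map fun l => Ty.tr l.2) (Ty.tr τ) := by
  rw [Ty.fn, Ty.tr]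

end TypeLemmas

/-! ### Derivations together with their translations -/

/-- The only sort that a term can have, determined from its head. -/
def Tm.srt {L : Type u} {N : Type v} {V : Type w} : Tm L N V → Srt
  | .var _ α => α
  | .nt _ α => α
  | .sym _ r => Srt.pow r .o
  | .app K _ => match K.srt with
    | .arr _ β => β
    | .o => .o

section Translates

variable {L : Type u} {N : Type v} {V : Type w} [DecidableEq L] (bullet : L) {Δ : Finset L}

/-- `Translates bullet P Γ M α S τ t ts`: there is a derivation `D` of `Γ ⊢ M : (S, τ)`, where `M`
is of sort `α`, with `tr(D) = t` and `ts` the multiset of the elements of `tr_cum(D)`. Moreover, at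
every application node of `D` the argument, its sort, and the set of labeled types derived for it
satisfy the side condition `P`. -/
inductive Translates (P : Tm L N V → (α : Srt) → Finset (LTy Δ α) → Prop) (Γ : Env V Δ) :
    Tm L N V → (α : Srt) → Finset Δ → Ty Δ α →
      Tm L (NT N Δ) (VT V Δ) → Multiset (Tm L (NT N Δ) (VT V Δ)) → Prop
  | var (x : V) (α : Srt) (S : Finset Δ) (τ : Ty Δ α) (hx : (S, τ) ∈ Γ x α)
      (hv : LTy.Valid (S, τ)) :
      Translates P Γ (.var x α) α S τ
        (if α = .o then .sym bullet 0 else .var (x, ⟨α, (S, τ)⟩) τ.tr)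
        (if α = .o then {.sym bullet 0} else 0)
  | nt (A : N) (α : Srt) (τ : Ty Δ α) (hv : LTy.Valid (∅, τ)) :
      Translates P Γ (.nt A α) α ∅ τ (.nt (some (A, ⟨α, τ⟩)) τ.tr) 0
  | leaf (a : L) (ha : a ∈ Δ) :
      Translates P Γ (.sym a 0) .o {⟨a, ha⟩} Ty.r (.sym a 0) {.sym a 0}
  | sym (a : L) (r : ℕ) (hr : 1 ≤ r) (Ss : List (Finset Δ)) (hlen : Ss.length = r)
      (hv : LTy.Valid (∅, leafTy Ss)) :
      Translates P Γ (.sym a r) (Srt.pow Ss.length .o) ∅ (leafTy Ss) (.sym a 0) 0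
  | app (K M : Tm L N V) (α β : Srt) (S₀ : Finset Δ) (Λ : Finset (LTy Δ α)) (τ : Ty Δ β)
      (t₀ : Tm L (NT N Δ) (VT V Δ)) (ts₀ : Multiset (Tm L (NT N Δ) (VT V Δ)))
      (t : LTy Δ α → Tm L (NT N Δ) (VT V Δ)) (ts : LTy Δ α → Multiset (Tm L (NT N Δ) (VT V Δ)))
      (hP : P M α Λ)
      (h₀ : Translates P Γ K (.arr α β) S₀ (Ty.fn Λ τ) t₀ ts₀)
      (h : ∀ l ∈ Λ, Translates P Γ M α l.1 l.2 (t l) (ts l))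
      (hdisj : Disjoint S₀ (labelUnion Λ))
      (hv : LTy.Valid (S₀ ∪ labelUnion Λ, τ)) :
      Translates P Γ (.app K M) β (S₀ ∪ labelUnion Λ) τ
        (if α = .o then t₀ else t₀.apps ((sorted Λ).map t))
        ((if β = .o then {if α = .o then t₀ else t₀.apps ((sorted Λ).map t)} else 0) + ts₀ +
          ∑ l ∈ Λ, ts l)

/-- The trivial side condition on application nodes. -/
def anyArg (_ : Tm L N V) (α : Srt) (_ : Finset (LTy Δ α)) : Prop := True

variable {bullet} {P : Tm L N V → (α : Srt) → Finset (LTy Δ α) → Prop} {Γ : Env V Δ}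
  {M : Tm L N V} {α : Srt} {S : Finset Δ} {τ : Ty Δ α}
  {t : Tm L (NT N Δ) (VT V Δ)} {ts : Multiset (Tm L (NT N Δ) (VT V Δ))}

theorem Translates.mono {P' : Tm L N V → (α : Srt) → Finset (LTy Δ α) → Prop}
    (h : Translates bullet P Γ M α S τ t ts) (hP : ∀ M α Λ, P M α Λ → P' M α Λ) :
    Translates bullet P' Γ M α S τ t ts := by
  induction h with
  | var x α S τ hx hv => exact .var x α S τ hx hv
  | nt A α τ hv => exact .nt A α τ hv
  | leaf a ha => exact .leaf a ha
  | sym a r hr Ss hlen hv => exact .sym a r hr Ss hlen hv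
  | app K M α β S₀ Λ τ t₀ ts₀ t ts hPM _ _ hdisj hv ih₀ ih =>
    exact .app K M α β S₀ Λ τ t₀ ts₀ t ts (hP _ _ _ hPM) ih₀ ih hdisj hv

theorem Translates.valid (h : Translates bullet P Γ M α S τ t ts) : LTy.Valid (S, τ) := by
  cases h with
  | leaf a ha => exact ⟨trivial, fun _ => Finset.singleton_nonempty _⟩
  | _ => assumption

theorem Translates.srt_eq (h : Translates bullet P Γ M α S τ t ts) : M.srt = α := by
  induction h with
  | sym a r hr Ss hlen hv => subst hlen; rfl
  | app K M α β S₀ Λ τ t₀ ts₀ t ts hPM h₀ _ hdisj hv ih₀ ih => simp [Tm.srt, ih₀]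
  | _ => rfl

/-- A derivation with empty label contributes nothing to `tr_cum`. -/
theorem Translates.eq_zero (h : Translates bullet P Γ M α S τ t ts) (hS : S = ∅) : ts = 0 := by
  induction h with
  | var x α S τ hx hv =>
    subst hS
    simp [hv.ne_o]
  | nt A α τ hv => rfl
  | leaf a ha => simp at hS
  | sym a r hr Ss hlen hv => rfl
  | app K M α β S₀ Λ τ t₀ ts₀ t ts hPM _ _ hdisj hv ih₀ ih =>
    rw [hS] at hv
    rw [Finset.union_eq_empty, labelUnion_eq_empty] at hS
    rw [if_neg hv.ne_o, ih₀ hS.1, Finset.sum_eq_zero fun l hl => ih l hl (hS.2 l hl)]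
    rfl

theorem Deriv.translates (D : Deriv N Γ M α S τ) :
    Translates bullet anyArg Γ M α S τ (D.tr bullet) (D.trCum bullet) := by
  induction D with
  | var x α S τ hx hv =>
    have := Translates.var (bullet := bullet) (P := anyArg (N := N)) x α S τ hx hv
    by_cases h : α = .o
    · simpa [Deriv.tr, Deriv.trCum, h] using this
    · simpa [Deriv.tr, Deriv.trCum, h] using this
  | nt A α τ hv =>
    simpa [Deriv.tr, Deriv.trCum, hv.ne_o] using Translates.nt A α τ hv
  | leaf a ha => exact .leaf a ha
  | sym a r hr Ss hlen hv =>
    have := Translates.sym (bullet := bullet) (P := anyArg (N := N)) (Γ := Γ) a r hr Ss hlen hv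
    simpa [Deriv.tr, Deriv.trCum, hv.ne_o] using this
  | app K M α β S S₀ Λ τ D₀ D hdisj hS hv ih₀ ih =>
    subst hS
    classical
    set t : LTy Δ α → Tm L (NT N Δ) (VT V Δ) :=
      fun l => if h : l ∈ Λ then (D l h).tr bullet else .sym bullet 0 with ht
    set ts : LTy Δ α → List (Tm L (NT N Δ) (VT V Δ)) :=
      fun l => if h : l ∈ Λ then (D l h).trCum bullet else [] with hts
    have := Translates.app K M α β S₀ Λ τ _ _ t (fun l => (ts l : Multiset _)) trivial ih₀
      (fun l hl => by simpa [ht, hts, hl] using ih l hl) hdisj hv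
    have e1 : (sorted Λ).attach.map (fun l => (D l.1 (mem_sorted.1 l.2)).tr bullet) =
        (sorted Λ).map t := attach_sorted_map _ _ fun l => by simp [ht, mem_sorted.1 l.2]
    have e2 : (sorted Λ).attach.map (fun l => (D l.1 (mem_sorted.1 l.2)).trCum bullet) =
        (sorted Λ).map ts := attach_sorted_map _ _ fun l => by simp [hts, mem_sorted.1 l.2]
    rw [Deriv.trCum, Deriv.tr, e1, e2, ← Multiset.coe_add, ← Multiset.coe_add,
      coe_flatten_map_sorted, ← add_assoc]
    by_cases hβ : β = .o
    · simpa only [hβ, if_true, Multiset.coe_singleton] using this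
    · simpa only [hβ, if_false, Multiset.coe_nil] using this

theorem Translates.exists_deriv (h : Translates bullet P Γ M α S τ t ts) :
    ∃ D : Deriv N Γ M α S τ, D.tr bullet = t ∧ (D.trCum bullet : Multiset _) = ts := by
  induction h with
  | var x α S τ hx hv =>
    refine ⟨.var x α S τ hx hv, by rw [Deriv.tr], ?_⟩
    rw [Deriv.trCum, Deriv.tr]
    split_ifs <;> rfl
  | nt A α τ hv =>
    refine ⟨.nt A α τ hv, by rw [Deriv.tr], ?_⟩
    simp [Deriv.trCum, hv.ne_o]
  | leaf a ha => exact ⟨.leaf a ha, rfl, rfl⟩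
  | sym a r hr Ss hlen hv =>
    refine ⟨.sym a r hr Ss hlen hv, by rw [Deriv.tr], ?_⟩
    simp [Deriv.trCum, hv.ne_o]
  | app K M α β S₀ Λ τ t₀ ts₀ t ts hPM _ _ hdisj hv ih₀ ih =>
    obtain ⟨D₀, rfl, rfl⟩ := ih₀
    choose D hD using ih
    refine ⟨.app K M α β _ S₀ Λ τ D₀ D hdisj rfl hv, ?_⟩
    classical
    set ts' : LTy Δ α → List (Tm L (NT N Δ) (VT V Δ)) :=
      fun l => if h : l ∈ Λ then (D l h).trCum bullet else [] with hts
    have e1 : (sorted Λ).attach.map (fun l => (D l.1 (mem_sorted.1 l.2)).tr bullet) =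
        (sorted Λ).map t := attach_sorted_map _ _ fun l => (hD l.1 (mem_sorted.1 l.2)).1
    have e2 : (sorted Λ).attach.map (fun l => (D l.1 (mem_sorted.1 l.2)).trCum bullet) =
        (sorted Λ).map ts' := attach_sorted_map _ _ fun l => by simp [hts, mem_sorted.1 l.2]
    have e3 : ∑ l ∈ Λ, (ts' l : Multiset _) = ∑ l ∈ Λ, ts l :=
      Finset.sum_congr rfl fun l hl => by simp only [hts, dif_pos hl]; exact (hD l hl).2
    have e4 : Deriv.tr bullet (.app K M α β _ S₀ Λ τ D₀ D hdisj rfl hv) =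
        if α = .o then D₀.tr bullet else (D₀.tr bullet).apps ((sorted Λ).map t) := by
      rw [Deriv.tr, e1]
    refine ⟨e4, ?_⟩
    rw [Deriv.trCum, e4, e2, ← Multiset.coe_add, ← Multiset.coe_add,
      coe_flatten_map_sorted, e3, ← add_assoc]
    by_cases hβ : β = .o
    · simp only [hβ, if_true, Multiset.coe_singleton]
    · simp only [hβ, if_false, Multiset.coe_nil]

/-- The translation of a derivation is a term of sort `tr(τ)` over the split variables, and the
elements of `tr_cum` are such terms of sort `o`. -/
theorem Translates.output (h : Translates bullet P Γ M α S τ t ts) :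
    (t.HasSort τ.tr ∧ ∀ y ∈ t.vars, ∃ x α l, α ≠ .o ∧ l ∈ Γ x α ∧ y = ((x, ⟨α, l⟩), Ty.tr l.2)) ∧
      ∀ s ∈ ts, s.HasSort .o ∧
        ∀ y ∈ s.vars, ∃ x α l, α ≠ .o ∧ l ∈ Γ x α ∧ y = ((x, ⟨α, l⟩), Ty.tr l.2) := by
  induction h with
  | var x α S τ hx hv =>
    split_ifs with h
    · subst h
      have h1 : (Tm.sym bullet 0 : Tm L (NT N Δ) (VT V Δ)).HasSort .o := .sym bullet 0
      refine ⟨⟨h1, by simp [Tm.vars]⟩, ?_⟩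
      simpa [Tm.vars] using h1
    · refine ⟨⟨.var _ _, ?_⟩, by simp⟩
      intro y hy
      exact ⟨x, α, (S, τ), h, hx, hy⟩
  | nt A α τ hv => exact ⟨⟨.nt _ _, by simp [Tm.vars]⟩, by simp⟩
  | leaf a ha =>
    have h1 : (Tm.sym a 0 : Tm L (NT N Δ) (VT V Δ)).HasSort .o := .sym a 0
    refine ⟨⟨h1, by simp [Tm.vars]⟩, ?_⟩
    simpa [Tm.vars] using h1
  | sym a r hr Ss hlen hv =>
    refine ⟨⟨?_, by simp [Tm.vars]⟩, by simp⟩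
    rw [leafTy_tr]
    exact .sym a 0
  | app K M α β S₀ Λ τ t₀ ts₀ t ts hPM _ _ hdisj hv ih₀ ih =>
    have key : (if α = .o then t₀ else t₀.apps ((sorted Λ).map t)).HasSort τ.tr ∧
        ∀ y ∈ (if α = .o then t₀ else t₀.apps ((sorted Λ).map t)).vars,
          ∃ x α l, α ≠ .o ∧ l ∈ Γ x α ∧ y = ((x, ⟨α, l⟩), Ty.tr l.2) := by
      obtain ⟨⟨h1, h2⟩, -⟩ := ih₀
      rw [Ty.tr_fn] at h1
      split_ifs at h1 ⊢ with hα
      · exact ⟨h1, h2⟩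
      · constructor
        · refine Tm.hasSort_apps.2 ⟨_, h1, ?_⟩
          rw [List.forall₂_map_left_iff, List.forall₂_map_right_iff, List.forall₂_same]
          exact fun l hl => (ih l (mem_sorted.1 hl)).1.1
        · intro y hy
          rcases Tm.mem_vars_apps.1 hy with hy | ⟨K, hK, hy⟩
          · exact h2 y hy
          · obtain ⟨l, hl, rfl⟩ := List.mem_map.1 hK
            exact (ih l (mem_sorted.1 hl)).1.2 y hy
    generalize (if α = .o then t₀ else t₀.apps ((sorted Λ).map t)) = t' at key ⊢
    refine ⟨key, fun s hs => ?_⟩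
    rw [Multiset.mem_add, Multiset.mem_add] at hs
    rcases hs with (hs | hs) | hs
    · split_ifs at hs with hβ
      · subst hβ
        rw [Multiset.mem_singleton] at hs
        subst hs
        exact key
      · simp at hs
    · exact ih₀.2 s hs
    · obtain ⟨l, hl, hs⟩ := Multiset.mem_sum.1 hs
      exact (ih l hl).2 s hs

end Translates

/-! ### Derivations for a head applied to arguments -/

section Spine

variable {L : Type u} {N : Type v} {V : Type w} [DecidableEq L] (bullet : L) {Δ : Finset L}

/-- `Spine bullet P Γ Ks α τ as ts`, for a list `Ks` of arguments and a type
`τ = Λ₁ → … → Λₖ → r` of sort `α`: the arguments `K₁, …, Kₖ` have derivations for all elements of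
the respective sets `Λᵢ`; `as` lists the translations of the arguments of sorts different
from `o`, and `ts` collects the elements of `tr_cum` for all arguments. -/
def Spine (P : Tm L N V → (α : Srt) → Finset (LTy Δ α) → Prop) (Γ : Env V Δ) :
    List (Tm L N V) → (α : Srt) → Ty Δ α →
      List (Tm L (NT N Δ) (VT V Δ)) → Multiset (Tm L (NT N Δ) (VT V Δ)) → Prop
  | [], .o, _, as, ts => as = [] ∧ ts = 0
  | K :: Ks, .arr α β, (Λ, τ), as, ts =>
      P K α Λ ∧ ∃ (t : LTy Δ α → Tm L (NT N Δ) (VT V Δ))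
        (u : LTy Δ α → Multiset (Tm L (NT N Δ) (VT V Δ))) (as' : List (Tm L (NT N Δ) (VT V Δ)))
        (ts' : Multiset (Tm L (NT N Δ) (VT V Δ))),
        (∀ l ∈ Λ, Translates bullet P Γ K α l.1 l.2 (t l) (u l)) ∧
        Spine P Γ Ks β τ as' ts' ∧
        as = (if α = .o then [] else (sorted Λ).map t) ++ as' ∧
        ts = (∑ l ∈ Λ, u l) + ts'
  | [], .arr _ _, _, _, _ => False
  | _ :: _, .o, _, _, _ => False

variable {bullet} {P : Tm L N V → (α : Srt) → Finset (LTy Δ α) → Prop} {Γ : Env V Δ}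

theorem spine_nil {τ : Ty Δ .o} {as : List (Tm L (NT N Δ) (VT V Δ))}
    {ts : Multiset (Tm L (NT N Δ) (VT V Δ))} :
    Spine bullet P Γ [] .o τ as ts ↔ as = [] ∧ ts = 0 := by rw [Spine]

theorem spine_cons {K : Tm L N V} {Ks : List (Tm L N V)} {α β : Srt} {Λ : Finset (LTy Δ α)}
    {τ : Ty Δ β} {as : List (Tm L (NT N Δ) (VT V Δ))}
    {ts : Multiset (Tm L (NT N Δ) (VT V Δ))} :
    Spine bullet P Γ (K :: Ks) (.arr α β) (Ty.fn Λ τ) as ts ↔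
      P K α Λ ∧ ∃ (t : LTy Δ α → Tm L (NT N Δ) (VT V Δ))
        (u : LTy Δ α → Multiset (Tm L (NT N Δ) (VT V Δ))) (as' : List (Tm L (NT N Δ) (VT V Δ)))
        (ts' : Multiset (Tm L (NT N Δ) (VT V Δ))),
        (∀ l ∈ Λ, Translates bullet P Γ K α l.1 l.2 (t l) (u l)) ∧
        Spine bullet P Γ Ks β τ as' ts' ∧
        as = (if α = .o then [] else (sorted Λ).map t) ++ as' ∧
        ts = (∑ l ∈ Λ, u l) + ts' := by rw [Ty.fn, Spine]

theorem not_spine_nil_arr {α β : Srt} {τ : Ty Δ (.arr α β)} {as : List (Tm L (NT N Δ) (VT V Δ))}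
    {ts : Multiset (Tm L (NT N Δ) (VT V Δ))} : ¬ Spine bullet P Γ [] (.arr α β) τ as ts := by
  rw [Spine]; exact id

theorem not_spine_cons_o {K : Tm L N V} {Ks : List (Tm L N V)} {τ : Ty Δ .o}
    {as : List (Tm L (NT N Δ) (VT V Δ))}
    {ts : Multiset (Tm L (NT N Δ) (VT V Δ))} : ¬ Spine bullet P Γ (K :: Ks) .o τ as ts := by
  rw [Spine]; exact id

theorem Spine.eq_nil {Ks : List (Tm L N V)} {τ : Ty Δ .o}
    {as : List (Tm L (NT N Δ) (VT V Δ))}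
    {ts : Multiset (Tm L (NT N Δ) (VT V Δ))} (h : Spine bullet P Γ Ks .o τ as ts) :
    Ks = [] ∧ as = [] ∧ ts = 0 := by
  cases Ks with
  | nil => exact ⟨rfl, spine_nil.1 h⟩
  | cons => exact absurd h not_spine_cons_o

/-- Inversion of application nodes. -/
theorem Translates.app_inv {K M : Tm L N V} {β : Srt} {S : Finset Δ} {τ : Ty Δ β}
    {t' : Tm L (NT N Δ) (VT V Δ)} {ts' : Multiset (Tm L (NT N Δ) (VT V Δ))}
    (h : Translates bullet P Γ (.app K M) β S τ t' ts') :
    ∃ (α : Srt) (S₀ : Finset Δ) (Λ : Finset (LTy Δ α)) (t₀ : Tm L (NT N Δ) (VT V Δ))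
      (ts₀ : Multiset (Tm L (NT N Δ) (VT V Δ)))
      (t : LTy Δ α → Tm L (NT N Δ) (VT V Δ)) (ts : LTy Δ α → Multiset (Tm L (NT N Δ) (VT V Δ))),
      P M α Λ ∧ Translates bullet P Γ K (.arr α β) S₀ (Ty.fn Λ τ) t₀ ts₀ ∧
      (∀ l ∈ Λ, Translates bullet P Γ M α l.1 l.2 (t l) (ts l)) ∧
      Disjoint S₀ (labelUnion Λ) ∧ S = S₀ ∪ labelUnion Λ ∧
      t' = (if α = .o then t₀ else t₀.apps ((sorted Λ).map t)) ∧
      ts' = (if β = .o then {t'} else 0) + ts₀ + ∑ l ∈ Λ, ts l := by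
  cases h with
  | app K M α β S₀ Λ τ t₀ ts₀ t ts hP h₀ h hdisj hv =>
    exact ⟨α, S₀, Λ, t₀, ts₀, t, ts, hP, h₀, h, hdisj, rfl, rfl, rfl⟩

theorem Translates.apps_inv {H : Tm L N V} {Ks : List (Tm L N V)} {S : Finset Δ} {τ : Ty Δ .o}
    {t : Tm L (NT N Δ) (VT V Δ)} {ts : Multiset (Tm L (NT N Δ) (VT V Δ))}
    (h : Translates bullet P Γ (H.apps Ks) .o S τ t ts) :
    ∃ (α : Srt) (S₀ : Finset Δ) (σ : Ty Δ α) (t₀ : Tm L (NT N Δ) (VT V Δ))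
      (ts₀ : Multiset (Tm L (NT N Δ) (VT V Δ))) (as : List (Tm L (NT N Δ) (VT V Δ)))
      (ts' : Multiset (Tm L (NT N Δ) (VT V Δ))),
      Translates bullet P Γ H α S₀ σ t₀ ts₀ ∧ Spine bullet P Γ Ks α σ as ts' ∧
      S = S₀ ∪ σ.labels ∧ Disjoint S₀ σ.labels ∧ t = t₀.apps as ∧
      ts = (if Ks = [] then 0 else {t}) + ts₀ + ts' := by
  induction Ks generalizing H with
  | nil =>
    exact ⟨.o, S, τ, t, ts, [], 0, h, spine_nil.2 ⟨rfl, rfl⟩, by simp, by simp, rfl, by simp⟩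
  | cons K Ks ih =>
    obtain ⟨β, S₁, σ, t₁, ts₁, as, ts', h1, h2, rfl, h3, rfl, rfl⟩ := ih h
    obtain ⟨α, S₀, Λ, t₀, ts₀, u, us, hP, h4, h5, h6, rfl, rfl, rfl⟩ := h1.app_inv
    refine ⟨.arr α β, S₀, Ty.fn Λ σ, t₀, ts₀, _, _, h4,
      spine_cons.2 ⟨hP, u, us, as, ts', h5, h2, rfl, rfl⟩, ?_, ?_, ?_, ?_⟩
    · rw [Ty.labels_fn, Finset.union_assoc]
    · rw [Ty.labels_fn, Finset.disjoint_union_right]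
      exact ⟨h6, (Finset.disjoint_union_left.1 h3).1⟩
    · rw [Tm.apps_append]
      split_ifs <;> rfl
    · cases β with
      | o =>
        obtain ⟨rfl, rfl, rfl⟩ := h2.eq_nil
        simp
      | arr β₁ β₂ =>
        cases Ks with
        | nil => exact absurd h2 not_spine_nil_arr
        | cons => simp [add_assoc]

theorem Translates.apps {H : Tm L N V} {Ks : List (Tm L N V)} {α : Srt} {S₀ : Finset Δ}
    {σ : Ty Δ α} {t₀ : Tm L (NT N Δ) (VT V Δ)} {ts₀ : Multiset (Tm L (NT N Δ) (VT V Δ))}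
    {as : List (Tm L (NT N Δ) (VT V Δ))} {ts' : Multiset (Tm L (NT N Δ) (VT V Δ))}
    (h : Translates bullet P Γ H α S₀ σ t₀ ts₀) (hs : Spine bullet P Γ Ks α σ as ts')
    (hdisj : Disjoint S₀ σ.labels) (hne : (S₀ ∪ σ.labels).Nonempty) :
    Translates bullet P Γ (H.apps Ks) .o (S₀ ∪ σ.labels) Ty.r (t₀.apps as)
      ((if Ks = [] then 0 else {t₀.apps as}) + ts₀ + ts') := by
  induction Ks generalizing H α S₀ t₀ ts₀ as ts' with
  | nil =>
    cases α with
    | o =>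
      obtain ⟨rfl, rfl⟩ := spine_nil.1 hs
      simp only [Ty.labels_o, Finset.union_empty, if_true, zero_add, add_zero]
      exact h
    | arr α β => exact absurd hs not_spine_nil_arr
  | cons K Ks ih =>
    cases α with
    | o => exact absurd hs not_spine_cons_o
    | arr α β =>
      obtain ⟨Λ, τ⟩ := σ
      change Translates bullet P Γ H _ S₀ (Ty.fn Λ τ) t₀ ts₀ at h
      change Disjoint S₀ (Ty.fn Λ τ).labels at hdisj
      change (S₀ ∪ (Ty.fn Λ τ).labels).Nonempty at hne
      change Translates bullet P Γ _ _ (S₀ ∪ (Ty.fn Λ τ).labels) _ _ _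
      obtain ⟨hP, u, us, as, ts', h5, h2, rfl, rfl⟩ := spine_cons.1 hs
      obtain ⟨-, -, hdis, hτ⟩ := Ty.valid_fn.1 h.valid.1
      rw [Ty.labels_fn, Finset.disjoint_union_right] at hdisj
      rw [Ty.labels_fn, ← Finset.union_assoc] at hne ⊢
      have hv : LTy.Valid (S₀ ∪ labelUnion Λ, τ) := by
        refine ⟨hτ, fun hβ => ?_⟩
        subst hβ
        simpa using hne
      have := ih (Translates.app H K α β S₀ Λ τ t₀ ts₀ u us hP h h5 hdisj.1 hv) h2
        (Finset.disjoint_union_left.2 ⟨hdisj.2, hdis⟩) hne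
      have e : t₀.apps (if α = .o then [] else (sorted Λ).map u) =
          if α = .o then t₀ else t₀.apps ((sorted Λ).map u) := by
        split_ifs <;> rfl
      rw [Tm.apps_append, e, Tm.apps_cons]
      convert this using 1
      cases β with
      | o =>
        obtain ⟨rfl, rfl, rfl⟩ := h2.eq_nil
        simp
      | arr β₁ β₂ =>
        cases Ks with
        | nil => exact absurd h2 not_spine_nil_arr
        | cons => simp [add_assoc]

theorem Translates.sym_inv {a : L} {r : ℕ} {α : Srt} {S : Finset Δ} {τ : Ty Δ α}
    {t : Tm L (NT N Δ) (VT V Δ)} {ts : Multiset (Tm L (NT N Δ) (VT V Δ))}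
    (h : Translates bullet P Γ (.sym a r) α S τ t ts) :
    t = .sym a 0 ∧
      ((r = 0 ∧ α = .o ∧ ts = {.sym a 0} ∧ ∃ ha : a ∈ Δ, S = {⟨a, ha⟩}) ∨
        (0 < r ∧ S = ∅ ∧ ts = 0 ∧ ∃ Ss : List (Finset Δ), Ss.length = r ∧
          (⟨α, τ⟩ : Σ α, Ty Δ α) = ⟨_, leafTy Ss⟩)) := by
  cases h with
  | leaf a ha => exact ⟨rfl, .inl ⟨rfl, rfl, rfl, ha, rfl⟩⟩
  | sym a r hr Ss hlen hv => exact ⟨rfl, .inr ⟨hr, rfl, rfl, Ss, hlen, rfl⟩⟩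

theorem Translates.nt_inv {A : N} {α' α : Srt} {S : Finset Δ} {τ : Ty Δ α}
    {t : Tm L (NT N Δ) (VT V Δ)} {ts : Multiset (Tm L (NT N Δ) (VT V Δ))}
    (h : Translates bullet P Γ (.nt A α') α S τ t ts) :
    α' = α ∧ S = ∅ ∧ t = .nt (some (A, ⟨α, τ⟩)) τ.tr ∧ ts = 0 := by
  cases h with
  | nt A α τ hv => exact ⟨rfl, rfl, rfl, rfl⟩

theorem Translates.var_inv {x : V} {α' α : Srt} {S : Finset Δ} {τ : Ty Δ α}
    {t : Tm L (NT N Δ) (VT V Δ)} {ts : Multiset (Tm L (NT N Δ) (VT V Δ))}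
    (h : Translates bullet P Γ (.var x α') α S τ t ts) : (S, τ) ∈ Γ x α := by
  cases h with
  | var x α S τ hx hv => exact hx

theorem Spine.leafTy_eq_nil {Ks : List (Tm L N V)} {Ss : List (Finset Δ)}
    {as : List (Tm L (NT N Δ) (VT V Δ))} {ts : Multiset (Tm L (NT N Δ) (VT V Δ))}
    (h : Spine bullet P Γ Ks _ (leafTy Ss) as ts) : as = [] := by
  induction Ss generalizing Ks as ts with
  | nil => exact h.eq_nil.2.1
  | cons S Ss ih =>
    cases Ks with
    | nil => exact absurd h not_spine_nil_arr
    | cons K Ks =>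
      obtain ⟨-, t, u, as', ts', -, h2, rfl, -⟩ := spine_cons.1 h
      exact ih h2

/-- Derivations of sort `o` for a nonterminal applied to arguments. -/
theorem translates_nt_apps_iff {A : N} {α : Srt} {Ks : List (Tm L N V)} {S : Finset Δ}
    {t : Tm L (NT N Δ) (VT V Δ)} {ts : Multiset (Tm L (NT N Δ) (VT V Δ))} :
    Translates bullet P Γ ((Tm.nt A α).apps Ks) .o S Ty.r t ts ↔
      ∃ (σ : Ty Δ α) (as : List (Tm L (NT N Δ) (VT V Δ)))
        (ts' : Multiset (Tm L (NT N Δ) (VT V Δ))), σ.Valid ∧ S = σ.labels ∧ S.Nonempty ∧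
        Spine bullet P Γ Ks α σ as ts' ∧
        t = (Tm.nt (some (A, ⟨α, σ⟩)) σ.tr).apps as ∧ ts = t ::ₘ ts' := by
  constructor
  · intro h
    have hne := h.valid.2 rfl
    obtain ⟨β, S₀, σ, t₀, ts₀, as, ts', h1, h2, rfl, -, rfl, rfl⟩ := h.apps_inv
    have hv := h1.valid
    obtain ⟨rfl, rfl, rfl, rfl⟩ := h1.nt_inv
    have hK : Ks ≠ [] := by
      rintro rfl
      cases α with
      | o => exact hv.ne_o rfl
      | arr => exact not_spine_nil_arr h2
    exact ⟨σ, as, ts', hv.1, by simp, hne, h2, rfl, by simp [hK]⟩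
  · rintro ⟨σ, as, ts', hv, rfl, hne, h2, rfl, rfl⟩
    have hα : α ≠ .o := by
      rintro rfl
      simp at hne
    have hK : Ks ≠ [] := by
      rintro rfl
      cases α with
      | o => exact hα rfl
      | arr => exact not_spine_nil_arr h2
    have := Translates.apps (Translates.nt (bullet := bullet) (P := P) (Γ := Γ) A α σ
      ⟨hv, fun e => absurd e hα⟩) h2 (by simp) (by simpa using hne)
    simpa [hK] using this

/-- Derivations of sort `o` for a symbol of positive rank applied to arguments. -/
theorem Translates.sym_apps_inv {a : L} {K : Tm L N V} {Ks : List (Tm L N V)} {S : Finset Δ}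
    {r : ℕ} {t : Tm L (NT N Δ) (VT V Δ)} {ts : Multiset (Tm L (NT N Δ) (VT V Δ))}
    (h : Translates bullet P Γ ((Tm.sym a r).apps (K :: Ks)) .o S Ty.r t ts) :
    ∃ (Ss : List (Finset Δ)) (ts' : Multiset (Tm L (NT N Δ) (VT V Δ))), Ss.length = r ∧
      Spine bullet P Γ (K :: Ks) _ (leafTy Ss) [] ts' ∧ ts = .sym a 0 ::ₘ ts' := by
  obtain ⟨β, S₀, σ, t₀, ts₀, as, ts', h1, h2, rfl, -, rfl, rfl⟩ := h.apps_inv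
  obtain ⟨rfl, ⟨-, rfl, -⟩ | ⟨-, rfl, rfl, Ss, hlen, he⟩⟩ := h1.sym_inv
  · exact absurd h2 not_spine_cons_o
  · cases he
    obtain rfl := h2.leafTy_eq_nil
    exact ⟨Ss, ts', hlen, h2, by simp⟩

theorem translates_sym_apps {a : L} {K : Tm L N V} {Ks : List (Tm L N V)}
    {Ss : List (Finset Δ)} {ts : Multiset (Tm L (NT N Δ) (VT V Δ))}
    (hv : (leafTy Ss).Valid) (hlen : Ss.length = (K :: Ks).length)
    (hne : (leafTy Ss).labels.Nonempty)
    (h : Spine bullet P Γ (K :: Ks) _ (leafTy Ss) [] ts) :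
    Translates bullet P Γ ((Tm.sym a (K :: Ks).length).apps (K :: Ks)) .o (leafTy Ss).labels Ty.r
      (.sym a 0) (.sym a 0 ::ₘ ts) := by
  have hα : Srt.pow Ss.length .o ≠ .o := by
    cases Ss with
    | nil => simp at hlen
    | cons => simp [Srt.pow]
  have := Translates.apps (Translates.sym (bullet := bullet) (P := P) (Γ := Γ) a (K :: Ks).length
    (by simp) Ss hlen ⟨hv, fun e => absurd e hα⟩) h (by simp) (by simpa using hne)
  simpa using this

end Spine

/-! ### Environments -/

section Env

variable {L : Type u} {N : Type v} {V : Type w} [DecidableEq L] {bullet : L} {Δ : Finset L}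

theorem labels_envTy_nil (Γ : Env V Δ) : (envTy Γ []).labels = ∅ := rfl

theorem labels_envTy_cons (Γ : Env V Δ) (x : V × Srt) (xs : List (V × Srt)) :
    (envTy Γ (x :: xs)).labels = labelUnion (Γ x.1 x.2) ∪ (envTy Γ xs).labels := rfl

theorem valid_envTy_cons (Γ : Env V Δ) (x : V × Srt) (xs : List (V × Srt)) :
    (envTy Γ (x :: xs)).Valid ↔ (∀ l ∈ Γ x.1 x.2, LTy.Valid l) ∧ Separated (Γ x.1 x.2) ∧
      Disjoint (labelUnion (Γ x.1 x.2)) (envTy Γ xs).labels ∧ (envTy Γ xs).Valid := Iff.rfl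

theorem envTy_valid_iff {Γ : Env V Δ} {xs : List (V × Srt)} :
    (envTy Γ xs).Valid ↔
      (∀ x ∈ xs, (∀ l ∈ Γ x.1 x.2, LTy.Valid l) ∧ Separated (Γ x.1 x.2)) ∧
      xs.Pairwise fun x y => Disjoint (labelUnion (Γ x.1 x.2)) (labelUnion (Γ y.1 y.2)) := by
  have hlab : ∀ (ys : List (V × Srt)) (s : Finset Δ), Disjoint s (envTy Γ ys).labels ↔
      ∀ y ∈ ys, Disjoint s (labelUnion (Γ y.1 y.2)) := by
    intro ys s
    induction ys with
    | nil => simp [labels_envTy_nil]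
    | cons y ys ih =>
      rw [labels_envTy_cons, Finset.disjoint_union_right, ih]
      simp
  induction xs with
  | nil =>
    have h : (envTy Γ []).Valid := trivial
    simp [h]
  | cons x xs ih =>
    rw [valid_envTy_cons, hlab, List.pairwise_cons, propext ih]
    simp only [List.mem_cons, forall_eq_or_imp]
    tauto

theorem mem_labels_envTy {Γ : Env V Δ} {xs : List (V × Srt)} {e : Δ} :
    e ∈ (envTy Γ xs).labels ↔ ∃ x ∈ xs, ∃ l ∈ Γ x.1 x.2, e ∈ l.1 := by
  induction xs with
  | nil => simp [labels_envTy_nil]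
  | cons x xs ih =>
    rw [labels_envTy_cons, Finset.mem_union, ih, mem_labelUnion]
    simp

theorem spine_envTy_iff {P : Tm L N V → (α : Srt) → Finset (LTy Δ α) → Prop} {Γ₀ : Env V Δ}
    {Γ : Env V Δ} {xs : List (V × Srt)} (hxs : xs.Nodup) {Ks : List (Tm L N V)}
    {as : List (Tm L (NT N Δ) (VT V Δ))} {ts : Multiset (Tm L (NT N Δ) (VT V Δ))} :
    Spine bullet P Γ₀ Ks _ (envTy Γ xs) as ts ↔
      Ks.length = xs.length ∧ ∃ (E : ∀ x : V × Srt, LTy Δ x.2 → Tm L (NT N Δ) (VT V Δ))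
        (F : ∀ x : V × Srt, LTy Δ x.2 → Multiset (Tm L (NT N Δ) (VT V Δ))),
        (∀ x ∈ xs, P (Tm.bind xs Ks x) x.2 (Γ x.1 x.2) ∧ ∀ l ∈ Γ x.1 x.2,
          Translates bullet P Γ₀ (Tm.bind xs Ks x) x.2 l.1 l.2 (E x l) (F x l)) ∧
        as = xs.flatMap (fun x => if x.2 = .o then [] else (sorted (Γ x.1 x.2)).map (E x)) ∧
        ts = (xs.map fun x => ∑ l ∈ Γ x.1 x.2, F x l).sum := by
  classical
  induction xs generalizing Ks as ts with
  | nil =>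
    constructor
    · intro h
      obtain ⟨rfl, rfl, rfl⟩ := h.eq_nil
      exact ⟨rfl, fun _ _ => .sym bullet 0, fun _ _ => 0, by simp, rfl, rfl⟩
    · rintro ⟨h, E, F, -, rfl, rfl⟩
      obtain rfl := List.length_eq_zero_iff.1 h
      exact spine_nil.2 ⟨rfl, rfl⟩
  | cons x xs ih =>
    have hx := (List.nodup_cons.1 hxs).1
    have hne : ∀ y ∈ xs, y ≠ x := fun y hy e => hx (e ▸ hy)
    cases Ks with
    | nil =>
      constructor
      · intro h; exact absurd h not_spine_nil_arr
      · rintro ⟨h, -⟩; simp at h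
    | cons K Ks =>
      change Spine bullet P Γ₀ (K :: Ks) (.arr x.2 _) (Ty.fn (Γ x.1 x.2) (envTy Γ xs)) as ts ↔ _
      rw [spine_cons]
      simp only [ih (List.nodup_cons.1 hxs).2]
      have hbx : Tm.bind (x :: xs) (K :: Ks) x = K := by simp [Tm.bind]
      have hb : ∀ y ∈ xs, Tm.bind (x :: xs) (K :: Ks) y = Tm.bind xs Ks y := fun y hy => by
        simp [Tm.bind, hne y hy]
      constructor
      · rintro ⟨hP, t, u, as', ts', ht, ⟨hlen, E, F, hEF, rfl, rfl⟩, rfl, rfl⟩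
        refine ⟨by simp [hlen], Function.update E x t, Function.update F x u, ?_, ?_, ?_⟩
        · intro y hy
          rcases List.mem_cons.1 hy with rfl | hy
          · rw [hbx, Function.update_self, Function.update_self]
            exact ⟨hP, ht⟩
          · rw [hb y hy, Function.update_of_ne (hne y hy), Function.update_of_ne (hne y hy)]
            exact hEF y hy
        · rw [List.flatMap_cons, Function.update_self]
          congr 1
          refine List.flatMap_congr fun y hy => ?_
          rw [Function.update_of_ne (hne y hy)]
        · rw [List.map_cons, List.sum_cons, Function.update_self]
          congr 2
          refine List.map_congr_left fun y hy => ?_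
          rw [Function.update_of_ne (hne y hy)]
      · rintro ⟨hlen, E, F, hEF, rfl, rfl⟩
        have h1 := hEF x (by simp)
        rw [hbx] at h1
        refine ⟨h1.1, E x, F x, _, _, h1.2, ⟨by simpa using hlen, E, F, ?_, rfl, rfl⟩, ?_, ?_⟩
        · intro y hy
          rw [← hb y hy]
          exact hEF y (by simp [hy])
        · rw [List.flatMap_cons]
        · rw [List.map_cons, List.sum_cons]

theorem length_flatMap_splitVar {X : Type*} (Γ : Env V Δ) (xs : List (V × Srt))
    (E : ∀ x : V × Srt, LTy Δ x.2 → X) :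
    (xs.flatMap (fun x => if x.2 = .o then [] else (sorted (Γ x.1 x.2)).map (E x))).length =
      (xs.flatMap (splitVar Γ)).length := by
  induction xs with
  | nil => rfl
  | cons x xs ih =>
    simp only [List.flatMap_cons, List.length_append, ih, splitVar]
    split_ifs <;> simp

/-- The split variables are bound to the translations of the corresponding derivations. -/
theorem bind_splitVar (Γ : Env V Δ) {xs : List (V × Srt)}
    (E : ∀ x : V × Srt, LTy Δ x.2 → Tm L (NT N Δ) (VT V Δ)) {x : V × Srt} (hx : x ∈ xs)
    (ho : x.2 ≠ .o) {l : LTy Δ x.2} (hl : l ∈ Γ x.1 x.2) :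
    Tm.bind (xs.flatMap (splitVar Γ))
      (xs.flatMap (fun x => if x.2 = .o then [] else (sorted (Γ x.1 x.2)).map (E x)))
      ((x.1, ⟨x.2, l⟩), Ty.tr l.2) = E x l := by
  let bs : List (Σ x : V × Srt, LTy Δ x.2) :=
    xs.flatMap fun x => if x.2 = .o then [] else (sorted (Γ x.1 x.2)).map (Sigma.mk x)
  let f : (Σ x : V × Srt, LTy Δ x.2) → VT V Δ × Srt :=
    fun p => ((p.1.1, ⟨p.1.2, p.2⟩), Ty.tr p.2.2)
  let g : (Σ x : V × Srt, LTy Δ x.2) → Tm L (NT N Δ) (VT V Δ) := fun p => E p.1 p.2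
  have h1 : xs.flatMap (splitVar Γ) = bs.map f := by
    simp only [bs, List.map_flatMap]
    refine List.flatMap_congr fun y _ => ?_
    rw [splitVar]
    split_ifs
    · rfl
    · rw [List.map_map]; rfl
  have h2 : xs.flatMap (fun x => if x.2 = .o then [] else (sorted (Γ x.1 x.2)).map (E x)) =
      bs.map g := by
    simp only [bs, List.map_flatMap]
    refine List.flatMap_congr fun y _ => ?_
    split_ifs
    · rfl
    · rw [List.map_map]; rfl
  rw [h1, h2]
  have hmem : (⟨x, l⟩ : Σ x : V × Srt, LTy Δ x.2) ∈ bs := by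
    refine List.mem_flatMap.2 ⟨x, hx, ?_⟩
    rw [if_neg ho]
    exact List.mem_map.2 ⟨l, mem_sorted.2 hl, rfl⟩
  refine Tm.bind_map_apply bs f g hmem ?_
  rintro ⟨⟨y, β⟩, l'⟩ - h
  simp only [f, Prod.mk.injEq] at h
  obtain ⟨⟨rfl, h⟩, -⟩ := h
  cases h
  rfl

theorem sum_labelUnion {X : Type*} [AddCommMonoid X] {α : Srt} {Λ : Finset (LTy Δ α)}
    (h : Separated Λ) (g : Δ → X) :
    ∑ e ∈ labelUnion Λ, g e = ∑ l ∈ Λ, ∑ e ∈ l.1, g e := by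
  rw [labelUnion, Finset.sum_biUnion]
  intro l hl l' hl' hne
  exact h l hl l' hl' hne

theorem sum_labels_envTy {X : Type*} [AddCommMonoid X] {Γ : Env V Δ} {xs : List (V × Srt)}
    (h : (envTy Γ xs).Valid) (g : Δ → X) :
    ∑ e ∈ (envTy Γ xs).labels, g e =
      (xs.map fun x => ∑ l ∈ Γ x.1 x.2, ∑ e ∈ l.1, g e).sum := by
  induction xs with
  | nil => rfl
  | cons x xs ih =>
    obtain ⟨-, h2, h3, h4⟩ := (valid_envTy_cons Γ x xs).1 h
    rw [labels_envTy_cons, Finset.sum_union h3, ih h4, sum_labelUnion h2]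
    simp

/-- Data attached to pairwise disjoint sets can be distributed over the elements of the sets. -/
theorem exists_sum_eq {ι X : Type*} [DecidableEq ι] [AddCommMonoid X] (bs : List (Finset ι × X))
    (hd : bs.Pairwise fun b b' => Disjoint b.1 b'.1) (h0 : ∀ b ∈ bs, b.1 = ∅ → b.2 = 0) :
    ∃ g : ι → X, ∀ b ∈ bs, ∑ e ∈ b.1, g e = b.2 := by
  induction bs with
  | nil => exact ⟨fun _ => 0, by simp⟩
  | cons b bs ih =>
    obtain ⟨hb, hd⟩ := List.pairwise_cons.1 hd
    obtain ⟨g, hg⟩ := ih hd fun b hb => h0 b (by simp [hb])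
    rcases b.1.eq_empty_or_nonempty with he | ⟨e₀, he₀⟩
    · refine ⟨g, fun b' hb' => ?_⟩
      rcases List.mem_cons.1 hb' with rfl | hb'
      · rw [h0 b' (by simp) he, he, Finset.sum_empty]
      · exact hg b' hb'
    · refine ⟨fun e => if e ∈ b.1 then (if e = e₀ then b.2 else 0) else g e, fun b' hb' => ?_⟩
      rcases List.mem_cons.1 hb' with rfl | hb'
      · rw [Finset.sum_congr rfl fun e he => if_pos he, Finset.sum_ite_eq', if_pos he₀]
      · rw [← hg b' hb']
        exact Finset.sum_congr rfl fun e he =>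
          if_neg (Finset.disjoint_right.1 (hb b' hb') he)

/-- Data attached to the bindings of a valid environment, and trivial for empty labels, can be
distributed over the elements of the labels. -/
theorem exists_distribution {X : Type*} [AddCommMonoid X] {Γ : Env V Δ} {xs : List (V × Srt)}
    (h : (envTy Γ xs).Valid) (F : ∀ x : V × Srt, LTy Δ x.2 → X)
    (hF : ∀ x ∈ xs, ∀ l ∈ Γ x.1 x.2, l.1 = ∅ → F x l = 0) :
    ∃ g : Δ → X, ∀ x ∈ xs, ∀ l ∈ Γ x.1 x.2, ∑ e ∈ l.1, g e = F x l := by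
  obtain ⟨h1, h2⟩ := envTy_valid_iff.1 h
  have hd : (xs.flatMap fun x => (sorted (Γ x.1 x.2)).map fun l => (l.1, F x l)).Pairwise
      fun b b' => Disjoint b.1 b'.1 := by
    rw [List.pairwise_flatMap]
    constructor
    · intro x hx
      rw [List.pairwise_map]
      refine (nodup_sorted _).imp_of_mem ?_
      exact fun hl hl' hne => (h1 x hx).2 _ (mem_sorted.1 hl) _ (mem_sorted.1 hl') hne
    · refine h2.imp ?_
      intro x y hxy b hb b' hb'
      obtain ⟨l, hl, rfl⟩ := List.mem_map.1 hb
      obtain ⟨l', hl', rfl⟩ := List.mem_map.1 hb'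
      exact hxy.mono (subset_labelUnion (mem_sorted.1 hl)) (subset_labelUnion (mem_sorted.1 hl'))
  obtain ⟨g, hg⟩ := exists_sum_eq _ hd fun b hb he => by
    obtain ⟨x, hx, hb⟩ := List.mem_flatMap.1 hb
    obtain ⟨l, hl, rfl⟩ := List.mem_map.1 hb
    exact hF x hx l (mem_sorted.1 hl) he
  refine ⟨g, fun x hx l hl => hg (l.1, F x l) ?_⟩
  exact List.mem_flatMap.2 ⟨x, hx, List.mem_map.2 ⟨l, mem_sorted.2 hl, rfl⟩⟩

end Env

/-! ### Substitution in derivations -/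

section Subst

variable {L : Type u} {N : Type v} {V : Type w} [DecidableEq L] {bullet : L} {Δ : Finset L}

/-- Substituting derivations for the variables of a derivation. The labels `S` of a derivation
without leaves from `Δ` are the disjoint union of the labels of those variables in it that have
nonempty labels, each of them occurring once; hence the contribution of the substituted derivations
to `tr_cum`, when it is distributed by `g` over the elements of labels, is the sum of `g` over `S`.
The multiset `b` consists of the symbols that translate the variables of sort `o`: they are present
before the substitution, but not after it. -/
theorem Translates.subst {Γ Γ₀ : Env V Δ} {σ : V × Srt → Tm L N V}
    {σ' : VT V Δ × Srt → Tm L (NT N Δ) (VT V Δ)}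
    {E : ∀ x : V × Srt, LTy Δ x.2 → Tm L (NT N Δ) (VT V Δ)}
    {F : ∀ x : V × Srt, LTy Δ x.2 → Multiset (Tm L (NT N Δ) (VT V Δ))}
    {g : Δ → Multiset (Tm L (NT N Δ) (VT V Δ))}
    (hE : ∀ x : V × Srt, ∀ l ∈ Γ x.1 x.2,
      Translates bullet anyArg Γ₀ (σ x) x.2 l.1 l.2 (E x l) (F x l))
    (hσ' : ∀ x : V × Srt, ∀ l ∈ Γ x.1 x.2, x.2 ≠ .o →
      σ' ((x.1, ⟨x.2, l⟩), Ty.tr l.2) = E x l)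
    (hg : ∀ x : V × Srt, ∀ l ∈ Γ x.1 x.2, ∑ e ∈ l.1, g e = F x l)
    {K : Tm L N V} {α : Srt} {S : Finset Δ} {τ : Ty Δ α} {t₁ : Tm L (NT N Δ) (VT V Δ)}
    {ts₁ : Multiset (Tm L (NT N Δ) (VT V Δ))}
    (h : Translates bullet anyArg Γ K α S τ t₁ ts₁) (hK : ∀ a ∈ Δ, (a, 0) ∉ K.syms) :
    ∃ t ts b, Translates bullet anyArg Γ₀ (K.subst σ) α S τ t ts ∧
      (α ≠ .o → t = t₁.subst σ') ∧ (∀ s ∈ b, s = .sym bullet 0) ∧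
      ts + b = ts₁.map (Tm.subst σ') + ∑ e ∈ S, g e := by
  induction h with
  | var x α S τ hx hv =>
    by_cases ho : α = .o
    · refine ⟨E (x, α) (S, τ), F (x, α) (S, τ), {.sym bullet 0}, hE (x, α) _ hx,
        fun h => absurd ho h, by simp, ?_⟩
      rw [if_pos ho, ← hg (x, α) _ hx, add_comm]
      rfl
    · refine ⟨E (x, α) (S, τ), F (x, α) (S, τ), 0, hE (x, α) _ hx, fun _ => ?_, by simp, ?_⟩
      · rw [if_neg ho, Tm.subst]
        exact (hσ' (x, α) _ hx ho).symm
      · rw [if_neg ho, ← hg (x, α) _ hx, Multiset.map_zero, add_comm]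
  | nt A α τ hv =>
    exact ⟨_, _, 0, .nt A α τ hv, fun _ => rfl, by simp, by simp⟩
  | leaf a ha => exact absurd (by simp [Tm.syms]) (hK a ha)
  | sym a r hr Ss hlen hv =>
    exact ⟨_, _, 0, .sym a r hr Ss hlen hv, fun _ => rfl, by simp, by simp⟩
  | app K M α β S₀ Λ τ t₀ ts₀ t ts hP h₀ _ hdisj hv ih₀ ih =>
    obtain ⟨u₀, us₀, b₀, hu₀, ht₀, hb₀, e₀⟩ := ih₀ fun a ha h => hK a ha (by simp [Tm.syms, h])
    have hex : ∀ l : LTy Δ α, ∃ u us b, l ∈ Λ →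
        Translates bullet anyArg Γ₀ (M.subst σ) α l.1 l.2 u us ∧
        (α ≠ .o → u = (t l).subst σ') ∧ (∀ s ∈ b, s = .sym bullet 0) ∧
        us + b = (ts l).map (Tm.subst σ') + ∑ e ∈ l.1, g e := by
      intro l
      by_cases hl : l ∈ Λ
      · obtain ⟨u, us, b, h⟩ := ih l hl fun a ha h => hK a ha (by simp [Tm.syms, h])
        exact ⟨u, us, b, fun _ => h⟩
      · exact ⟨.sym bullet 0, 0, 0, fun h => absurd h hl⟩
    choose u us b hub using hex
    have hnode : (if α = .o then u₀ else u₀.apps ((sorted Λ).map u)) =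
        (if α = .o then t₀ else t₀.apps ((sorted Λ).map t)).subst σ' := by
      split_ifs with ho
      · exact ht₀ (by simp)
      · rw [Tm.subst_apps, ht₀ (by simp), List.map_map]
        congr 1
        exact List.map_congr_left fun l hl => (hub l (mem_sorted.1 hl)).2.1 ho
    refine ⟨_, _, b₀ + ∑ l ∈ Λ, b l, .app _ _ α β S₀ Λ τ u₀ us₀ u us trivial hu₀
      (fun l hl => (hub l hl).1) hdisj hv, fun _ => hnode, ?_, ?_⟩
    · intro s hs
      rcases Multiset.mem_add.1 hs with hs | hs
      · exact hb₀ s hs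
      · obtain ⟨l, hl, hs⟩ := Multiset.mem_sum.1 hs
        exact (hub l hl).2.2.1 s hs
    · have hsep := (Ty.valid_fn.1 h₀.valid.1).2.1
      have hsum : ∑ l ∈ Λ, us l + ∑ l ∈ Λ, b l =
          (∑ l ∈ Λ, ts l).map (Tm.subst σ') + ∑ e ∈ labelUnion Λ, g e := by
        rw [← Finset.sum_add_distrib, sum_labelUnion hsep,
          ← Multiset.coe_mapAddMonoidHom, map_sum, ← Finset.sum_add_distrib]
        exact Finset.sum_congr rfl fun l hl => (hub l hl).2.2.2
      rw [hnode, Multiset.map_add, Multiset.map_add, Finset.sum_union hdisj]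
      have hif : ∀ X : Tm L (NT N Δ) (VT V Δ),
          Multiset.map (Tm.subst σ') (if β = .o then {X} else 0) =
            if β = .o then {X.subst σ'} else 0 := by
        intro X; split_ifs <;> simp
      rw [hif]
      generalize (if β = .o then _ else _ : Multiset (Tm L (NT N Δ) (VT V Δ))) = Z
      calc Z + us₀ + ∑ l ∈ Λ, us l + (b₀ + ∑ l ∈ Λ, b l)
          = Z + (us₀ + b₀) + (∑ l ∈ Λ, us l + ∑ l ∈ Λ, b l) := by abel
        _ = _ := by rw [e₀, hsum]; abel

end Subst

/-! ### Soundness -/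

section Soundness

variable {L : Type u} {N : Type v} {V : Type w} [DecidableEq L] (bullet : L) {Δ : Finset L}

/-- The letters of a multiset of symbols, other than the auxiliary letter. -/
def visible (c : Multiset (L × ℕ)) : Multiset L := (c.map Prod.fst).filter (· ≠ bullet)

@[simp] theorem visible_add (c c' : Multiset (L × ℕ)) :
    visible bullet (c + c') = visible bullet c + visible bullet c' := by
  simp [visible]

theorem visible_cons (a : L) (r : ℕ) (c : Multiset (L × ℕ)) :
    visible bullet ((a, r) ::ₘ c) = (if a ≠ bullet then {a} else 0) + visible bullet c := by
  simp only [visible, Multiset.map_cons, Multiset.filter_cons]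

theorem visible_cons_bullet (r : ℕ) (c : Multiset (L × ℕ)) :
    visible bullet ((bullet, r) ::ₘ c) = visible bullet c := by
  simp [visible_cons]

variable {bullet}

/-- Nullary symbols `bullet` can be dropped from a run. -/
theorem Run.remove_bullets {P : Set (Rule L N V)} {m b : Multiset (Tm L N V)} {n : ℕ}
    {c : Multiset (L × ℕ)} (hb : ∀ s ∈ b, s = .sym bullet 0) (h : Run P (m + b) n c) :
    ∃ c', Run P m n c' ∧ visible bullet c' = visible bullet c := by
  induction b using Multiset.induction_on generalizing n c with
  | empty => exact ⟨c, by simpa using h, rfl⟩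
  | cons s b ih =>
    obtain rfl := hb s (by simp)
    rw [Multiset.add_cons, ← Multiset.singleton_add] at h
    obtain ⟨n₁, n₂, c₁, c₂, h1, h2, rfl, rfl⟩ := h.split
    obtain ⟨-, c', h3, rfl⟩ := Run.sym_apps (Ks := []) h1
    obtain ⟨rfl, rfl⟩ := h3.eq_zero
    rw [zero_add]
    obtain ⟨c', h4, h5⟩ := ih (fun s hs => hb s (by simp [hs])) h2
    refine ⟨c', h4, ?_⟩
    rw [h5, Multiset.cons_add, visible_cons_bullet, zero_add]

/-- Nullary symbols `bullet` can be added to a run. -/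
theorem Run.add_bullets {P : Set (Rule L N V)} {m b : Multiset (Tm L N V)} {n : ℕ}
    {c : Multiset (L × ℕ)} (hb : ∀ s ∈ b, s = .sym bullet 0) (h : Run P m n c) :
    ∃ c', Run P (m + b) n c' ∧ visible bullet c' = visible bullet c := by
  induction b using Multiset.induction_on with
  | empty => exact ⟨c, by simpa using h, rfl⟩
  | cons s b ih =>
    obtain rfl := hb s (by simp)
    obtain ⟨c', h4, h5⟩ := ih fun s hs => hb s (by simp [hs])
    refine ⟨(bullet, 0) ::ₘ c', ?_, by rw [visible_cons_bullet, h5]⟩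
    rw [Multiset.add_cons]
    exact Run.sym bullet [] _ n c' (by simpa using h4)

/-- The environment without bindings. -/
def noEnv (V : Type w) (Δ : Finset L) : Env V Δ := fun _ _ => ∅

/-- The rules obtained by the transformation from the rules in `P`, for all choices of an
environment and a derivation. -/
def lowerRules (bullet : L) (Δ : Finset L) (P : Set (Rule L N V)) :
    Set (Rule L (NT N Δ) (VT V Δ)) :=
  {R' | ∃ R ∈ P, ∃ Γ : Env V Δ, (∀ x α, (x, α) ∉ R.vars → Γ x α = ∅) ∧
    (envTy Γ R.vars).Valid ∧
    ∃ D : Deriv N Γ R.body .o (envTy Γ R.vars).labels Ty.r, R' = trRule bullet R Γ D}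

/-- Subject reduction: a derivation for the body of a rule and derivations for the arguments give
a derivation for the reduct, whose translation is obtained by the transformed rule. -/
theorem Translates.reduct {R : Rule L N V} (hR : R.vars.Nodup)
    (hleaf : ∀ a ∈ Δ, (a, 0) ∉ R.body.syms) {Γ : Env V Δ}
    (hΓ : ∀ x α, (x, α) ∉ R.vars → Γ x α = ∅) (hv : (envTy Γ R.vars).Valid) {S : Finset Δ}
    (hS : S = (envTy Γ R.vars).labels) {t₁ : Tm L (NT N Δ) (VT V Δ)}
    {ts₁ : Multiset (Tm L (NT N Δ) (VT V Δ))}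
    (h : Translates bullet anyArg Γ R.body .o S Ty.r t₁ ts₁) {Ks : List (Tm L N V)}
    {as : List (Tm L (NT N Δ) (VT V Δ))} {ts' : Multiset (Tm L (NT N Δ) (VT V Δ))}
    (hs : Spine bullet anyArg (noEnv V Δ) Ks _ (envTy Γ R.vars) as ts') :
    Ks.length = R.vars.length ∧ ∃ t ts b,
      Translates bullet anyArg (noEnv V Δ) (R.body.subst (Tm.bind R.vars Ks)) .o S Ty.r t ts ∧
      (∀ s ∈ b, s = .sym bullet 0) ∧
      ts + b = ts₁.map (Tm.subst (Tm.bind (R.vars.flatMap (splitVar Γ)) as)) + ts' := by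
  subst hS
  obtain ⟨hlen, E, F, hEF, rfl, rfl⟩ := (spine_envTy_iff hR).1 hs
  obtain ⟨g, hg⟩ := exists_distribution hv F fun x hx l hl he => ((hEF x hx).2 l hl).eq_zero he
  have hmem : ∀ x : V × Srt, ∀ l ∈ Γ x.1 x.2, x ∈ R.vars := by
    intro x l hl
    by_contra hx
    rw [hΓ _ _ hx] at hl
    simp at hl
  obtain ⟨t, ts, b, h1, -, h2, h3⟩ := Translates.subst (Γ := Γ)
    (fun x l hl => (hEF x (hmem x l hl)).2 l hl)
    (fun x l hl ho => bind_splitVar Γ E (hmem x l hl) ho hl)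
    (fun x l hl => hg x (hmem x l hl) l hl) h hleaf
  refine ⟨hlen, t, ts, b, h1, h2, ?_⟩
  rw [h3, sum_labels_envTy hv]
  congr 2
  exact List.map_congr_left fun x hx => Finset.sum_congr rfl fun l hl => hg x hx l hl

/-- Every reduction of the translation of a derivation comes from a reduction of the term. -/
theorem Run.of_translates {P : Set (Rule L N V)} {Q : Set (Rule L (NT N Δ) (VT V Δ))}
    (hP : ∀ R ∈ P, R.vars.Nodup ∧ ∀ a ∈ Δ, (a, 0) ∉ R.body.syms)
    (hQ : ∀ R' ∈ Q, R'.nt = none ∨ R' ∈ lowerRules bullet Δ P)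
    {n : ℕ} {M : Tm L N V} {S : Finset Δ} {t : Tm L (NT N Δ) (VT V Δ)}
    {ts : Multiset (Tm L (NT N Δ) (VT V Δ))} {c : Multiset (L × ℕ)}
    (h : Translates bullet anyArg (noEnv V Δ) M .o S Ty.r t ts) (hr : Run Q ts n c) :
    ∃ n' c', Run P {M} n' c' ∧ visible bullet c' = visible bullet c := by
  -- Outermost reductions are done first: induction on the number of uses of rules, then on the
  -- size of the term.
  induction n using Nat.strong_induction_on generalizing M S t ts c with
  | _ n ihn =>
    induction hsz : M.size using Nat.strong_induction_on generalizing M S t ts c n with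
    | _ s ihs =>
      rcases M.exists_eq_apps with ⟨x, α, Ks, rfl⟩ | ⟨A, α, Ks, rfl⟩ | ⟨a, r, Ks, rfl⟩
      · obtain ⟨β, S₀, σ, t₀, ts₀, as, ts', h1, -⟩ := h.apps_inv
        exact absurd h1.var_inv (Finset.notMem_empty _)
      · obtain ⟨σ, as, ts', hv, rfl, hne, hs, rfl, rfl⟩ := translates_nt_apps_iff.1 h
        rw [← Multiset.singleton_add] at hr
        obtain ⟨n₁, n₂, c₁, c₂, hr1, hr2, rfl, rfl⟩ := hr.split
        obtain ⟨R', hR', hnt, -, hlen, n₁, rfl, hr0⟩ := hr1.nt_apps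
        rcases hQ R' hR' with h0 | ⟨R, hR, Γ, hΓ, hvΓ, D, rfl⟩
        · simp [h0] at hnt
        have hnt' : (⟨R.nt, ⟨_, envTy Γ R.vars⟩⟩ : N × (Σ α : Srt, Ty Δ α)) = (A, ⟨α, σ⟩) :=
          Option.some.inj hnt
        cases hnt'
        -- The rule used for the head of the translation comes from a rule for `A` and a derivation
        -- of its body. What remains to be reduced is `tr_cum` for the reduct, up to symbols
        -- `bullet`, and takes fewer uses of rules.
        obtain ⟨hlen', t, ts, b, h1, hb, e⟩ :=
          Translates.reduct (hP R hR).1 (hP R hR).2 hΓ hvΓ rfl (D.translates (bullet := bullet)) hs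
        have hbody : (trRule bullet R Γ D).body.subst
            (Tm.bind (trRule bullet R Γ D).vars as) =
            (Tm.sym bullet (D.trCum bullet).length).apps ((D.trCum bullet).map
              (Tm.subst (Tm.bind (R.vars.flatMap (splitVar Γ)) as))) := by
          rw [trRule, merge, Tm.subst_apps]
          rfl
        rw [hbody] at hr0
        obtain ⟨-, c', hr4, rfl⟩ := hr0.sym_apps
        have hr3 := hr4.add hr2
        rw [← Multiset.map_coe, ← e] at hr3
        obtain ⟨c'', hr5, hc⟩ := hr3.remove_bullets hb
        obtain ⟨n', c''', hr6, hc'⟩ := ihn (n₁ + n₂) (by omega) h1 hr5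
        refine ⟨n' + 1, c''', .rule R hR Ks hlen' 0 n' c''' hr6, ?_⟩
        rw [hc', hc, Multiset.cons_add, visible_cons_bullet]
      · cases Ks with
        | nil =>
          obtain ⟨-, ⟨rfl, -, rfl, -⟩ | ⟨hr0, -, -, Ss, hlen, he⟩⟩ := Translates.sym_inv h
          · obtain ⟨-, c', h2, rfl⟩ := Run.sym_apps (Ks := []) hr
            obtain ⟨rfl, rfl⟩ := h2.eq_zero
            exact ⟨0, _, .sym a [] 0 0 0 .zero, rfl⟩
          · cases Ss with
            | nil => simp at hlen; omega
            | cons S Ss => cases congrArg Sigma.fst he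
        | cons K Ks =>
          obtain ⟨Ss, ts', hlen, hs, rfl⟩ := h.sym_apps_inv
          rw [← Multiset.singleton_add] at hr
          obtain ⟨n₁, n₂, c₁, c₂, hr1, hr2, rfl, rfl⟩ := hr.split
          obtain ⟨-, c', h2, rfl⟩ := Run.sym_apps (Ks := []) hr1
          obtain ⟨rfl, rfl⟩ := h2.eq_zero
          -- The parts of `tr_cum` that stem from different arguments are reduced independently.
          have key : ∀ (Ks' : List (Tm L N V)) (Ss : List (Finset Δ)) (as) (ts) (n c),
              (∀ K' ∈ Ks', K' ∈ K :: Ks) → n ≤ n₂ →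
              Spine bullet anyArg (noEnv V Δ) Ks' _ (leafTy Ss) as ts → Run Q ts n c →
              Ks'.length = Ss.length ∧
              ∃ n' c', Run P ↑Ks' n' c' ∧ visible bullet c' = visible bullet c := by
            intro Ks' Ss as ts n c hsub hn hs hr
            induction Ks' generalizing Ss as ts n c with
            | nil =>
              cases Ss with
              | nil =>
                obtain ⟨-, rfl, rfl⟩ := hs.eq_nil
                obtain ⟨rfl, rfl⟩ := hr.eq_zero
                exact ⟨rfl, 0, 0, .zero, rfl⟩
              | cons => exact absurd hs not_spine_nil_arr
            | cons K' Ks' ih =>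
              cases Ss with
              | nil => exact absurd hs not_spine_cons_o
              | cons S Ss =>
                obtain ⟨-, t, u, as', ts', ht, hs', rfl, rfl⟩ := spine_cons.1 hs
                rw [Finset.sum_singleton] at hr
                obtain ⟨n₁, n₂, c₁, c₂, hr1, hr2, rfl, rfl⟩ := hr.split
                obtain ⟨hl, m₂, d₂, hd2, he2⟩ := ih Ss _ ts' n₂ c₂
                  (fun K hK => hsub K (by simp [hK])) (by omega) hs' hr2
                have ht' := ht (S, Ty.r) (Finset.mem_singleton_self _)
                have hlt := Tm.size_lt_of_mem_args (Tm.sym a r) (hsub K' (by simp))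
                rw [hsz] at hlt
                obtain ⟨m₁, d₁, hd1, he1⟩ := ihs K'.size hlt n₁
                  (fun m hm => ihn m (by omega)) ht' hr1 rfl
                refine ⟨by simp [hl], m₁ + m₂, d₁ + d₂, ?_, by simp [he1, he2]⟩
                simpa using hd1.add hd2
          obtain ⟨hl, m, d, hd, he⟩ := key (K :: Ks) Ss [] ts' n₂ c₂ (fun _ h => h) le_rfl hs hr2
          obtain rfl : (K :: Ks).length = r := by omega
          refine ⟨m, _, .sym a (K :: Ks) 0 m d (by simpa using hd), ?_⟩
          simp [visible_cons, he]

end Soundness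

/-! ### Canonical derivations -/

section Canonical

variable {L : Type u} {N : Type v} {V : Type w} [DecidableEq L] (bullet : L) {Δ : Finset L}

/-- The side condition defining canonical derivations of closed terms: the set of labeled types
derived for an argument contains all labeled types with empty label that can be derived for it. -/
def fullArg (M : Tm L N V) (α : Srt) (Λ : Finset (LTy Δ α)) : Prop :=
  ∀ τ : Ty Δ α, (∅, τ) ∈ Λ ↔ ∃ t ts, Translates bullet anyArg (noEnv V Δ) M α ∅ τ t ts

/-- The labeled types with empty label that can be derived for a closed term. -/
noncomputable def emptyLabeled (M : Tm L N V) (α : Srt) : Finset (LTy Δ α) :=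
  haveI := Ty.finite (Δ := Δ) α
  (Set.toFinite {l : LTy Δ α | l.1 = ∅ ∧
    ∃ t ts, Translates bullet anyArg (noEnv V Δ) M α l.1 l.2 t ts}).toFinset

variable {bullet}

theorem mem_emptyLabeled {M : Tm L N V} {α : Srt} {l : LTy Δ α} :
    l ∈ emptyLabeled bullet M α ↔
      l.1 = ∅ ∧ ∃ t ts, Translates bullet anyArg (noEnv V Δ) M α l.1 l.2 t ts := by
  simp [emptyLabeled]

/-- The type `τ'` arises from `τ` by adding labeled types with empty label to its argument
sets. -/
def Ty.Extends {Δ : Finset L} : {α : Srt} → Ty Δ α → Ty Δ α → Prop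
  | .o, _, _ => True
  | .arr _ _, (Λ, τ), (Λ', τ') => Λ ⊆ Λ' ∧ (∀ l ∈ Λ', l ∉ Λ → l.1 = ∅) ∧ Ty.Extends τ τ'

theorem Ty.extends_fn {α β : Srt} {Λ Λ' : Finset (LTy Δ α)} {τ τ' : Ty Δ β} :
    Ty.Extends (Ty.fn Λ τ) (Ty.fn Λ' τ') ↔
      Λ ⊆ Λ' ∧ (∀ l ∈ Λ', l ∉ Λ → l.1 = ∅) ∧ Ty.Extends τ τ' := Iff.rfl

theorem Ty.extends_refl {α : Srt} (τ : Ty Δ α) : Ty.Extends τ τ := by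
  induction α with
  | o => trivial
  | arr α β _ ih =>
    obtain ⟨Λ, τ⟩ := τ
    exact ⟨Finset.Subset.refl _, fun l h h' => absurd h h', ih τ⟩

theorem Ty.Extends.eq_leafTy {Ss : List (Finset Δ)} {τ : Ty Δ (Srt.pow Ss.length .o)}
    (h : Ty.Extends (leafTy Ss) τ) (hv : τ.Valid) : τ = leafTy Ss := by
  induction Ss with
  | nil => rfl
  | cons S Ss ih =>
    obtain ⟨Λ, τ⟩ := τ
    obtain ⟨h1, h2, h3⟩ := h
    obtain ⟨h4, -, -, h5⟩ := hv
    obtain rfl := ih h3 h5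
    have : Λ = ({(S, Ty.r)} : Finset (LTy Δ .o)) := by
      refine Finset.Subset.antisymm (fun l hl => ?_) h1
      by_contra hn
      exact ((h4 l hl).2 rfl).ne_empty (h2 l hl hn)
    rw [this]
    rfl

/-- Canonical derivations with empty label are unique. -/
theorem Translates.unique {M : Tm L N V} {α : Srt} {τ : Ty Δ α}
    {t t' : Tm L (NT N Δ) (VT V Δ)} {ts ts' : Multiset (Tm L (NT N Δ) (VT V Δ))}
    (h : Translates bullet (fullArg bullet) (noEnv V Δ) M α ∅ τ t ts)
    (h' : Translates bullet (fullArg bullet) (noEnv V Δ) M α ∅ τ t' ts') : t = t' := by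
  induction M generalizing α t t' ts ts' with
  | var x β => exact absurd h.var_inv (Finset.notMem_empty _)
  | nt A β => rw [h.nt_inv.2.2.1, h'.nt_inv.2.2.1]
  | sym a r => rw [h.sym_inv.1, h'.sym_inv.1]
  | app K M ihK ihM =>
    obtain ⟨β, S₀, Λ, t₀, ts₀, u, us, hP, h0, h1, -, hS, rfl, -⟩ := h.app_inv
    obtain ⟨β', S₀', Λ', t₀', ts₀', u', us', hP', h0', h1', -, hS', rfl, -⟩ := h'.app_inv
    obtain ⟨rfl, -⟩ := Srt.arr.inj (h0.srt_eq.symm.trans h0'.srt_eq)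
    rw [eq_comm, Finset.union_eq_empty, labelUnion_eq_empty] at hS hS'
    obtain ⟨rfl, hS⟩ := hS
    obtain ⟨rfl, hS'⟩ := hS'
    have hΛ : Λ = Λ' := by
      ext ⟨S, σ⟩
      constructor
      · intro hl
        obtain rfl : S = ∅ := hS _ hl
        exact (hP' σ).2 ((hP σ).1 hl)
      · intro hl
        obtain rfl : S = ∅ := hS' _ hl
        exact (hP σ).2 ((hP' σ).1 hl)
    subst hΛ
    rw [ihK h0 h0']
    have : (sorted Λ).map u = (sorted Λ).map u' := by
      refine List.map_congr_left fun l hl => ?_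
      have hl := mem_sorted.1 hl
      obtain ⟨S, σ⟩ := l
      obtain rfl : S = ∅ := hS _ hl
      exact ihM (h1 _ hl) (h1' _ hl)
    rw [this]

/-- Every derivation with empty label for a closed term can be made canonical. Enlarging the
argument sets by labeled types with empty label does not matter, since nonterminals have
all types. -/
theorem Translates.exists_canonical {M : Tm L N V} {α : Srt} {τ τ' : Ty Δ α}
    {t : Tm L (NT N Δ) (VT V Δ)} {ts : Multiset (Tm L (NT N Δ) (VT V Δ))}
    (h : Translates bullet anyArg (noEnv V Δ) M α ∅ τ t ts)
    (hv : τ'.Valid) (he : Ty.Extends τ τ') :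
    ∃ t' ts', Translates bullet (fullArg bullet) (noEnv V Δ) M α ∅ τ' t' ts' := by
  have hα := h.valid.ne_o
  induction M generalizing α t ts with
  | var x β => exact absurd h.var_inv (Finset.notMem_empty _)
  | nt A β =>
    obtain ⟨rfl, -⟩ := h.nt_inv
    exact ⟨_, _, .nt A β τ' ⟨hv, fun e => absurd e hα⟩⟩
  | sym a r =>
    obtain ⟨-, ⟨-, e, -⟩ | ⟨hr, -, -, Ss, hlen, e⟩⟩ := h.sym_inv
    · exact absurd e hα
    · cases e
      obtain rfl := he.eq_leafTy hv
      exact ⟨_, _, .sym a r hr Ss hlen ⟨hv, fun e => absurd e hα⟩⟩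
  | app K M ihK ihM =>
    obtain ⟨β, S₀, Λ, t₀, ts₀, u, us, -, h0, h1, -, hS, -, -⟩ := h.app_inv
    rw [eq_comm, Finset.union_eq_empty, labelUnion_eq_empty] at hS
    obtain ⟨rfl, hS⟩ := hS
    have hlab : labelUnion (emptyLabeled (Δ := Δ) bullet M β) = ∅ :=
      labelUnion_eq_empty.2 fun l hl => (mem_emptyLabeled.1 hl).1
    have hv' : (Ty.fn (emptyLabeled bullet M β) τ').Valid := by
      refine Ty.valid_fn.2 ⟨fun l hl => ?_, fun l hl l' hl' _ => ?_, by simp [hlab], hv⟩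
      · obtain ⟨-, t, ts, h⟩ := mem_emptyLabeled.1 hl
        exact h.valid
      · simp [(mem_emptyLabeled.1 hl).1]
    obtain ⟨t₀', ts₀', h₀'⟩ := ihK h0 hv' (Ty.extends_fn.2 ⟨fun l hl =>
      mem_emptyLabeled.2 ⟨hS l hl, _, _, h1 l hl⟩, fun l hl _ => (mem_emptyLabeled.1 hl).1, he⟩)
      (by simp)
    have hex : ∀ l : LTy Δ β, ∃ t ts, l ∈ emptyLabeled bullet M β →
        Translates bullet (fullArg bullet) (noEnv V Δ) M β l.1 l.2 t ts := by
      rintro ⟨S, σ⟩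
      by_cases hl : (S, σ) ∈ emptyLabeled bullet M β
      · obtain ⟨hS, t, ts, h⟩ := mem_emptyLabeled.1 hl
        obtain rfl : S = ∅ := hS
        obtain ⟨t', ts', h'⟩ := ihM h h.valid.1 (Ty.extends_refl σ) h.valid.ne_o
        exact ⟨t', ts', fun _ => h'⟩
      · exact ⟨.sym bullet 0, 0, fun h => absurd h hl⟩
    choose u us hu using hex
    have := Translates.app K M β α ∅ _ τ' t₀' ts₀' u us (P := fullArg bullet)
      (fun σ => by simp [mem_emptyLabeled]) h₀' hu (by simp)
      ⟨hv, fun e => absurd e hα⟩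
    rw [hlab, Finset.empty_union] at this
    exact ⟨_, _, this⟩

end Canonical

/-! ### Subject expansion -/

section Expansion

variable {L : Type u} {N : Type v} {V : Type w} [DecidableEq L] {bullet : L} {Δ : Finset L}

/-- An occurrence of a substituted variable, with the labeled type that is derived for the term
substituted for it, and with the translation of this derivation. -/
structure Occ (N : Type v) (V : Type w) (Δ : Finset L) where
  var : V × Srt
  lty : LTy Δ var.2
  tr : Tm L (NT N Δ) (VT V Δ)
  trCum : Multiset (Tm L (NT N Δ) (VT V Δ))

theorem Tm.HasSort.srt_eq {K : Tm L N V} {α : Srt} (h : K.HasSort α) : K.srt = α := by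
  induction h with
  | app _ _ ih _ => simp [Tm.srt, ih]
  | _ => rfl

/-- A canonical derivation for `K[σ]` is cut at the occurrences of the variables of `K`. The
occurrences with nonempty labels are collected in `U`; their labels partition the label of the
whole derivation. Occurrences with empty labels need no bookkeeping, because canonical derivations
with empty labels are unique. The derivation for `K` exists in every environment that
contains all these labeled types. -/
theorem Translates.cut {σ : V × Srt → Tm L N V} (hσ : ∀ x, (σ x).HasSort x.2)
    {K : Tm L N V} (hK : ∀ a ∈ Δ, (a, 0) ∉ K.syms) {α : Srt} {S : Finset Δ} {τ : Ty Δ α}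
    {t : Tm L (NT N Δ) (VT V Δ)} {ts : Multiset (Tm L (NT N Δ) (VT V Δ))}
    (h : Translates bullet (fullArg bullet) (noEnv V Δ) (K.subst σ) α S τ t ts) :
    ∃ U : Set (Occ N V Δ),
      (∀ u ∈ U, u.var ∈ K.vars ∧ u.lty.1 ⊆ S ∧ u.lty.1.Nonempty ∧
        Translates bullet (fullArg bullet) (noEnv V Δ) (σ u.var) u.var.2 u.lty.1 u.lty.2
          u.tr u.trCum) ∧
      (∀ u ∈ U, ∀ u' ∈ U, ¬ Disjoint u.lty.1 u'.lty.1 → u = u') ∧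
      (∀ e ∈ S, ∃ u ∈ U, e ∈ u.lty.1) ∧
      ∀ (Γ : Env V Δ) (σ' : VT V Δ × Srt → Tm L (NT N Δ) (VT V Δ))
        (g : Δ → Multiset (Tm L (NT N Δ) (VT V Δ))),
        (∀ u ∈ U, u.lty ∈ Γ u.var.1 u.var.2 ∧
          (u.var.2 ≠ .o → σ' ((u.var.1, ⟨u.var.2, u.lty⟩), Ty.tr u.lty.2) = u.tr) ∧
          ∑ e ∈ u.lty.1, g e = u.trCum) →
        (∀ x ∈ K.vars, ∀ τ t ts,
          Translates bullet (fullArg bullet) (noEnv V Δ) (σ x) x.2 ∅ τ t ts →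
            (∅, τ) ∈ Γ x.1 x.2 ∧ σ' ((x.1, ⟨x.2, (∅, τ)⟩), Ty.tr τ) = t) →
        ∃ t₁ ts₁ b, Translates bullet anyArg Γ K α S τ t₁ ts₁ ∧
          (α ≠ .o → t = t₁.subst σ') ∧ (∀ s ∈ b, s = .sym bullet 0) ∧
          ts + b = ts₁.map (Tm.subst σ') + ∑ e ∈ S, g e := by
  induction K generalizing α S t ts with
  | var x β =>
    change Translates bullet (fullArg bullet) (noEnv V Δ) (σ (x, β)) α S τ t ts at h
    obtain rfl : β = α := (hσ (x, β)).srt_eq.symm.trans h.srt_eq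
    have hv := h.valid
    rcases S.eq_empty_or_nonempty with rfl | hne
    · have ho := hv.ne_o
      refine ⟨∅, by simp, by simp, by simp, fun Γ σ' g _ h2 => ?_⟩
      obtain ⟨h3, h4⟩ := h2 (x, β) (Set.mem_singleton _) τ t ts h
      refine ⟨_, _, 0, .var x β ∅ τ h3 hv, fun _ => ?_, by simp, ?_⟩
      · rw [if_neg ho]
        exact h4.symm
      · rw [if_neg ho, h.eq_zero rfl]
        simp
    · refine ⟨{⟨(x, β), (S, τ), t, ts⟩}, ?_, ?_, fun e he => ⟨_, rfl, he⟩, ?_⟩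
      · rintro u rfl
        exact ⟨rfl, Finset.Subset.refl _, hne, h⟩
      · rintro u rfl u' rfl -
        rfl
      · intro Γ σ' g h1 _
        obtain ⟨h3, h4, h5⟩ := h1 _ rfl
        refine ⟨_, _, if β = .o then {.sym bullet 0} else 0, .var x β S τ h3 hv,
          fun ho => ?_, ?_, ?_⟩
        · rw [if_neg ho]
          exact (h4 ho).symm
        · split_ifs <;> simp
        · rw [h5, add_comm]
          congr 1
          split_ifs <;> rfl
  | nt A β =>
    change Translates bullet (fullArg bullet) (noEnv V Δ) (.nt A β) α S τ t ts at h
    have hv := h.valid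
    obtain ⟨rfl, rfl, rfl, rfl⟩ := h.nt_inv
    exact ⟨∅, by simp, by simp, by simp, fun Γ σ' g _ _ =>
      ⟨_, _, 0, .nt A β τ hv, fun _ => rfl, by simp, by simp⟩⟩
  | sym a r =>
    change Translates bullet (fullArg bullet) (noEnv V Δ) (.sym a r) α S τ t ts at h
    have hv := h.valid
    obtain ⟨rfl, ⟨rfl, -, -, ha, -⟩ | ⟨hr, rfl, rfl, Ss, hlen, e⟩⟩ := h.sym_inv
    · exact absurd (by simp [Tm.syms]) (hK a ha)
    · cases e
      exact ⟨∅, by simp, by simp, by simp, fun Γ σ' g _ _ =>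
        ⟨_, _, 0, .sym a r hr Ss hlen hv, fun _ => rfl, by simp, by simp⟩⟩
  | app K M ihK ihM =>
    have hv := h.valid
    change Translates bullet (fullArg bullet) (noEnv V Δ) (.app (K.subst σ) (M.subst σ))
      α S τ t ts at h
    obtain ⟨β, S₀, Λ, t₀, ts₀, t', ts', -, h0, h1, hdisj, rfl, rfl, rfl⟩ := h.app_inv
    have hsep := (Ty.valid_fn.1 h0.valid.1).2.1
    obtain ⟨U₀, hU₀, hinj₀, hcov₀, hder₀⟩ :=
      ihK (fun a ha hm => hK a ha (by simp [Tm.syms, hm])) h0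
    have hex := fun l (hl : l ∈ Λ) => ihM (fun a ha hm => hK a ha (by simp [Tm.syms, hm])) (h1 l hl)
    choose U hU hinj hcov hder using hex
    refine ⟨U₀ ∪ {u | ∃ l hl, u ∈ U l hl}, ?_, ?_, ?_, ?_⟩
    · rintro u (hu | ⟨l, hl, hu⟩)
      · obtain ⟨h2, h3, h4, h5⟩ := hU₀ u hu
        exact ⟨.inl h2, h3.trans Finset.subset_union_left, h4, h5⟩
      · obtain ⟨h2, h3, h4, h5⟩ := hU l hl u hu
        exact ⟨.inr h2, (h3.trans (subset_labelUnion hl)).trans Finset.subset_union_right, h4, h5⟩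
    · rintro u (hu | ⟨l, hl, hu⟩) u' (hu' | ⟨l', hl', hu'⟩) hnd
      · exact hinj₀ u hu u' hu' hnd
      · exact absurd (hdisj.mono (hU₀ u hu).2.1
          ((hU l' hl' u' hu').2.1.trans (subset_labelUnion hl'))) hnd
      · exact absurd (hdisj.mono (hU₀ u' hu').2.1
          ((hU l hl u hu).2.1.trans (subset_labelUnion hl))).symm hnd
      · by_cases hll : l = l'
        · subst hll
          exact hinj l hl u hu u' hu' hnd
        · exact absurd ((hsep l hl l' hl' hll).mono (hU l hl u hu).2.1 (hU l' hl' u' hu').2.1) hnd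
    · intro e he
      rcases Finset.mem_union.1 he with he | he
      · obtain ⟨u, hu, he⟩ := hcov₀ e he
        exact ⟨u, .inl hu, he⟩
      · obtain ⟨l, hl, he⟩ := mem_labelUnion.1 he
        obtain ⟨u, hu, he⟩ := hcov l hl e he
        exact ⟨u, .inr ⟨l, hl, hu⟩, he⟩
    · intro Γ σ' g hg1 hg2
      obtain ⟨u₀, us₀, b₀, hu₀, ht₀, hb₀, e₀⟩ := hder₀ Γ σ' g (fun u hu => hg1 u (.inl hu))
        fun x hx => hg2 x (.inl hx)
      have hex : ∀ l : LTy Δ β, ∃ u us b, l ∈ Λ →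
          Translates bullet anyArg Γ M β l.1 l.2 u us ∧
          (β ≠ .o → t' l = u.subst σ') ∧ (∀ s ∈ b, s = .sym bullet 0) ∧
          ts' l + b = us.map (Tm.subst σ') + ∑ e ∈ l.1, g e := by
        intro l
        by_cases hl : l ∈ Λ
        · obtain ⟨u, us, b, h⟩ := hder l hl Γ σ' g (fun u hu => hg1 u (.inr ⟨l, hl, hu⟩))
            fun x hx => hg2 x (.inr hx)
          exact ⟨u, us, b, fun _ => h⟩
        · exact ⟨.sym bullet 0, 0, 0, fun h => absurd h hl⟩
      choose u us b hub using hex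
      have hnode : (if β = .o then t₀ else t₀.apps ((sorted Λ).map t')) =
          (if β = .o then u₀ else u₀.apps ((sorted Λ).map u)).subst σ' := by
        split_ifs with ho
        · exact ht₀ (by simp)
        · rw [Tm.subst_apps, ht₀ (by simp), List.map_map]
          congr 1
          exact List.map_congr_left fun l hl => (hub l (mem_sorted.1 hl)).2.1 ho
      refine ⟨_, _, b₀ + ∑ l ∈ Λ, b l, .app K M β α S₀ Λ τ u₀ us₀ u us trivial hu₀
        (fun l hl => (hub l hl).1) hdisj hv, fun _ => hnode, ?_, ?_⟩
      · intro s hs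
        rcases Multiset.mem_add.1 hs with hs | hs
        · exact hb₀ s hs
        · obtain ⟨l, hl, hs⟩ := Multiset.mem_sum.1 hs
          exact (hub l hl).2.2.1 s hs
      · have hsum : ∑ l ∈ Λ, ts' l + ∑ l ∈ Λ, b l =
            (∑ l ∈ Λ, us l).map (Tm.subst σ') + ∑ e ∈ labelUnion Λ, g e := by
          rw [← Finset.sum_add_distrib, sum_labelUnion hsep,
            ← Multiset.coe_mapAddMonoidHom, map_sum, ← Finset.sum_add_distrib]
          exact Finset.sum_congr rfl fun l hl => (hub l hl).2.2.2
        rw [hnode, Multiset.map_add, Multiset.map_add, Finset.sum_union hdisj]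
        have hif : ∀ X : Tm L (NT N Δ) (VT V Δ),
            Multiset.map (Tm.subst σ') (if α = .o then {X} else 0) =
              if α = .o then {X.subst σ'} else 0 := by
          intro X; split_ifs <;> simp
        rw [hif]
        generalize (if α = .o then _ else _ : Multiset (Tm L (NT N Δ) (VT V Δ))) = Z
        calc Z + ts₀ + ∑ l ∈ Λ, ts' l + (b₀ + ∑ l ∈ Λ, b l)
            = Z + (ts₀ + b₀) + (∑ l ∈ Λ, ts' l + ∑ l ∈ Λ, b l) := by abel
          _ = _ := by rw [e₀, hsum]; abel

/-- Subject expansion: a canonical derivation for a reduct arises from a derivation for the body of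
the rule and canonical derivations for the arguments. -/
theorem Translates.expand {R : Rule L N V} (hR : R.vars.Nodup)
    (hvars : ∀ x ∈ R.body.vars, x ∈ R.vars) (hleaf : ∀ a ∈ Δ, (a, 0) ∉ R.body.syms)
    {Ks : List (Tm L N V)} (hKs : List.Forall₂ Tm.HasSort Ks (R.vars.map Prod.snd))
    {S : Finset Δ} {t : Tm L (NT N Δ) (VT V Δ)} {ts : Multiset (Tm L (NT N Δ) (VT V Δ))}
    (h : Translates bullet (fullArg bullet) (noEnv V Δ) (R.body.subst (Tm.bind R.vars Ks)) .o S
      Ty.r t ts) :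
    ∃ (Γ : Env V Δ) (as : List (Tm L (NT N Δ) (VT V Δ)))
      (ts' b : Multiset (Tm L (NT N Δ) (VT V Δ)))
      (D : Deriv N Γ R.body .o (envTy Γ R.vars).labels Ty.r),
      (∀ x α, (x, α) ∉ R.vars → Γ x α = ∅) ∧ (envTy Γ R.vars).Valid ∧
      S = (envTy Γ R.vars).labels ∧ as.length = (R.vars.flatMap (splitVar Γ)).length ∧
      Spine bullet (fullArg bullet) (noEnv V Δ) Ks _ (envTy Γ R.vars) as ts' ∧
      (∀ s ∈ b, s = .sym bullet 0) ∧
      ts + b = ((D.trCum bullet).map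
        (Tm.subst (Tm.bind (R.vars.flatMap (splitVar Γ)) as)) : Multiset _) + ts' := by
  classical
  set σ := Tm.bind R.vars Ks with hσdef
  have hlen : Ks.length = R.vars.length := by simpa using hKs.length_eq
  obtain ⟨U, hU, hinj, hcov, hder⟩ := Translates.cut (Tm.hasSort_bind hKs) hleaf h
  -- The environment consists of the labeled types found at the cut, and of all the labeled types
  -- with empty label that the arguments have: the latter make the derivations of the arguments
  -- canonical also in the spine before the reduction.
  let Γ : Env V Δ := fun x α =>
    haveI := Ty.finite (Δ := Δ) α
    if (x, α) ∈ R.vars then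
      (Set.toFinite {l : LTy Δ α | l ∈ emptyLabeled bullet (σ (x, α)) α ∨
        ∃ u ∈ U, (⟨u.var, u.lty⟩ : Σ x : V × Srt, LTy Δ x.2) = ⟨(x, α), l⟩}).toFinset
    else ∅
  have hΓ : ∀ x α, (x, α) ∉ R.vars → Γ x α = ∅ := fun x α hx => if_neg hx
  have memΓ : ∀ x ∈ R.vars, ∀ l : LTy Δ x.2, l ∈ Γ x.1 x.2 ↔
      (l ∈ emptyLabeled bullet (σ x) x.2 ∨
        ∃ u ∈ U, (⟨u.var, u.lty⟩ : Σ x : V × Srt, LTy Δ x.2) = ⟨x, l⟩) := by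
    rintro ⟨x, α⟩ hx l
    simp only [Γ, if_pos hx, Set.Finite.mem_toFinset, Set.mem_ofPred_eq]
  have hUvar : ∀ u ∈ U, u.var ∈ R.vars := fun u hu => hvars _ (hU u hu).1
  have hUΓ : ∀ u ∈ U, u.lty ∈ Γ u.var.1 u.var.2 := fun u hu =>
    (memΓ _ (hUvar u hu) _).2 (.inr ⟨u, hu, rfl⟩)
  -- The canonical derivations for the bindings of `Γ`.
  have hex : ∀ (x : V × Srt) (l : LTy Δ x.2), ∃ t ts,
      (x ∈ R.vars → l ∈ Γ x.1 x.2 →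
        Translates bullet (fullArg bullet) (noEnv V Δ) (σ x) x.2 l.1 l.2 t ts) ∧
      ∀ u ∈ U, (⟨u.var, u.lty⟩ : Σ x : V × Srt, LTy Δ x.2) = ⟨x, l⟩ →
        t = u.tr ∧ ts = u.trCum := by
    intro x l
    by_cases hu : ∃ u ∈ U, (⟨u.var, u.lty⟩ : Σ x : V × Srt, LTy Δ x.2) = ⟨x, l⟩
    · obtain ⟨u, hu, e⟩ := hu
      cases e
      refine ⟨u.tr, u.trCum, fun _ _ => (hU u hu).2.2.2, fun u' hu' e => ?_⟩
      have h1 : u'.lty.1 = u.lty.1 := by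
        obtain ⟨x, l, t, ts⟩ := u'
        obtain ⟨x', l', t', ts'⟩ := u
        cases e
        rfl
      obtain rfl : u' = u := by
        refine hinj u' hu' u hu ?_
        rw [h1, disjoint_self]
        exact (hU u hu).2.2.1.ne_empty
      exact ⟨rfl, rfl⟩
    · by_cases hx : x ∈ R.vars ∧ l ∈ Γ x.1 x.2
      · have hl := ((memΓ x hx.1 l).1 hx.2).resolve_right hu
        obtain ⟨S, τ⟩ := l
        obtain ⟨he, t, ts, hd⟩ := mem_emptyLabeled.1 hl
        obtain rfl : S = ∅ := he
        obtain ⟨t', ts', hd'⟩ := hd.exists_canonical hd.valid.1 (Ty.extends_refl τ)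
        exact ⟨t', ts', fun _ _ => hd', fun u hu' e => absurd ⟨u, hu', e⟩ hu⟩
      · exact ⟨.sym bullet 0, 0, fun h1 h2 => absurd ⟨h1, h2⟩ hx,
          fun u hu' e => absurd ⟨u, hu', e⟩ hu⟩
  choose E F hEF hEU using hex
  have hnon : ∀ x ∈ R.vars, ∀ l ∈ Γ x.1 x.2, l.1.Nonempty →
      ∃ u ∈ U, (⟨u.var, u.lty⟩ : Σ x : V × Srt, LTy Δ x.2) = ⟨x, l⟩ := by
    intro x hx l hl hne
    exact ((memΓ x hx l).1 hl).resolve_left fun he => hne.ne_empty (mem_emptyLabeled.1 he).1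
  -- The labels of the bindings are disjoint, because those of the occurrences are.
  have hoverlap : ∀ x ∈ R.vars, ∀ l ∈ Γ x.1 x.2, ∀ y ∈ R.vars, ∀ l' ∈ Γ y.1 y.2, ∀ e ∈ l.1,
      e ∈ l'.1 → (⟨x, l⟩ : Σ x : V × Srt, LTy Δ x.2) = ⟨y, l'⟩ := by
    intro x hx l hl y hy l' hl' e he he'
    obtain ⟨u, hu, eu⟩ := hnon x hx l hl ⟨e, he⟩
    obtain ⟨u', hu', eu'⟩ := hnon y hy l' hl' ⟨e, he'⟩
    cases eu
    cases eu'
    obtain rfl := hinj u hu u' hu' (Finset.not_disjoint_iff.2 ⟨e, he, he'⟩)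
    rfl
  have hvalid : (envTy Γ R.vars).Valid := by
    refine envTy_valid_iff.2 ⟨fun x hx => ⟨fun l hl => (hEF x l hx hl).valid, ?_⟩, ?_⟩
    · intro l hl l' hl' hne
      refine Finset.disjoint_left.2 fun e he he' => hne ?_
      have := hoverlap x hx l hl x hx l' hl' e he he'
      cases this
      rfl
    · refine hR.imp_of_mem fun {x y} hx hy hne => Finset.disjoint_left.2 fun e he he' => hne ?_
      obtain ⟨l, hl, he⟩ := mem_labelUnion.1 he
      obtain ⟨l', hl', he'⟩ := mem_labelUnion.1 he'
      exact congrArg Sigma.fst (hoverlap x hx l hl y hy l' hl' e he he')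
  have hS : S = (envTy Γ R.vars).labels := by
    ext e
    rw [mem_labels_envTy]
    constructor
    · intro he
      obtain ⟨u, hu, he⟩ := hcov e he
      exact ⟨u.var, hUvar u hu, u.lty, hUΓ u hu, he⟩
    · rintro ⟨x, hx, l, hl, he⟩
      obtain ⟨u, hu, eu⟩ := hnon x hx l hl ⟨e, he⟩
      cases eu
      exact (hU u hu).2.1 he
  obtain ⟨g, hg⟩ := exists_distribution hvalid F fun x hx l hl he => (hEF x l hx hl).eq_zero he
  set as := R.vars.flatMap fun x => if x.2 = .o then [] else (sorted (Γ x.1 x.2)).map (E x)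
  obtain ⟨t₁, ts₁, b, hd, -, hb, e⟩ := hder Γ (Tm.bind (R.vars.flatMap (splitVar Γ)) as) g
    (fun u hu => by
      obtain ⟨h1, h2⟩ := hEU u.var u.lty u hu rfl
      refine ⟨hUΓ u hu, fun ho => ?_, ?_⟩
      · rw [bind_splitVar Γ E (hUvar u hu) ho (hUΓ u hu), h1]
      · rw [hg u.var (hUvar u hu) u.lty (hUΓ u hu), h2])
    (fun x hx τ t ts hd => by
      have hmem : ((∅, τ) : LTy Δ x.2) ∈ Γ x.1 x.2 := (memΓ x (hvars x hx) _).2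
        (.inl (mem_emptyLabeled.2 ⟨rfl, _, _, hd.mono fun _ _ _ _ => trivial⟩))
      refine ⟨hmem, ?_⟩
      rw [← (hEF x (∅, τ) (hvars x hx) hmem).unique hd]
      exact bind_splitVar Γ E (hvars x hx) hd.valid.ne_o hmem)
  subst hS
  obtain ⟨D, -, rfl⟩ := hd.exists_deriv
  refine ⟨Γ, as, _, b, D, hΓ, hvalid, rfl, length_flatMap_splitVar Γ R.vars E,
    (spine_envTy_iff hR).2 ⟨hlen, E, F, fun x hx => ⟨fun τ => ?_, fun l hl => hEF x l hx hl⟩,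
      rfl, rfl⟩, hb, ?_⟩
  · constructor
    · intro hl
      exact ⟨_, _, (hEF x _ hx hl).mono fun _ _ _ _ => trivial⟩
    · rintro ⟨t, ts, hd⟩
      exact (memΓ x hx _).2 (.inl (mem_emptyLabeled.2 ⟨rfl, t, ts, hd⟩))
  · rw [e, sum_labels_envTy hvalid]
    congr 2
    exact List.map_congr_left fun x hx => Finset.sum_congr rfl fun l hl => hg x hx l hl

end Expansion

/-! ### Completeness -/

section Completeness

variable {L : Type u} {N : Type v} {V : Type w} [DecidableEq L] {bullet : L} {Δ : Finset L}

/-- The letters of the nullary symbols in a multiset of symbols. -/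
def leafLetters (c : Multiset (L × ℕ)) : Multiset L := (c.filter fun p => p.2 = 0).map Prod.fst

@[simp] theorem leafLetters_add (c c' : Multiset (L × ℕ)) :
    leafLetters (c + c') = leafLetters c + leafLetters c' := by
  simp [leafLetters]

theorem leafLetters_cons_of_ne {a : L} {r : ℕ} (hr : r ≠ 0) (c : Multiset (L × ℕ)) :
    leafLetters ((a, r) ::ₘ c) = leafLetters c := by
  simp [leafLetters, hr]

theorem tr_envTy (Γ : Env V Δ) (xs : List (V × Srt)) :
    (envTy Γ xs).tr = Srt.arrs ((xs.flatMap (splitVar Γ)).map Prod.snd) .o := by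
  induction xs with
  | nil => rfl
  | cons x xs ih =>
    refine (Ty.tr_fn (Γ x.1 x.2) (envTy Γ xs)).trans ?_
    rw [ih, List.flatMap_cons, splitVar]
    split_ifs
    · rfl
    · rw [List.map_append, List.map_map, Srt.arrs, Srt.arrs, Srt.arrs, List.foldr_append]
      rfl

theorem trRule_sort (R : Rule L N V) (Γ : Env V Δ)
    (D : Deriv N Γ R.body .o (envTy Γ R.vars).labels Ty.r) :
    (trRule bullet R Γ D).sort = (envTy Γ R.vars).tr :=
  (tr_envTy Γ R.vars).symm

theorem fullArg_o (K : Tm L N V) {S : Finset Δ} (hS : S.Nonempty) (τ : Ty Δ .o) :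
    fullArg bullet K .o {(S, τ)} := by
  intro τ
  constructor
  · intro h
    rw [Finset.mem_singleton, Prod.mk.injEq] at h
    exact absurd h.1.symm hS.ne_empty
  · rintro ⟨t, ts, h⟩
    exact absurd rfl h.valid.ne_o

/-- If a term reduces to a tree whose leaves have pairwise distinct labels from `Δ`, then it has a
canonical derivation whose translation reduces to trees with the same letters. -/
theorem Run.exists_translates {P : Set (Rule L N V)} {Q : Set (Rule L (NT N Δ) (VT V Δ))}
    (hP : ∀ R ∈ P, R.vars.Nodup ∧ R.body.HasSort .o ∧ (∀ x ∈ R.body.vars, x ∈ R.vars) ∧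
      ∀ a ∈ Δ, (a, 0) ∉ R.body.syms)
    (hQ : lowerRules bullet Δ P ⊆ Q) {M : Tm L N V} {n : ℕ} {c : Multiset (L × ℕ)}
    (h : Run P {M} n c) (hM : M.HasSort .o) (hnd : (leafLetters c).Nodup)
    (hΔ : ∀ a ∈ leafLetters c, a ∈ Δ) :
    ∃ (S : Finset Δ) (t : Tm L (NT N Δ) (VT V Δ)) (ts : Multiset (Tm L (NT N Δ) (VT V Δ)))
      (n' : ℕ) (c' : Multiset (L × ℕ)),
      Translates bullet (fullArg bullet) (noEnv V Δ) M .o S Ty.r t ts ∧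
      S.val.map Subtype.val = leafLetters c ∧ Run Q ts n' c' ∧
      visible bullet c' = visible bullet c := by
  revert hM hnd hΔ
  refine Run.single_induction (Q := fun M c => M.HasSort .o → (leafLetters c).Nodup →
    (∀ a ∈ leafLetters c, a ∈ Δ) → ∃ (S : Finset Δ) (t : Tm L (NT N Δ) (VT V Δ))
      (ts : Multiset (Tm L (NT N Δ) (VT V Δ))) (n' : ℕ) (c' : Multiset (L × ℕ)),
      Translates bullet (fullArg bullet) (noEnv V Δ) M .o S Ty.r t ts ∧
      S.val.map Subtype.val = leafLetters c ∧ Run Q ts n' c' ∧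
      visible bullet c' = visible bullet c) ?_ ?_ h
  · intro a Ks cs hKs hM hnd hΔ
    replace hM := (Tm.hasSort_sym_apps hM).2
    cases Ks with
    | nil =>
      cases hKs
      have ha : a ∈ Δ := hΔ a (by simp [leafLetters])
      exact ⟨{⟨a, ha⟩}, _, _, 0, _, .leaf a ha,
        by simp [leafLetters, Multiset.filter_singleton], .sym a [] 0 0 0 .zero, rfl⟩
    | cons K Ks =>
      rw [leafLetters_cons_of_ne (by simp)] at hnd hΔ ⊢
      generalize hKs' : K :: Ks = Ks' at *
      obtain ⟨Ss, ts, n', c', hlen, hv, hl, hs, hr, hc⟩ : ∃ (Ss : List (Finset Δ))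
          (ts : Multiset (Tm L (NT N Δ) (VT V Δ))) (n' : ℕ) (c' : Multiset (L × ℕ)),
          Ss.length = Ks'.length ∧ (leafTy Ss).Valid ∧
          (leafTy Ss).labels.val.map Subtype.val = leafLetters cs.sum ∧
          Spine bullet (fullArg bullet) (noEnv V Δ) Ks' _ (leafTy Ss) [] ts ∧
          Run Q ts n' c' ∧ visible bullet c' = visible bullet cs.sum := by
        clear hKs'
        induction hKs with
        | nil => exact ⟨[], 0, 0, 0, rfl, trivial, rfl, spine_nil.2 ⟨rfl, rfl⟩, .zero, rfl⟩
        | cons h1 _ ih =>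
          rw [List.sum_cons, leafLetters_add] at hnd hΔ
          obtain ⟨hnd1, hnd2, hdis⟩ := Multiset.nodup_add.1 hnd
          obtain ⟨S, t, ts₁, n₁, c₁, ht, hl1, hr1, hc1⟩ := h1 (hM _ (by simp)) hnd1
            fun a ha => hΔ a (Multiset.mem_add.2 (.inl ha))
          obtain ⟨Ss, ts₂, n₂, c₂, hlen, hv, hl2, hs, hr2, hc2⟩ :=
            ih hnd2 (fun a ha => hΔ a (Multiset.mem_add.2 (.inr ha)))
              fun K hK => hM K (by simp [hK])
          have hS := ht.valid.2 rfl
          have hlu : labelUnion ({(S, Ty.r)} : Finset (LTy Δ .o)) = S :=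
            Finset.singleton_biUnion
          have hd : Disjoint S (leafTy Ss).labels := by
            refine Finset.disjoint_left.2 fun e he he' => ?_
            rw [← hl1, ← hl2] at hdis
            exact Multiset.disjoint_left.1 hdis (Multiset.mem_map_of_mem _ he)
              (Multiset.mem_map_of_mem _ he')
          refine ⟨S :: Ss, ts₁ + ts₂, n₁ + n₂, c₁ + c₂, by simp [hlen], ?_, ?_, ?_,
            hr1.add hr2, by simp [hc1, hc2]⟩
          · refine ⟨?_, ?_, ?_, hv⟩
            · intro l hl
              obtain rfl := Finset.mem_singleton.1 hl
              exact ⟨trivial, fun _ => hS⟩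
            · intro l hl l' hl' hne
              exact absurd ((Finset.mem_singleton.1 hl).trans (Finset.mem_singleton.1 hl').symm) hne
            · rw [hlu]; exact hd
          · rw [List.sum_cons, leafLetters_add, ← hl1, ← hl2, ← Multiset.map_add]
            congr 1
            change (labelUnion ({(S, Ty.r)} : Finset (LTy Δ .o)) ∪ (leafTy Ss).labels).val = _
            rw [hlu, ← Finset.disjUnion_eq_union _ _ hd]
            rfl
          · refine spine_cons.2
              ⟨fullArg_o _ hS _, fun _ => t, fun _ => ts₁, [], ts₂, ?_, hs, rfl, ?_⟩
            · intro l hl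
              obtain rfl := Finset.mem_singleton.1 hl
              exact ht
            · rw [Finset.sum_singleton]
      subst hKs'
      have hne : (leafTy Ss).labels.Nonempty := by
        cases Ss with
        | nil => simp at hlen
        | cons S Ss =>
          obtain ⟨e, he⟩ := (hv.1 (S, Ty.r) (Finset.mem_singleton_self _)).2 rfl
          exact ⟨e, Finset.mem_union_left _
            (mem_labelUnion.2 ⟨(S, Ty.r), Finset.mem_singleton_self _, he⟩)⟩
      refine ⟨_, _, _, n', (a, 0) ::ₘ c', translates_sym_apps hv hlen hne hs, hl,
        .sym a [] ts n' c' (by simpa using hr), ?_⟩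
      rw [visible_cons, visible_cons, hc]
  · intro R hR Ms hlen c ih hM hnd hΔ
    obtain ⟨hvn, hbody, hvars, hleaf⟩ := hP R hR
    have hKs := Tm.nt_apps_hasSort hM
    obtain ⟨S, t, ts, n', c', ht, hl, hr, hc⟩ :=
      ih (hbody.subst (Tm.hasSort_bind hKs)) hnd hΔ
    have hne := ht.valid.2 rfl
    obtain ⟨Γ, as, ts', b, D, hΓ, hv, rfl, hlas, hs, hb, e⟩ := ht.expand hvn hvars hleaf hKs
    obtain ⟨c'', hr2, hc2⟩ := hr.add_bullets hb
    rw [e] at hr2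
    obtain ⟨n₁, n₂, c₁, c₂, hr3, hr4, rfl, rfl⟩ := hr2.split
    have hbody' : (trRule bullet R Γ D).body.subst (Tm.bind (trRule bullet R Γ D).vars as) =
        (Tm.sym bullet ((D.trCum bullet).map
          (Tm.subst (Tm.bind (R.vars.flatMap (splitVar Γ)) as))).length).apps
          ((D.trCum bullet).map (Tm.subst (Tm.bind (R.vars.flatMap (splitVar Γ)) as))) := by
      rw [trRule, merge, Tm.subst_apps, List.length_map]
      rfl
    have hr5 := Run.sym bullet _ ts' _ _ (hr3.add hr4)
    rw [← hbody'] at hr5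
    have hr6 := Run.rule (trRule bullet R Γ D) (hQ ⟨R, hR, Γ, hΓ, hv, D, rfl⟩) as hlas _ _ _ hr5
    rw [trRule_sort] at hr6
    refine ⟨_, _, _, _, _,
      translates_nt_apps_iff.2 ⟨envTy Γ R.vars, as, ts', hv, rfl, hne, hs, rfl, rfl⟩, hl, hr6, ?_⟩
    rw [visible_cons_bullet, hc2, hc]

end Completeness

/-! ### The transformed scheme is a recursion scheme -/

section LowerHORS

variable {L : Type u} {N : Type v} {V : Type w} [DecidableEq L] (bullet : L) {Δ : Finset L}

/-- A term may have many derivations, but as there are finitely many types, they have only finitely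
many translations. -/
theorem finite_tr_trCum (Γ : Env V Δ) (M : Tm L N V) (α : Srt) (S : Finset Δ) (τ : Ty Δ α) :
    {p | ∃ D : Deriv N Γ M α S τ, p = (D.tr bullet, D.trCum bullet)}.Finite := by
  classical
  induction M generalizing α S with
  | var x β =>
    refine Set.Subsingleton.finite ?_
    rintro _ ⟨D, rfl⟩ _ ⟨D', rfl⟩
    cases D
    cases D'
    rfl
  | nt A β =>
    refine Set.Subsingleton.finite ?_
    rintro _ ⟨D, rfl⟩ _ ⟨D', rfl⟩
    cases D
    cases D'
    rfl
  | sym a r =>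
    refine ((Set.finite_singleton [Tm.sym a 0]).insert []).image (Prod.mk (Tm.sym a 0)) |>.subset ?_
    rintro _ ⟨D, rfl⟩
    cases D with
    | leaf a ha => exact ⟨_, .inr rfl, rfl⟩
    | sym a r hr Ss hlen hv =>
      refine ⟨[], .inl rfl, ?_⟩
      simp [Deriv.tr, Deriv.trCum, hv.ne_o]
  | app K M ihK ihM =>
    rcases hK : K.srt with _ | ⟨β, α'⟩
    · refine Set.finite_empty.subset ?_
      rintro _ ⟨D, rfl⟩
      cases D with
      | app _ _ β _ _ S₀ Λ _ D₀ D hdisj hS hv =>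
        have := (D₀.translates (bullet := bullet)).srt_eq
        rw [hK] at this
        cases this
    · have := Ty.finite (Δ := Δ) β
      let G : ∀ Λ : Finset (LTy Δ β),
          ((Tm L (NT N Δ) (VT V Δ) × List (Tm L (NT N Δ) (VT V Δ))) ×
            (∀ _ : {l // l ∈ sorted Λ}, Tm L (NT N Δ) (VT V Δ) × List (Tm L (NT N Δ) (VT V Δ)))) →
          Tm L (NT N Δ) (VT V Δ) × List (Tm L (NT N Δ) (VT V Δ)) := fun Λ q =>
        (if β = .o then q.1.1 else q.1.1.apps ((sorted Λ).attach.map fun l => (q.2 l).1),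
          (if α = .o then
            [if β = .o then q.1.1 else q.1.1.apps ((sorted Λ).attach.map fun l => (q.2 l).1)]
            else []) ++ (q.1.2 ++ ((sorted Λ).attach.map fun l => (q.2 l).2).flatten))
      have hfin : ∀ (S₀ : Finset Δ) (Λ : Finset (LTy Δ β)),
          (G Λ '' ({p | ∃ D : Deriv N Γ K (.arr β α) S₀ (Ty.fn Λ τ),
              p = (D.tr bullet, D.trCum bullet)} ×ˢ
            Set.pi Set.univ fun l : {l // l ∈ sorted Λ} =>
              {p | ∃ D : Deriv N Γ M β l.1.1 l.1.2, p = (D.tr bullet, D.trCum bullet)})).Finite :=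
        fun S₀ Λ => ((ihK _ _ _).prod (Set.Finite.pi fun l => ihM _ _ _)).image _
      refine (Set.finite_iUnion fun S₀ => Set.finite_iUnion fun Λ => hfin S₀ Λ).subset ?_
      rintro _ ⟨D, rfl⟩
      cases D with
      | app _ _ β' _ _ S₀ Λ _ D₀ D hdisj hS hv =>
        have := (D₀.translates (bullet := bullet)).srt_eq
        rw [hK] at this
        cases this
        refine Set.mem_iUnion.2 ⟨S₀, Set.mem_iUnion.2 ⟨Λ, ?_⟩⟩
        refine ⟨((D₀.tr bullet, D₀.trCum bullet), fun l =>
          ((D l.1 (mem_sorted.1 l.2)).tr bullet, (D l.1 (mem_sorted.1 l.2)).trCum bullet)),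
          ⟨⟨D₀, rfl⟩, fun l _ => ⟨_, rfl⟩⟩, ?_⟩
        simp only [G]
        rw [Deriv.trCum, Deriv.tr]

theorem finite_env (xs : List (V × Srt)) :
    {Γ : Env V Δ | ∀ x α, (x, α) ∉ xs → Γ x α = ∅}.Finite := by
  have : ∀ α, Finite (Ty Δ α) := Ty.finite
  let f : Env V Δ → ∀ x : {x // x ∈ xs}, Finset (LTy Δ x.1.2) := fun Γ x => Γ x.1.1 x.1.2
  have : Finite {x // x ∈ xs} := xs.finite_toSet
  refine Set.Finite.of_finite_image (f := f) (Set.toFinite _) ?_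
  intro Γ hΓ Γ' hΓ' h
  funext x α
  by_cases hx : (x, α) ∈ xs
  · exact congrFun h ⟨(x, α), hx⟩
  · rw [hΓ x α hx, hΓ' x α hx]

theorem finite_lowerRules {P : Set (Rule L N V)} (hP : P.Finite) :
    (lowerRules bullet Δ P).Finite := by
  let G : Rule L N V → Env V Δ → List (Tm L (NT N Δ) (VT V Δ)) → Rule L (NT N Δ) (VT V Δ) :=
    fun R Γ l => ⟨some (R.nt, ⟨_, envTy Γ R.vars⟩), R.vars.flatMap (splitVar Γ), merge bullet l⟩
  refine (hP.biUnion fun R _ => (finite_env (Δ := Δ) R.vars).biUnion fun Γ _ =>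
    ((finite_tr_trCum bullet Γ R.body .o (envTy Γ R.vars).labels Ty.r).image Prod.snd).image
      (G R Γ)).subset ?_
  rintro _ ⟨R, hR, Γ, hΓ, -, D, rfl⟩
  refine Set.mem_biUnion hR (Set.mem_biUnion hΓ ?_)
  exact ⟨_, ⟨_, ⟨D, rfl⟩, rfl⟩, rfl⟩

theorem merge_hasSort {Rs : List (Tm L N V)} (h : ∀ K ∈ Rs, K.HasSort .o) :
    (merge bullet Rs).HasSort .o := Tm.sym_apps_hasSort h

theorem mem_vars_merge {Rs : List (Tm L N V)} {x : V × Srt} (h : x ∈ (merge bullet Rs).vars) :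
    ∃ K ∈ Rs, x ∈ K.vars := by
  rcases Tm.mem_vars_apps.1 h with h | h
  · exact absurd h (Set.notMem_empty _)
  · exact h

theorem nodup_flatMap_splitVar (Γ : Env V Δ) {xs : List (V × Srt)} (h : xs.Nodup) :
    (xs.flatMap (splitVar Γ)).Nodup := by
  refine List.nodup_flatMap.2 ⟨fun x _ => ?_, h.imp fun {x y} hne => ?_⟩
  · rw [splitVar]
    split_ifs
    · exact List.nodup_nil
    · refine (nodup_sorted _).map fun l l' h => ?_
      simpa using congrArg (fun p => p.1.2) h
  · intro z hz hz'
    rw [splitVar] at hz hz'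
    split_ifs at hz hz'
    · exact absurd hz List.not_mem_nil
    · exact absurd hz List.not_mem_nil
    · exact absurd hz' List.not_mem_nil
    obtain ⟨l, hl, rfl⟩ := List.mem_map.1 hz
    obtain ⟨l', hl', h⟩ := List.mem_map.1 hz'
    simp only [Prod.mk.injEq] at h
    exact hne (Prod.ext h.1.1 (congrArg Sigma.fst h.1.2)).symm

theorem trRule_wf {R : Rule L N V} (hR : R.vars.Nodup) {Γ : Env V Δ}
    (hΓ : ∀ x α, (x, α) ∉ R.vars → Γ x α = ∅)
    (D : Deriv N Γ R.body .o (envTy Γ R.vars).labels Ty.r) :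
    (trRule bullet R Γ D).vars.Nodup ∧ (trRule bullet R Γ D).body.HasSort .o ∧
      ∀ y ∈ (trRule bullet R Γ D).body.vars, y ∈ (trRule bullet R Γ D).vars := by
  have hout := (D.translates (bullet := bullet)).output.2
  refine ⟨nodup_flatMap_splitVar Γ hR, merge_hasSort bullet fun K hK => (hout K hK).1, ?_⟩
  intro y hy
  obtain ⟨K, hK, hy⟩ := mem_vars_merge bullet hy
  obtain ⟨x, α, l, hα, hl, rfl⟩ := (hout K hK).2 y hy
  have hx : (x, α) ∈ R.vars := by
    by_contra hx
    rw [hΓ x α hx] at hl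
    simp at hl
  refine List.mem_flatMap.2 ⟨(x, α), hx, ?_⟩
  rw [splitVar, if_neg hα]
  exact List.mem_map.2 ⟨l, mem_sorted.2 hl, rfl⟩

/-- The initial rule of the transformed scheme, where `A` was initial before normalization. -/
noncomputable def lowerInitRule (V : Type w) (Δ : Finset L) (A : N) :
    Rule L (NT N Δ) (VT V Δ) :=
  ⟨none, [],
    merge bullet
      (Tm.nt (some (A, ⟨_, leafTy ((enum Δ).map fun e => {e})⟩))
          (leafTy ((enum Δ).map fun e => {e})).tr ::
        leafTms _ _ Δ)⟩

theorem lowering_rules (S : Scheme L N V) :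
    (lowering bullet Δ S).rules =
      {lowerInitRule bullet (V ⊕ Δ) Δ (some S.init)} ∪
        lowerRules bullet Δ (normRule Δ '' S.rules) := by
  have h : {R' | ∃ R ∈ (normalize Δ S).rules, R.nt ≠ (normalize Δ S).init ∧ ∃ Γ : Env (V ⊕ Δ) Δ,
      (∀ x α, (x, α) ∉ R.vars → Γ x α = ∅) ∧ (envTy Γ R.vars).Valid ∧
      ∃ D : Deriv (Option N) Γ R.body .o (envTy Γ R.vars).labels Ty.r,
        R' = trRule bullet R Γ D} = lowerRules bullet Δ (normRule Δ '' S.rules) := by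
    ext R'
    constructor
    · rintro ⟨R, rfl | hR, hne, h⟩
      · exact absurd rfl hne
      · exact ⟨R, hR, h⟩
    · rintro ⟨R, hR, h⟩
      refine ⟨R, .inr hR, ?_, h⟩
      obtain ⟨R, -, rfl⟩ := hR
      exact Option.some_ne_none _
  rw [← h]
  rfl

theorem Scheme.IsHORS.lowering {S : Scheme L N V} (hS : S.IsHORS) :
    (Hors.lowering bullet Δ S).IsHORS := by
  have hN := hS.normalize Δ
  rw [Scheme.IsHORS, lowering_rules]
  refine ⟨(Set.finite_singleton _).union (finite_lowerRules bullet (hS.1.image _)), ?_⟩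
  rintro R' (rfl | ⟨R, hR, Γ, hΓ, -, D, rfl⟩)
  · refine ⟨List.nodup_nil, merge_hasSort bullet ?_, ?_⟩
    · intro K hK
      rcases List.mem_cons.1 hK with rfl | hK
      · rw [leafTy_tr]
        exact .nt _ _
      · obtain ⟨e, -, rfl⟩ := List.mem_map.1 hK
        exact .sym _ 0
    · intro y hy
      obtain ⟨K, hK, hy⟩ := mem_vars_merge bullet hy
      rcases List.mem_cons.1 hK with rfl | hK
      · exact absurd hy (Set.notMem_empty _)
      · obtain ⟨e, -, rfl⟩ := List.mem_map.1 hK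
        exact absurd hy (Set.notMem_empty _)
  · exact trRule_wf bullet (hN.2 R (.inr hR)).1 hΓ D

/-! ### The order of the transformed scheme -/

theorem Srt.ord_arrs_le {l : List Srt} {γ : Srt} {n : ℕ} (h : ∀ α ∈ l, α.ord + 1 ≤ n)
    (hγ : γ.ord ≤ n) : (Srt.arrs l γ).ord ≤ n := by
  induction l with
  | nil => exact hγ
  | cons α l ih =>
    have h1 := h α (by simp)
    have h2 := ih fun β hβ => h β (by simp [hβ])
    change max (1 + α.ord) (Srt.arrs l γ).ord ≤ n
    omega

theorem Srt.ord_pow_le (n : ℕ) (γ : Srt) : (Srt.pow n γ).ord ≤ max 1 γ.ord := by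
  induction n with
  | zero => exact le_max_right _ _
  | succ n ih =>
    change max (1 + 0) (Srt.pow n γ).ord ≤ _
    omega

theorem Srt.one_le_ord {α : Srt} (h : α ≠ .o) : 1 ≤ α.ord := by
  cases α with
  | o => exact absurd rfl h
  | arr α β =>
    change 1 ≤ max (1 + α.ord) β.ord
    omega

/-- The translation lowers the order, because arguments of sort `o` disappear. -/
theorem Ty.ord_tr_le {α : Srt} (τ : Ty Δ α) : τ.tr.ord ≤ α.ord - 1 := by
  induction α with
  | o => exact le_rfl
  | arr α β ihα ihβ =>
    obtain ⟨Λ, τ⟩ := τ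
    have hβ := ihβ τ
    change (Ty.fn Λ τ).tr.ord ≤ max (1 + α.ord) β.ord - 1
    rw [Ty.tr_fn]
    split_ifs with ho
    · omega
    · have h1 := Srt.one_le_ord ho
      refine Srt.ord_arrs_le (fun γ hγ => ?_) (by omega)
      obtain ⟨l, -, rfl⟩ := List.mem_map.1 hγ
      have h2 := ihα l.2
      omega

theorem order_lowering_le {S : Scheme L N V} (hS : S.IsHORS) {k : ℕ} (hk : 1 ≤ k)
    (hord : S.order = k) : (lowering bullet Δ S).order ≤ k - 1 := by
  refine csSup_le' ?_
  rintro _ ⟨R', hR', rfl⟩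
  rw [lowering_rules] at hR'
  rcases hR' with rfl | ⟨_, ⟨R, hR, rfl⟩, Γ, hΓ, -, D, rfl⟩
  · exact Nat.zero_le _
  · have h1 : R.sort.ord ≤ k := by
      rw [← hord]
      exact le_csSup (hS.1.image _).bddAbove ⟨R, hR, rfl⟩
    have h2 : (normRule Δ R).sort.ord ≤ k := by
      rw [normRule_sort]
      exact (Srt.ord_pow_le _ _).trans (by omega)
    change (trRule bullet (normRule Δ R) Γ D).sort.ord ≤ k - 1
    rw [trRule_sort]
    exact (Ty.ord_tr_le (envTy Γ (normRule Δ R).vars)).trans (Nat.sub_le_sub_right h2 1)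

end LowerHORS

/-! ### The initial nonterminal -/

section Initial

variable {L : Type u} {N : Type v} {V : Type w} [DecidableEq L] {bullet : L} {Δ : Finset L}
  {P : Tm L N V → (α : Srt) → Finset (LTy Δ α) → Prop} {Γ : Env V Δ}

theorem nodup_enum (Δ : Finset L) : (enum Δ).Nodup := Finset.nodup_toList _

theorem labels_leafTy_singletons (es : List Δ) :
    (leafTy (es.map fun e => {e})).labels = es.toFinset := by
  induction es with
  | nil => rfl
  | cons e es ih =>
    change labelUnion (α := .o) {(({e} : Finset Δ), Ty.r)} ∪
      (leafTy (es.map fun e => {e})).labels = _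
    rw [ih, List.toFinset_cons, labelUnion, Finset.singleton_biUnion, Finset.insert_eq]

theorem valid_leafTy_singletons {es : List Δ} (h : es.Nodup) :
    (leafTy (es.map fun e => {e})).Valid := by
  induction es with
  | nil => trivial
  | cons e es ih =>
    obtain ⟨h1, h2⟩ := List.nodup_cons.1 h
    refine Ty.valid_fn.2 ⟨?_, ?_, ?_, ih h2⟩
    · intro l hl
      obtain rfl := Finset.mem_singleton.1 hl
      exact ⟨trivial, fun _ => Finset.singleton_nonempty e⟩
    · intro l hl l' hl' hne
      exact absurd ((Finset.mem_singleton.1 hl).trans (Finset.mem_singleton.1 hl').symm) hne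
    · rw [labels_leafTy_singletons, labelUnion, Finset.singleton_biUnion,
        Finset.disjoint_singleton_left, List.mem_toFinset]
      exact h1

theorem spine_leafTy_singletons (es : List Δ) :
    Spine bullet anyArg Γ (es.map fun e => (.sym e.1 0 : Tm L N V)) _
      (leafTy (es.map fun e => {e})) []
      ↑(es.map fun e => (.sym e.1 0 : Tm L (NT N Δ) (VT V Δ))) := by
  induction es with
  | nil => exact spine_nil.2 ⟨rfl, rfl⟩
  | cons e es ih =>
    refine spine_cons.2 ⟨trivial, fun _ => .sym e.1 0, fun _ => {.sym e.1 0}, _, _, ?_, ih, rfl, ?_⟩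
    · intro l hl
      obtain rfl := Finset.mem_singleton.1 hl
      exact .leaf e.1 e.2
    · rw [Finset.sum_singleton]
      rfl

/-- The label of `eᵢ` is always `{eᵢ}`. -/
theorem Spine.labels_subset_of_leaves {es : List Δ} {τ : Ty Δ (Srt.pow es.length .o)}
    {as : List (Tm L (NT N Δ) (VT V Δ))} {ts : Multiset (Tm L (NT N Δ) (VT V Δ))}
    (h : Spine bullet P Γ (es.map fun e => .sym e.1 0) _ τ as ts) : ∀ e ∈ τ.labels, e ∈ es := by
  induction es generalizing as ts with
  | nil =>
    intro e he
    exact absurd he (Finset.notMem_empty e)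
  | cons e es ih =>
    obtain ⟨Λ, τ⟩ := τ
    obtain ⟨-, t, u, as', ts', h1, h2, -, -⟩ := spine_cons.1 h
    intro e' he'
    rcases Finset.mem_union.1 he' with he' | he'
    · obtain ⟨l, hl, he'⟩ := mem_labelUnion.1 he'
      obtain ⟨-, ⟨-, -, -, _, hS⟩ | ⟨h0, -⟩⟩ := (h1 l hl).sym_inv
      · rw [hS] at he'
        rw [Finset.mem_singleton.1 he']
        exact List.mem_cons_self
      · exact absurd h0 (lt_irrefl 0)
    · exact List.mem_cons_of_mem _ (ih h2 e' he')

/-- A type with which a nonterminal can be applied to `e₁, …, eₙ`, where all of these are used, is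
the type `{({e₁}, r)} → … → {({eₙ}, r)} → r`. -/
theorem Spine.eq_leafTy_singletons {es : List Δ} (hes : es.Nodup)
    {τ : Ty Δ (Srt.pow es.length .o)}
    {as : List (Tm L (NT N Δ) (VT V Δ))} {ts : Multiset (Tm L (NT N Δ) (VT V Δ))}
    (h : Spine bullet P Γ (es.map fun e => .sym e.1 0) _ τ as ts)
    (hτ : ∀ e ∈ es, e ∈ τ.labels) :
    (⟨_, τ⟩ : Σ α, Ty Δ α) = ⟨_, leafTy (es.map fun e => {e})⟩ ∧ as = [] ∧
      ts = ↑(es.map fun e => (.sym e.1 0 : Tm L (NT N Δ) (VT V Δ))) := by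
  induction es generalizing as ts with
  | nil =>
    obtain ⟨-, rfl, rfl⟩ := h.eq_nil
    exact ⟨rfl, rfl, rfl⟩
  | cons e es ih =>
    obtain ⟨h1, h2⟩ := List.nodup_cons.1 hes
    obtain ⟨Λ, τ⟩ := τ
    obtain ⟨-, t, u, as', ts', h3, h4, rfl, rfl⟩ := spine_cons.1 h
    have h5 : ∀ l ∈ Λ, l = (({e} : Finset Δ), Ty.r) ∧ u l = {.sym e.1 0} := by
      intro l hl
      obtain ⟨-, ⟨-, -, hu, _, hS⟩ | ⟨h0, -⟩⟩ := (h3 l hl).sym_inv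
      · exact ⟨Prod.ext hS rfl, hu⟩
      · exact absurd h0 (lt_irrefl 0)
    have h6 : Λ = {(({e} : Finset Δ), Ty.r)} := by
      have he := Finset.mem_union.1 (hτ e List.mem_cons_self)
      obtain ⟨l, hl, -⟩ :=
        mem_labelUnion.1 (he.resolve_right fun he => h1 (h4.labels_subset_of_leaves e he))
      ext l'
      rw [Finset.mem_singleton]
      exact ⟨fun hl' => (h5 l' hl').1, fun hl' => hl' ▸ (h5 l hl).1 ▸ hl⟩
    have h7 : ∀ e' ∈ es, e' ∈ τ.labels := by
      intro e' he'
      refine (Finset.mem_union.1 (hτ e' (List.mem_cons_of_mem _ he'))).resolve_left fun h8 => ?_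
      obtain ⟨l, hl, h8⟩ := mem_labelUnion.1 h8
      rw [(h5 l hl).1] at h8
      exact h1 (Finset.mem_singleton.1 h8 ▸ he')
    obtain ⟨h8, rfl, rfl⟩ := ih h2 h4 h7
    refine ⟨?_, rfl, ?_⟩
    · rw [h6]
      exact congrArg (fun p : Σ α, Ty Δ α =>
        (⟨.arr .o p.1, Ty.fn {(({e} : Finset Δ), Ty.r)} p.2⟩ : Σ α, Ty Δ α)) h8
    · rw [Finset.sum_congr rfl fun l hl => (h5 l hl).2, h6, Finset.sum_singleton]
      rfl

/-- The first reduction step of the transformed scheme. -/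
theorem run_lowering_init_iff {S : Scheme L N V} {n : ℕ} {c : Multiset (L × ℕ)} :
    Run (lowering bullet Δ S).rules {.nt none .o} n c ↔ ∃ n' c', n = n' + 1 ∧
      c = (bullet, (enum Δ).length + 1) ::ₘ c' ∧
      Run (lowering bullet Δ S).rules
        (Tm.nt (some (some S.init, ⟨_, leafTy ((enum Δ).map fun e => {e})⟩)) .o ::ₘ
          ↑(leafTms (NT (Option N) Δ) (VT (V ⊕ Δ) Δ) Δ)) n' c' := by
  have hbody : (lowerInitRule bullet (V ⊕ Δ) Δ (some S.init)).body =
      (Tm.sym bullet ((enum Δ).length + 1)).apps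
        (Tm.nt (some (some S.init, ⟨_, leafTy ((enum Δ).map fun e => {e})⟩)) .o ::
          leafTms (NT (Option N) Δ) (VT (V ⊕ Δ) Δ) Δ) := by
    simp [lowerInitRule, merge, leafTy_tr, leafTms]
  have hsubst : ∀ σ, (lowerInitRule bullet (V ⊕ Δ) Δ (some S.init)).body.subst σ =
      (lowerInitRule bullet (V ⊕ Δ) Δ (some S.init)).body := by
    intro σ
    simp [hbody, Tm.subst_apps, Tm.subst, leafTms, Function.comp_def]
  constructor
  · intro h
    obtain ⟨R, hR, hnt, -, -, n', rfl, h⟩ := Run.nt_apps (Ms := []) h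
    rw [lowering_rules] at hR
    rcases hR with rfl | ⟨R, -, Γ, -, -, D, rfl⟩
    · rw [hsubst, hbody] at h
      obtain ⟨-, c', h', rfl⟩ := h.sym_apps
      exact ⟨n', c', rfl, rfl, h'⟩
    · exact absurd hnt (Option.some_ne_none _)
  · rintro ⟨n', c', rfl, rfl, h⟩
    refine Run.rule (lowerInitRule bullet (V ⊕ Δ) Δ (some S.init)) ?_ [] rfl 0 n' _ ?_
    · rw [lowering_rules]
      exact .inl rfl
    · rw [hsubst, hbody]
      have := Run.sym bullet (Tm.nt (some (some S.init,
        ⟨_, leafTy ((enum Δ).map fun e => {e})⟩)) .o ::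
          leafTms (NT (Option N) Δ) (VT (V ⊕ Δ) Δ) Δ) 0 n' c'
          (by rw [add_zero]; exact h)
      simpa [leafTms] using this

end Initial

/-! ### Soundness and completeness of the transformation -/

section Correctness

variable {L : Type u} {N : Type v} {V : Type w} [DecidableEq L] {bullet : L} {Δ : Finset L}

theorem map_normSym_eq_self {c : Multiset (L × ℕ)} (h : ∀ a ∈ leafLetters c, a ∈ Δ) :
    c.map (normSym Δ) = c := by
  refine (Multiset.map_congr rfl fun p hp => ?_).trans (Multiset.map_id c)
  obtain ⟨a, r⟩ := p
  cases r with
  | zero =>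
    have : a ∈ Δ := h a (Multiset.mem_map.2 ⟨(a, 0), Multiset.mem_filter.2 ⟨hp, rfl⟩, rfl⟩)
    simp [normSym, this]
  | succ r => rfl

/-- The leaves of a narrow tree are exactly the symbols from `Δ`, once each. -/
theorem Tm.IsNarrow.leafLetters_syms {T : Tm L N V} (h : T.IsNarrow Δ) :
    leafLetters T.syms = Δ.val := by
  obtain ⟨h1, h2, h3⟩ := h
  rw [leafLetters, ← Tm.leaves_eq_syms]
  refine Multiset.eq_of_le_of_card_le
    ((Multiset.le_iff_subset (Multiset.coe_nodup.2 h2)).2 fun a ha => h3 a ha) ?_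
  rw [Multiset.coe_card, h1]
  exact le_rfl

theorem equivalent_iff {N' V' : Type*} {T : Tm L N V} {T' : Tm L N' V'} :
    Equivalent bullet T T' ↔ visible bullet T.syms = visible bullet T'.syms := by
  rw [Multiset.ext]
  refine forall_congr' fun a => ?_
  rw [Tm.count_eq_syms, Tm.count_eq_syms, visible, visible]
  by_cases h : a = bullet
  · simp [h]
  · rw [Multiset.count_filter_of_pos (p := (· ≠ bullet)) h,
      Multiset.count_filter_of_pos (p := (· ≠ bullet)) h]
    exact ⟨fun h' => h' h, fun h' _ => h'⟩

theorem normRule_wf {S : Scheme L N V} (hS : S.IsHORS) (Δ : Finset L) :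
    ∀ R ∈ normRule Δ '' S.rules, R.vars.Nodup ∧ R.body.HasSort .o ∧
      (∀ x ∈ R.body.vars, x ∈ R.vars) ∧ ∀ a ∈ Δ, (a, 0) ∉ R.body.syms := by
  intro R hR
  obtain ⟨h1, h2, h3⟩ := (hS.normalize Δ).2 R (.inr hR)
  obtain ⟨R, -, rfl⟩ := hR
  exact ⟨h1, h2, h3, fun a ha => leaf_notMem_syms_normTm ha _⟩

/-- The translated initial nonterminal together with `e₁, …, eₙ` is `tr_cum` of a derivation for
`A e₁ … eₙ`, so that soundness for derivations applies. -/
theorem soundness {S : Scheme L N V} (hS : S.IsHORS) (hnarrow : S.IsNarrow Δ)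
    {T' : Tm L (NT (Option N) Δ) (VT (V ⊕ Δ) Δ)} (hT' : (lowering bullet Δ S).Generates T') :
    ∃ T, S.Generates T ∧ Equivalent bullet T T' := by
  obtain ⟨n, h⟩ := Run.of_generates hT'
  obtain ⟨n', c', rfl, hc, h⟩ := run_lowering_init_iff.1 h
  -- A rule can be used for the translated initial nonterminal only if `Δ` is nonempty.
  have hne : (leafTy ((enum Δ).map fun e => {e})).labels.Nonempty := by
    rw [← Multiset.singleton_add] at h
    obtain ⟨n₁, n₂, c₁, c₂, h1, -, -, -⟩ := h.split
    obtain ⟨R, hR, hnt, -⟩ := Run.nt_apps (Ms := []) h1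
    rw [lowering_rules] at hR
    rcases hR with rfl | ⟨R, -, Γ, -, -, D, rfl⟩
    · exact absurd hnt.symm (Option.some_ne_none _)
    · have he : (⟨_, envTy Γ R.vars⟩ : Σ α, Ty Δ α) =
          ⟨_, leafTy ((enum Δ).map fun e => {e})⟩ :=
        congrArg Prod.snd (Option.some.inj hnt)
      have := congrArg (fun p : Σ α, Ty Δ α => p.2.labels) he
      change (envTy Γ R.vars).labels = (leafTy ((enum Δ).map fun e => {e})).labels at this
      rw [← this]
      exact (D.translates (bullet := bullet)).valid.2 rfl
  have htr := translates_nt_apps_iff (bullet := bullet) (P := anyArg) (Γ := noEnv (V ⊕ Δ) Δ)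
    (A := some S.init) (Ks := leafTms (Option N) (V ⊕ Δ) Δ) |>.2
    ⟨_, _, _, valid_leafTy_singletons (nodup_enum Δ), rfl, hne, spine_leafTy_singletons _, rfl, rfl⟩
  rw [leafTy_tr] at htr
  have hwf := normRule_wf hS Δ
  obtain ⟨n₁, c₁, h1, hv⟩ := Run.of_translates (P := normRule Δ '' S.rules)
    (Q := (lowering bullet Δ S).rules) (fun R hR => ⟨(hwf R hR).1, (hwf R hR).2.2.2⟩)
    (by
      rw [lowering_rules]
      rintro R' (rfl | hR')
      · exact .inl rfl
      · exact .inr hR') htr h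
  have hclose : closeTm Δ (.nt S.init .o : Tm L N V) = _ := closeTm_nt Δ S.init .o
  rw [List.length_map, ← hclose] at h1
  obtain ⟨n₂, c₂, h2, rfl⟩ := h1.of_normalize (fun R hR => (hS.2 R hR).2.2) rfl
  obtain ⟨T, hT, rfl⟩ := hS.exists_generates_iff.2 ⟨n₂, h2⟩
  refine ⟨T, hT, equivalent_iff.2 ?_⟩
  rw [map_normSym_eq_self fun a ha => by
    rwa [(hnarrow T hT).leafLetters_syms] at ha] at hv
  rw [hv, hc, visible_cons_bullet]

/-- A reduction of `A e₁ … eₙ` to a narrow tree yields a derivation with label `Δ`; its `tr_cum` is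
the right side of the initial rule. -/
theorem completeness {S : Scheme L N V} (hS : S.IsHORS) (hnarrow : S.IsNarrow Δ)
    {T : Tm L N V} (hT : S.Generates T) :
    ∃ T', (lowering bullet Δ S).Generates T' ∧ Equivalent bullet T T' := by
  have hleaf := (hnarrow T hT).leafLetters_syms
  obtain ⟨n, h⟩ := Run.of_generates hT
  have h1 := h.normalize (fun R hR => (hS.2 R hR).2.2) Δ
  rw [map_normSym_eq_self fun a ha => by rwa [hleaf] at ha, Multiset.map_singleton,
    closeTm_nt] at h1
  obtain ⟨X, t, ts, n', c', h2, hX, h3, hv⟩ := h1.exists_translates (bullet := bullet)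
    (Q := (lowering bullet Δ S).rules) (normRule_wf hS Δ)
    (by rw [lowering_rules]; exact Set.subset_union_right)
    (by
      refine Tm.hasSort_apps.2 ⟨List.replicate (enum Δ).length .o, ?_, ?_⟩
      · rw [← Srt.pow_eq_arrs]
        exact .nt _ _
      · rw [leafTms]
        generalize enum Δ = es
        induction es with
        | nil => exact .nil
        | cons e es ih => exact .cons (.sym e.1 0) ih)
    (hleaf ▸ Δ.nodup) (fun a ha => by rwa [hleaf] at ha)
  obtain ⟨σ, as, ts', -, rfl, -, h4, rfl, rfl⟩ := translates_nt_apps_iff.1 h2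
  obtain ⟨h5, rfl, rfl⟩ := h4.eq_leafTy_singletons (nodup_enum Δ) fun e _ => by
    have : e.1 ∈ σ.labels.val.map Subtype.val := by
      rw [hX, hleaf]
      exact e.2
    obtain ⟨e', he', h⟩ := Multiset.mem_map.1 this
    rwa [← Subtype.ext h]
  have htr : σ.tr = .o := by
    have := congrArg (fun p : Σ α, Ty Δ α => p.2.tr) h5
    exact this.trans (leafTy_tr _)
  rw [h5, htr] at h3
  obtain ⟨T', hT', he⟩ := (hS.lowering bullet).exists_generates_iff.2
    ⟨_, run_lowering_init_iff.2 ⟨_, _, rfl, rfl, h3⟩⟩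
  refine ⟨T', hT', equivalent_iff.2 ?_⟩
  rw [he, visible_cons_bullet, hv]

theorem diag_lowering_iff {S : Scheme L N V} (hS : S.IsHORS) (hnarrow : S.IsNarrow Δ)
    {Sig : Set L} (hb : bullet ∉ Sig) : S.Diag Sig ↔ (lowering bullet Δ S).Diag Sig := by
  refine forall_congr' fun n => ⟨?_, ?_⟩
  · rintro ⟨T, hT, h⟩
    obtain ⟨T', hT', he⟩ := completeness (bullet := bullet) hS hnarrow hT
    exact ⟨T', hT', fun a ha => (h a ha).trans_eq (he a (ne_of_mem_of_not_mem ha hb))⟩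
  · rintro ⟨T', hT', h⟩
    obtain ⟨T, hT, he⟩ := soundness hS hnarrow hT'
    exact ⟨T, hT, fun a ha => (h a ha).trans_eq (he a (ne_of_mem_of_not_mem ha hb)).symm⟩

end Correctness

end Hors

theorem mainTheorem2 {L N V : Type*} [DecidableEq L] (Δ : Finset L) (k : ℕ) (hk : 1 ≤ k)
    (S : Hors.Scheme L N V) (hS : S.IsHORS) (hnarrow : S.IsNarrow Δ) (horder : S.order = k)
    (bullet : L) (hbullet : S.NotUsed bullet) :
    (Hors.lowering bullet Δ S).IsHORS ∧
    (Hors.lowering bullet Δ S).order ≤ k - 1 ∧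
    (∀ T', (Hors.lowering bullet Δ S).Generates T' →
      ∃ T, S.Generates T ∧ Hors.Equivalent bullet T T') ∧
    (∀ T, S.Generates T →
      ∃ T', (Hors.lowering bullet Δ S).Generates T' ∧ Hors.Equivalent bullet T T') ∧
    (∀ Sig : Set L, bullet ∉ Sig →
      (S.Diag Sig ↔ (Hors.lowering bullet Δ S).Diag Sig)) := by
  refine ⟨hS.lowering bullet, Hors.order_lowering_le bullet hS hk horder,
    fun _ hT' => Hors.soundness hS hnarrow hT', fun _ hT => Hors.completeness hS hnarrow hT,
    fun _ hb => Hors.diag_lowering_iff hS hnarrow hb⟩
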